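/- Let $\Lambda$ be a reduced dg Lie algebra over $\mathbb{Q}$ (homologically graded and concentrated in degrees $\ge 1$), for example the Quillen model $\Lambda_X$ of a simply connected space $X$, and let $A=\mathcal{U}\Lambda$ be its universal enveloping dg algebra. A dg $\Lambda$-representation is a left dg $A$-module in possibly unbounded chain complexes of rational vector spaces. Let $V$ and $W$ be dg $\Lambda$-representations such that $H_nV=0$ for all sufficiently small $n$ and $H_nW=0$ for all sufficiently large $n$. Let $B(A,V)$ be the bar resolution of $V$, that is, the total dg $A$-module of the normalised simplicial bar construction, with $A\otimes\overline{A}^{\otimes p}\otimes V$ in simplicial degree $p$, where $\overline{A}=A/\mathbb{Q}$. Let $B_p(A,V)\subseteq B(A,V)$ be its $p$-skeleton, spanned by the simplicial degrees $\le p$ (so $B_p(A,V)=0$ for $p<0$). Write $[M,N]_A$ for the chain complex of $A$-linear homogeneous maps $M\to N$, and put $\mathrm{Ext}^n_A(V,W):=H_n\,[B(A,V),W]_A$. Filter $[B(A,V),W]_A$ by the subcomplexes $$F^p=\ker\big([B(A,V),W]_A\to[B_{p-1}(A,V),W]_A\big),$$ and give $\mathrm{Ext}^n_A(V,W)$ the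 induced filtration $F^p\,\mathrm{Ext}^n_A(V,W)=\mathrm{im}\,(H_nF^p\to H_n[B(A,V),W]_A)$. Then the spectral sequence $(E_r,d_r)_{r\ge1}$ of this filtered complex, indexed so that $E_r^{p,q}$ is the term of filtration $p$ and homological degree $q-p$, with $d_r\colon E_r^{p,q}\to E_r^{p+r,\,q+r-1}$, has the following properties. 1. For $p\ge 0$ and all $q$ there is an isomorphism of rational vector spaces $$E_2^{p,q}\cong\mathrm{Ext}^{p,q}_{H_\bullet(A)}\big(H_\bullet(V),H_\bullet(W)\big),$$ and $E_2^{p,q}=0$ for $p<0$. Here $\mathrm{Ext}^{p,q}$ is the $p$-th cohomology of the complex of $H_\bullet(A)$-linear maps of internal degree $q$ from any projective resolution of $H_\bullet(V)$ by graded $H_\bullet(A)$-modules (such resolutions exist) to $H_\bullet(W)$. 2. It converges strongly to $\mathrm{Ext}^{q-p}_A(V,W)$: for each $n$ the filtration of $\mathrm{Ext}^n_A(V,W)$ is finite, that is, $F^p=\mathrm{Ext}^n_A(V,W)$ for some $p$ and $F^p=0$ for some $p$; and for each $(p,q)$ the differentials into and out of $E_r^{p,q}$ vanish for all sufficiently large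 $r$, and the stable value satisfies $$E_\infty^{p,q}\cong F^p\,\mathrm{Ext}^{q-p}_A(V,W)\,/\,F^{p+1}\,\mathrm{Ext}^{q-p}_A(V,W).$$ -/

import Mathlib

universe u

namespace HyperExt

open scoped TensorProduct

/-! ## Gradings of rational vector spaces -/

section Gradings

variable {M : Type*} [AddCommGroup M] [Module ℚ M] {𝓜 : ℤ → Submodule ℚ M}

/-- The family of homogeneous components of an element of a graded vector space. -/
noncomputable def components (h : DirectSum.IsInternal 𝓜) : M →ₗ[ℚ] (ℤ →₀ M) :=
  DirectSum.toModule ℚ ℤ (ℤ →₀ M) (fun n => Finsupp.lsingle n ∘ₗ (𝓜 n).subtype) ∘ₗ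
    (LinearEquiv.ofBijective (DirectSum.coeLinearMap 𝓜) h).symm.toLinearMap

/-- The projection of a graded vector space onto its part of degree `n`. -/
noncomputable def component (h : DirectSum.IsInternal 𝓜) (n : ℤ) : M →ₗ[ℚ] M :=
  Finsupp.lapply n ∘ₗ components h

/-- The parity involution: multiplication by `(-1) ^ n` in degree `n`. -/
noncomputable def parity (h : DirectSum.IsInternal 𝓜) : M →ₗ[ℚ] M :=
  DirectSum.toModule ℚ ℤ M (fun n => (-1 : ℚ) ^ n • (𝓜 n).subtype) ∘ₗ
    (LinearEquiv.ofBijective (DirectSum.coeLinearMap 𝓜) h).symm.toLinearMap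

theorem ofBijective_symm_of_mem (h : DirectSum.IsInternal 𝓜) {n : ℤ} {x : M} (hx : x ∈ 𝓜 n) :
    (LinearEquiv.ofBijective (DirectSum.coeLinearMap 𝓜) h).symm x =
      DirectSum.lof ℚ ℤ (fun i => 𝓜 i) n ⟨x, hx⟩ :=
  (LinearEquiv.symm_apply_eq _).2 (DirectSum.coeLinearMap_lof 𝓜 n ⟨x, hx⟩).symm

theorem components_of_mem (h : DirectSum.IsInternal 𝓜) {n : ℤ} {x : M} (hx : x ∈ 𝓜 n) :
    components h x = Finsupp.single n x := by
  simp [components, ofBijective_symm_of_mem h hx]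

theorem component_of_mem (h : DirectSum.IsInternal 𝓜) {n : ℤ} {x : M} (hx : x ∈ 𝓜 n) :
    component h n x = x := by
  simp [component, components_of_mem h hx]

theorem component_of_mem_ne (h : DirectSum.IsInternal 𝓜) {m n : ℤ} (hmn : m ≠ n) {x : M}
    (hx : x ∈ 𝓜 m) : component h n x = 0 := by
  simp [component, components_of_mem h hx, hmn]

theorem parity_of_mem (h : DirectSum.IsInternal 𝓜) {n : ℤ} {x : M} (hx : x ∈ 𝓜 n) :
    parity h x = (-1 : ℚ) ^ n • x := by
  simp [parity, ofBijective_symm_of_mem h hx]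

theorem graded_induction (h : DirectSum.IsInternal 𝓜) {P : M → Prop} (x : M)
    (mem : ∀ n, ∀ y ∈ 𝓜 n, P y) (zero : P 0) (add : ∀ y z, P y → P z → P (y + z)) : P x := by
  have hx : x ∈ ⨆ n, 𝓜 n := by rw [h.submodule_iSup_eq_top]; trivial
  exact Submodule.iSup_induction 𝓜 (motive := P) hx mem zero add

theorem parity_parity (h : DirectSum.IsInternal 𝓜) (x : M) : parity h (parity h x) = x := by
  induction x using graded_induction h with
  | mem n y hy =>
    rw [parity_of_mem h hy, map_smul, parity_of_mem h hy, smul_smul, ← mul_zpow]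
    simp
  | zero => simp
  | add y z hy hz => simp only [map_add, hy, hz]

theorem component_mem (h : DirectSum.IsInternal 𝓜) (n : ℤ) (x : M) :
    component h n x ∈ 𝓜 n := by
  induction x using graded_induction h with
  | mem m y hy =>
    by_cases hmn : m = n
    · subst hmn; rwa [component_of_mem h hy]
    · rw [component_of_mem_ne h hmn hy]; exact zero_mem _
  | zero => simp
  | add y z hy hz => rw [map_add]; exact add_mem hy hz

theorem isInternal_of_weight (Ψ : M →ₗ[ℚ] (ℤ →₀ M))
    (hΨ : ∀ n, ∀ x ∈ 𝓜 n, Ψ x = Finsupp.single n x) (top : ∀ x, x ∈ ⨆ n, 𝓜 n) :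
    DirectSum.IsInternal 𝓜 := by
  refine DirectSum.isInternal_submodule_of_iSupIndep_of_iSup_eq_top ?_ (by ext; simp [top])
  rw [iSupIndep_def]
  intro n
  rw [Submodule.disjoint_def]
  intro x hx hx'
  have h1 : (Finsupp.lapply n ∘ₗ Ψ) x = x := by simp [hΨ n x hx]
  have h2 : (⨆ (j) (_ : j ≠ n), 𝓜 j) ≤ LinearMap.ker (Finsupp.lapply n ∘ₗ Ψ) := by
    refine iSup₂_le fun j hj y hy => ?_
    simp [hΨ j y hy, hj]
  rw [← h1]; exact h2 hx'

/-- The image of a grading under a surjection whose kernel is a graded subspace. -/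
theorem isInternal_map (h : DirectSum.IsInternal 𝓜) {N : Type*} [AddCommGroup N] [Module ℚ N]
    (f : M →ₗ[ℚ] N) (hf : Function.Surjective f)
    (hker : ∀ n x, f x = 0 → f (component h n x) = 0) :
    DirectSum.IsInternal (fun n => (𝓜 n).map f) := by
  refine DirectSum.isInternal_submodule_of_iSupIndep_of_iSup_eq_top ?_ ?_
  · rw [iSupIndep_def]
    intro n
    rw [Submodule.disjoint_def]
    rintro _ ⟨x, hx, rfl⟩ hx'
    simp_rw [← Submodule.map_iSup] at hx'
    obtain ⟨x', hx', e⟩ := hx'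
    have h2 : (⨆ (j) (_ : j ≠ n), 𝓜 j) ≤ LinearMap.ker (component h n) :=
      iSup₂_le fun j hj y hy => component_of_mem_ne h hj hy
    have h3 := hker n (x - x') (by rw [map_sub, e, sub_self])
    rwa [map_sub, component_of_mem h hx, show component h n x' = 0 from h2 hx', sub_zero] at h3
  · rw [← Submodule.map_iSup, h.submodule_iSup_eq_top, Submodule.map_top,
      LinearMap.range_eq_top.2 hf]

/-- The grading of a graded subspace. -/
theorem isInternal_comap (h : DirectSum.IsInternal 𝓜) (N : Submodule ℚ M)
    (hN : ∀ n, ∀ x ∈ N, component h n x ∈ N) :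
    DirectSum.IsInternal (fun n => (𝓜 n).comap N.subtype) := by
  refine DirectSum.isInternal_submodule_of_iSupIndep_of_iSup_eq_top ?_ ?_
  · rw [iSupIndep_def]
    intro n
    rw [Submodule.disjoint_def]
    intro x hx hx'
    have h2 : (⨆ (j) (_ : j ≠ n), (𝓜 j).comap N.subtype) ≤
        LinearMap.ker (component h n ∘ₗ N.subtype) :=
      iSup₂_le fun j hj y hy => component_of_mem_ne h hj hy
    have h3 : component h n (x : M) = 0 := h2 hx'
    exact Subtype.ext ((component_of_mem h hx).symm.trans h3)
  · have key : ∀ x : M, ∃ s : Finset ℤ, x = ∑ n ∈ s, component h n x := by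
      intro x
      refine ⟨(components h x).support, ?_⟩
      have : ∀ x : M, x = (Finsupp.lsum ℚ fun _ : ℤ => (LinearMap.id : M →ₗ[ℚ] M))
          (components h x) := by
        intro x
        induction x using graded_induction h with
        | mem m y hy => simp [components_of_mem h hy]
        | zero => simp
        | add y z hy hz => rw [map_add, map_add, ← hy, ← hz]
      conv_lhs => rw [this x]
      simp [Finsupp.lsum_apply, Finsupp.sum, component]
    rw [eq_top_iff]
    rintro x -
    obtain ⟨s, hs⟩ := key x
    have : x = ∑ n ∈ s, (⟨component h n x, hN n x x.2⟩ : N) := by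
      ext; simp [← hs]
    rw [this]
    exact Submodule.sum_mem _ fun n _ => Submodule.mem_iSup_of_mem n (component_mem h n _)

/-- A linear map of degree `e` commutes with the projections onto homogeneous parts. -/
theorem map_component (h : DirectSum.IsInternal 𝓜) {N : Type*} [AddCommGroup N] [Module ℚ N]
    {𝓝 : ℤ → Submodule ℚ N} (h' : DirectSum.IsInternal 𝓝) (f : M →ₗ[ℚ] N) (e : ℤ)
    (hf : ∀ n, ∀ x ∈ 𝓜 n, f x ∈ 𝓝 (n + e)) (n : ℤ) (x : M) :
    f (component h n x) = component h' (n + e) (f x) := by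
  induction x using graded_induction h with
  | mem m y hy =>
    by_cases hmn : m = n
    · subst hmn; rw [component_of_mem h hy, component_of_mem h' (hf _ _ hy)]
    · rw [component_of_mem_ne h hmn hy, component_of_mem_ne h' (by lia) (hf _ _ hy), map_zero]
  | zero => simp
  | add y z hy hz => simp only [map_add, hy, hz]

theorem map_parity (h : DirectSum.IsInternal 𝓜) {N : Type*} [AddCommGroup N] [Module ℚ N]
    {𝓝 : ℤ → Submodule ℚ N} (h' : DirectSum.IsInternal 𝓝) (f : M →ₗ[ℚ] N)
    (hf : ∀ n, ∀ x ∈ 𝓜 n, f x ∈ 𝓝 n) (x : M) :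
    f (parity h x) = parity h' (f x) := by
  induction x using graded_induction h with
  | mem m y hy => rw [parity_of_mem h hy, parity_of_mem h' (hf _ _ hy), map_smul]
  | zero => simp
  | add y z hy hz => simp only [map_add, hy, hz]

/-- The grading of a subquotient. -/
theorem isInternal_subquotient (h : DirectSum.IsInternal 𝓜) (K : Submodule ℚ M)
    (hK : ∀ n, ∀ x ∈ K, component h n x ∈ K) {N : Type*} [AddCommGroup N] [Module ℚ N]
    (f : K →ₗ[ℚ] N) (hf : Function.Surjective f)
    (hker : ∀ n (x : K), f x = 0 → f ⟨component h n x, hK n x x.2⟩ = 0) :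
    DirectSum.IsInternal (fun n => ((𝓜 n).comap K.subtype).map f) := by
  refine isInternal_map (isInternal_comap h K hK) f hf fun n x hx => ?_
  convert hker n x hx using 2
  ext
  have h2 := map_component (isInternal_comap h K hK) h K.subtype 0
    (fun m x hx => by simpa using hx) n x
  rw [add_zero] at h2
  exact h2

end Gradings

/-! ## Differential graded algebras and modules -/

/-- A `ℤ`-graded (associative, unital) algebra over `ℚ`. -/
structure GrAlg : Type (u + 1) where
  carrier : Type u
  [ring : Ring carrier]
  [algebra : Algebra ℚ carrier]
  gr : ℤ → Submodule ℚ carrier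
  internal : DirectSum.IsInternal gr
  one_mem : (1 : carrier) ∈ gr 0
  mul_mem : ∀ {i j : ℤ} {a b : carrier}, a ∈ gr i → b ∈ gr j → a * b ∈ gr (i + j)

attribute [instance] GrAlg.ring GrAlg.algebra

/-- A dg algebra over `ℚ`, homologically graded. -/
structure DGAlg : Type (u + 1) extends GrAlg.{u} where
  d : carrier →ₗ[ℚ] carrier
  d_mem : ∀ {i : ℤ} {a : carrier}, a ∈ gr i → d a ∈ gr (i - 1)
  d_d : ∀ a : carrier, d (d a) = 0
  d_mul : ∀ {i : ℤ} {a : carrier} (b : carrier), a ∈ gr i →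
    d (a * b) = d a * b + (-1 : ℚ) ^ i • (a * d b)

/-- A `ℤ`-graded left module over a graded algebra. -/
structure GrMod (R : GrAlg.{u}) : Type (u + 1) where
  carrier : Type u
  [addCommGroup : AddCommGroup carrier]
  [moduleRat : Module ℚ carrier]
  [module : Module R.carrier carrier]
  [tower : IsScalarTower ℚ R.carrier carrier]
  gr : ℤ → Submodule ℚ carrier
  internal : DirectSum.IsInternal gr
  smul_mem : ∀ {i j : ℤ} {a : R.carrier} {x : carrier}, a ∈ R.gr i → x ∈ gr j → a • x ∈ gr (i + j)

attribute [instance] GrMod.addCommGroup GrMod.moduleRat GrMod.module GrMod.tower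

/-- A left dg module over a dg algebra; the underlying chain complex may be unbounded. -/
structure DGMod (A : DGAlg.{u}) : Type (u + 1) extends GrMod.{u} A.toGrAlg where
  d : carrier →ₗ[ℚ] carrier
  d_mem : ∀ {i : ℤ} {x : carrier}, x ∈ gr i → d x ∈ gr (i - 1)
  d_d : ∀ x : carrier, d (d x) = 0
  d_smul : ∀ {i : ℤ} {a : A.carrier} (x : carrier), a ∈ A.gr i →
    d (a • x) = A.d a • x + (-1 : ℚ) ^ i • (a • d x)

instance GrMod.smulComm {R : GrAlg.{u}} (M : GrMod R) :
    SMulCommClass R.carrier ℚ M.carrier := IsScalarTower.to_smulCommClass'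

namespace DGAlg

variable (A : DGAlg.{u})

theorem d_mul' (a b : A.carrier) : A.d (a * b) = A.d a * b + parity A.internal a * A.d b := by
  induction a using graded_induction A.internal with
  | mem n y hy => rw [A.d_mul b hy, parity_of_mem A.internal hy, smul_mul_assoc]
  | zero => simp
  | add y z hy hz => simp only [add_mul, map_add, hy, hz]; abel

theorem d_one : A.d 1 = 0 := by
  have := A.d_mul 1 A.one_mem
  simpa using this

theorem component_d (n : ℤ) (a : A.carrier) :
    A.d (component A.internal n a) = component A.internal (n - 1) (A.d a) :=
  map_component A.internal A.internal A.d (-1) (fun _ _ h => A.d_mem h) n a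

theorem parity_d (a : A.carrier) :
    parity A.internal (A.d a) = - A.d (parity A.internal a) := by
  induction a using graded_induction A.internal with
  | mem n y hy =>
    rw [parity_of_mem A.internal hy, parity_of_mem A.internal (A.d_mem hy), map_smul,
      zpow_sub_one₀ (by norm_num), ← neg_smul]
    congr 1; norm_num
  | zero => simp
  | add y z hy hz => simp only [map_add, hy, hz]; abel

/-! ### The homology algebra -/

/-- The algebra of cycles. -/
def cycles : Subalgebra ℚ A.carrier where
  carrier := {a | A.d a = 0}
  mul_mem' {a b} ha hb := by
    simp only [Set.mem_ofPred_eq] at *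
    rw [A.d_mul', ha, hb, zero_mul, mul_zero, add_zero]
  add_mem' {a b} ha hb := by
    simp only [Set.mem_ofPred_eq] at *
    rw [map_add, ha, hb, add_zero]
  algebraMap_mem' q := by
    simp [Algebra.algebraMap_eq_smul_one, A.d_one]

theorem mem_cycles {a : A.carrier} : a ∈ A.cycles ↔ A.d a = 0 := Iff.rfl

/-- The ideal of boundaries in the algebra of cycles. -/
def boundaries : Ideal A.cycles where
  carrier := {z | ∃ b, A.d b = z}
  add_mem' := by
    rintro _ _ ⟨b, hb⟩ ⟨c, hc⟩
    exact ⟨b + c, by simp [hb, hc]⟩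
  zero_mem' := ⟨0, by simp⟩
  smul_mem' := by
    rintro ⟨z, hz⟩ _ ⟨b, hb⟩
    refine ⟨parity A.internal z * b, ?_⟩
    have h0 : A.d (parity A.internal z) = 0 := by
      rw [← neg_eq_zero, ← A.parity_d, A.mem_cycles.1 hz, map_zero]
    rw [A.d_mul', h0, parity_parity, hb]
    simp

instance : A.boundaries.IsTwoSided where
  mul_mem_of_left := by
    rintro _ ⟨c, hc⟩ ⟨b, hb⟩
    refine ⟨b * c, ?_⟩
    rw [A.d_mul', hb, A.mem_cycles.1 hc]
    simp

/-- The quotient map from cycles to homology classes. -/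
def homologyMk : A.cycles →ₗ[ℚ] A.cycles ⧸ A.boundaries :=
  (A.boundaries.mkQ).restrictScalars ℚ

theorem homologyMk_eq_zero {z : A.cycles} : A.homologyMk z = 0 ↔ ∃ b, A.d b = z := by
  change Submodule.Quotient.mk z = (0 : A.cycles ⧸ A.boundaries) ↔ _
  rw [Submodule.Quotient.mk_eq_zero]; rfl

theorem component_mem_cycles (n : ℤ) {a : A.carrier} (ha : a ∈ A.cycles) :
    component A.internal n a ∈ A.cycles := by
  rw [A.mem_cycles, A.component_d, A.mem_cycles.1 ha, map_zero]

theorem homologyMk_surjective : Function.Surjective A.homologyMk := fun x => by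
  obtain ⟨z, rfl⟩ := Submodule.Quotient.mk_surjective _ x
  exact ⟨z, rfl⟩

theorem homology_internal : DirectSum.IsInternal
    (fun n => ((A.gr n).comap A.cycles.toSubmodule.subtype).map A.homologyMk) := by
  refine isInternal_subquotient A.internal A.cycles.toSubmodule
    (fun n x hx => A.component_mem_cycles n hx) A.homologyMk A.homologyMk_surjective ?_
  intro n z hz
  obtain ⟨b, hb⟩ := A.homologyMk_eq_zero.1 hz
  refine A.homologyMk_eq_zero.2 ⟨component A.internal (n + 1) b, ?_⟩
  rw [A.component_d, hb, add_sub_cancel_right]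

/-- The homology `H(A)`, with the algebra structure induced by that of `A`. -/
noncomputable def homology : GrAlg.{u} where
  carrier := A.cycles ⧸ A.boundaries
  gr n := ((A.gr n).comap A.cycles.toSubmodule.subtype).map A.homologyMk
  internal := A.homology_internal
  one_mem := ⟨1, A.one_mem, rfl⟩
  mul_mem := by
    rintro i j _ _ ⟨a, ha, rfl⟩ ⟨b, hb, rfl⟩
    exact ⟨a * b, A.mul_mem ha hb, rfl⟩

end DGAlg

namespace DGMod

variable {A : DGAlg.{u}} (V : DGMod A)

theorem d_smul' (a : A.carrier) (x : V.carrier) :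
    V.d (a • x) = A.d a • x + parity A.internal a • V.d x := by
  induction a using graded_induction A.internal with
  | mem n y hy => rw [V.d_smul x hy, parity_of_mem A.internal hy, smul_assoc]
  | zero => simp
  | add y z hy hz => simp only [add_smul, map_add, hy, hz]; abel

theorem component_d (n : ℤ) (x : V.carrier) :
    V.d (component V.internal n x) = component V.internal (n - 1) (V.d x) :=
  map_component V.internal V.internal V.d (-1) (fun _ _ h => V.d_mem h) n x

theorem parity_d (x : V.carrier) :
    parity V.internal (V.d x) = - V.d (parity V.internal x) := by
  induction x using graded_induction V.internal with
  | mem n y hy =>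
    rw [parity_of_mem V.internal hy, parity_of_mem V.internal (V.d_mem hy), map_smul,
      zpow_sub_one₀ (by norm_num), ← neg_smul]
    congr 1; norm_num
  | zero => simp
  | add y z hy hz => simp only [map_add, hy, hz]; abel

theorem parity_smul (a : A.carrier) (x : V.carrier) :
    parity V.internal (a • x) = parity A.internal a • parity V.internal x := by
  induction a using graded_induction A.internal with
  | mem n a ha =>
    induction x using graded_induction V.internal with
    | mem m x hx =>
      rw [parity_of_mem _ ha, parity_of_mem _ hx, parity_of_mem _ (V.smul_mem ha hx),
        zpow_add₀ (by norm_num), smul_comm _ ((-1 : ℚ) ^ m), smul_assoc, smul_smul, mul_comm]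
    | zero => simp
    | add y z hy hz => simp only [smul_add, map_add, hy, hz]
  | zero => simp
  | add y z hy hz => simp only [add_smul, map_add, hy, hz]

/-! ### The homology module -/

/-- The cycles of a dg module, a module over the cycles of the algebra. -/
def cycles : Submodule A.cycles V.carrier where
  carrier := {x | V.d x = 0}
  add_mem' {a b} ha hb := by
    simp only [Set.mem_ofPred_eq] at *
    rw [map_add, ha, hb, add_zero]
  zero_mem' := by simp
  smul_mem' := by
    rintro ⟨a, ha⟩ x hx
    simp only [Set.mem_ofPred_eq] at *
    change V.d (a • x) = 0
    rw [V.d_smul', hx, A.mem_cycles.1 ha, zero_smul, smul_zero, add_zero]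

theorem mem_cycles {x : V.carrier} : x ∈ V.cycles ↔ V.d x = 0 := Iff.rfl

/-- The boundaries, as a submodule of the cycles. -/
def boundaries : Submodule A.cycles V.cycles where
  carrier := {z | ∃ y, V.d y = z}
  add_mem' := by
    rintro _ _ ⟨b, hb⟩ ⟨c, hc⟩
    exact ⟨b + c, by simp [hb, hc]⟩
  zero_mem' := ⟨0, by simp⟩
  smul_mem' := by
    rintro ⟨a, ha⟩ _ ⟨y, hy⟩
    refine ⟨parity A.internal a • y, ?_⟩
    have h0 : A.d (parity A.internal a) = 0 := by
      rw [← neg_eq_zero, ← A.parity_d, A.mem_cycles.1 ha, map_zero]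
    rw [V.d_smul', h0, parity_parity, hy, zero_smul, zero_add]
    rfl

/-- The quotient map from cycles to homology classes. -/
def homologyMk : (V.cycles.restrictScalars ℚ) →ₗ[ℚ] V.cycles ⧸ V.boundaries :=
  (V.boundaries.mkQ).restrictScalars ℚ

theorem homologyMk_eq_zero {z : V.cycles} : V.homologyMk z = 0 ↔ ∃ y, V.d y = z := by
  change Submodule.Quotient.mk z = (0 : V.cycles ⧸ V.boundaries) ↔ _
  rw [Submodule.Quotient.mk_eq_zero]; rfl

theorem homologyMk_surjective : Function.Surjective V.homologyMk := fun x => by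
  obtain ⟨z, rfl⟩ := Submodule.Quotient.mk_surjective _ x
  exact ⟨z, rfl⟩

theorem component_mem_cycles (n : ℤ) {x : V.carrier} (hx : x ∈ V.cycles) :
    component V.internal n x ∈ V.cycles := by
  rw [V.mem_cycles, V.component_d, V.mem_cycles.1 hx, map_zero]

theorem homology_internal : DirectSum.IsInternal
    (fun n => ((V.gr n).comap (V.cycles.restrictScalars ℚ).subtype).map V.homologyMk) := by
  refine isInternal_subquotient V.internal (V.cycles.restrictScalars ℚ)
    (fun n x hx => V.component_mem_cycles n hx) V.homologyMk V.homologyMk_surjective ?_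
  intro n z hz
  obtain ⟨y, hy⟩ := V.homologyMk_eq_zero.1 hz
  refine V.homologyMk_eq_zero.2 ⟨component V.internal (n + 1) y, ?_⟩
  rw [V.component_d, hy, add_sub_cancel_right]

theorem isTorsion : Module.IsTorsionBySet A.cycles (V.cycles ⧸ V.boundaries) A.boundaries := by
  rintro x ⟨_, b, hb⟩
  obtain ⟨z, rfl⟩ := Submodule.Quotient.mk_surjective _ x
  rw [← Submodule.Quotient.mk_smul, Submodule.Quotient.mk_eq_zero]
  refine ⟨b • (z : V.carrier), ?_⟩
  rw [V.d_smul', V.mem_cycles.1 z.2, smul_zero, add_zero, hb]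
  rfl

/-- The homology `H(V)`, a graded `H(A)`-module. -/
noncomputable def homology : GrMod A.homology :=
  letI : Module A.homology.carrier (V.cycles ⧸ V.boundaries) := V.isTorsion.module
  { carrier := V.cycles ⧸ V.boundaries
    tower := V.isTorsion.isScalarTower
    gr := fun n => ((V.gr n).comap (V.cycles.restrictScalars ℚ).subtype).map V.homologyMk
    internal := V.homology_internal
    smul_mem := by
      rintro i j _ _ ⟨a, ha, rfl⟩ ⟨x, hx, rfl⟩
      exact ⟨(a • x : V.cycles), V.smul_mem ha hx, rfl⟩ }

/-- The homology of `V` vanishes in all sufficiently small degrees. -/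
def BoundedBelow : Prop := ∃ k : ℤ, ∀ n ≤ k, V.homology.gr n = ⊥

/-- The homology of `V` vanishes in all sufficiently large degrees. -/
def BoundedAbove : Prop := ∃ l : ℤ, ∀ n ≥ l, V.homology.gr n = ⊥

end DGMod

/-! ## Reduced dg Lie algebras and their universal enveloping algebras -/

/-- A reduced dg Lie algebra over `ℚ` (homologically graded, concentrated in degrees `≥ 1`). -/
structure DGLie : Type (u + 1) where
  carrier : Type u
  [addCommGroup : AddCommGroup carrier]
  [module : Module ℚ carrier]
  gr : ℤ → Submodule ℚ carrier
  internal : DirectSum.IsInternal gr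
  reduced : ∀ i ≤ 0, gr i = ⊥
  bracket : carrier →ₗ[ℚ] carrier →ₗ[ℚ] carrier
  bracket_mem : ∀ {i j : ℤ} {x y : carrier}, x ∈ gr i → y ∈ gr j → bracket x y ∈ gr (i + j)
  bracket_skew : ∀ {i j : ℤ} {x y : carrier}, x ∈ gr i → y ∈ gr j →
    bracket x y = -((-1 : ℚ) ^ (i * j) • bracket y x)
  jacobi : ∀ {i j k : ℤ} {x y z : carrier}, x ∈ gr i → y ∈ gr j → z ∈ gr k →
    bracket x (bracket y z) =
      bracket (bracket x y) z + (-1 : ℚ) ^ (i * j) • bracket y (bracket x z)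
  d : carrier →ₗ[ℚ] carrier
  d_mem : ∀ {i : ℤ} {x : carrier}, x ∈ gr i → d x ∈ gr (i - 1)
  d_d : ∀ x : carrier, d (d x) = 0
  d_bracket : ∀ {i j : ℤ} {x y : carrier}, x ∈ gr i → y ∈ gr j →
    d (bracket x y) = bracket (d x) y + (-1 : ℚ) ^ i • bracket x (d y)

attribute [instance] DGLie.addCommGroup DGLie.module

namespace DGLie

variable (L : DGLie.{u})

/-- The defining relations `x y - (-1) ^ (|x| |y|) y x = [x, y]`. -/
inductive Rel : TensorAlgebra ℚ L.carrier → TensorAlgebra ℚ L.carrier → Prop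
  | of {i j : ℤ} {x y : L.carrier} (hx : x ∈ L.gr i) (hy : y ∈ L.gr j) :
    Rel (TensorAlgebra.ι ℚ x * TensorAlgebra.ι ℚ y)
      ((-1 : ℚ) ^ (i * j) • (TensorAlgebra.ι ℚ y * TensorAlgebra.ι ℚ x) +
        TensorAlgebra.ι ℚ (L.bracket x y))

/-- The algebra underlying the universal enveloping algebra. -/
abbrev Env : Type u := RingQuot L.Rel

/-- The canonical map from the Lie algebra to its universal enveloping algebra. -/
noncomputable def ι : L.carrier →ₗ[ℚ] L.Env :=
  (RingQuot.mkAlgHom ℚ L.Rel).toLinearMap ∘ₗ TensorAlgebra.ι ℚ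

theorem ι_mul {i j : ℤ} {x y : L.carrier} (hx : x ∈ L.gr i) (hy : y ∈ L.gr j) :
    L.ι x * L.ι y = (-1 : ℚ) ^ (i * j) • (L.ι y * L.ι x) + L.ι (L.bracket x y) := by
  have := RingQuot.mkAlgHom_rel ℚ (Rel.of hx hy)
  rw [map_add, map_smul, map_mul, map_mul] at this
  exact this

variable {L} in
/-- The algebra map out of the universal enveloping algebra given by its universal property. -/
noncomputable def lift {B : Type*} [Semiring B] [Algebra ℚ B] (f : L.carrier →ₗ[ℚ] B)
    (hf : ∀ (i j : ℤ) (x y : L.carrier), x ∈ L.gr i → y ∈ L.gr j →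
      f x * f y = (-1 : ℚ) ^ (i * j) • (f y * f x) + f (L.bracket x y)) : L.Env →ₐ[ℚ] B :=
  RingQuot.liftAlgHom ℚ ⟨TensorAlgebra.lift ℚ f, by
    rintro _ _ ⟨hx, hy⟩
    simpa using hf _ _ _ _ hx hy⟩

theorem lift_ι {B : Type*} [Semiring B] [Algebra ℚ B] (f : L.carrier →ₗ[ℚ] B)
    (hf : ∀ (i j : ℤ) (x y : L.carrier), x ∈ L.gr i → y ∈ L.gr j →
      f x * f y = (-1 : ℚ) ^ (i * j) • (f y * f x) + f (L.bracket x y)) (x : L.carrier) :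
    lift f hf (L.ι x) = f x := by
  change RingQuot.liftAlgHom ℚ _ (RingQuot.mkAlgHom ℚ L.Rel (TensorAlgebra.ι ℚ x)) = f x
  rw [RingQuot.liftAlgHom_mkAlgHom_apply, TensorAlgebra.lift_ι_apply]

theorem env_induction {P : L.Env → Prop} (one : P 1) (add : ∀ a b, P a → P b → P (a + b))
    (smul : ∀ (q : ℚ) a, P a → P (q • a))
    (mul : ∀ i, ∀ x ∈ L.gr i, ∀ a, P a → P (L.ι x * a)) (u : L.Env) : P u := by
  have zero : P 0 := by simpa using smul 0 1 one
  have key : ∀ t : TensorAlgebra ℚ L.carrier, ∀ a, P a →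
      P (RingQuot.mkAlgHom ℚ L.Rel t * a) := by
    intro t
    induction t using TensorAlgebra.induction with
    | algebraMap r => intro a ha; simpa [Algebra.algebraMap_eq_smul_one] using smul r a ha
    | ι x =>
      intro a ha
      change P (L.ι x * a)
      induction x using graded_induction L.internal with
      | mem n y hy => exact mul n y hy a ha
      | zero => simpa using zero
      | add y z hy hz => rw [map_add, add_mul]; exact add _ _ hy hz
    | mul s t hs ht => intro a ha; rw [map_mul, mul_assoc]; exact hs _ (ht _ ha)
    | add s t hs ht => intro a ha; rw [map_add, add_mul]; exact add _ _ (hs _ ha) (ht _ ha)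
  obtain ⟨t, rfl⟩ := RingQuot.mkAlgHom_surjective ℚ L.Rel u
  simpa using key t 1 one

/-- The part of degree `n`: spanned by the products of homogeneous elements of the Lie algebra
whose degrees add up to `n`. -/
noncomputable def envGr (n : ℤ) : Submodule ℚ L.Env :=
  Submodule.span ℚ {u | ∃ l : List (ℤ × L.carrier), (∀ p ∈ l, p.2 ∈ L.gr p.1) ∧
    (l.map Prod.fst).sum = n ∧ (l.map fun p => L.ι p.2).prod = u}

theorem one_mem_envGr : (1 : L.Env) ∈ L.envGr 0 :=
  Submodule.subset_span ⟨[], by simp, rfl, rfl⟩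

theorem mul_mem_envGr {i j : ℤ} {a b : L.Env} (ha : a ∈ L.envGr i) (hb : b ∈ L.envGr j) :
    a * b ∈ L.envGr (i + j) := by
  have := Submodule.mul_mem_mul ha hb
  rw [envGr, envGr, Submodule.span_mul_span] at this
  refine Submodule.span_mono ?_ this
  rintro _ ⟨_, ⟨l, hl, rfl, rfl⟩, _, ⟨m, hm, rfl, rfl⟩, rfl⟩
  refine ⟨l ++ m, ?_, by simp, by simp⟩
  intro p hp
  rcases List.mem_append.1 hp with h | h
  exacts [hl p h, hm p h]

theorem ι_mem_envGr {i : ℤ} {x : L.carrier} (hx : x ∈ L.gr i) : L.ι x ∈ L.envGr i :=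
  Submodule.subset_span ⟨[(i, x)], by simpa using hx, by simp, by simp⟩

/-- To check a linear property of `envGr`, it is enough to check products of generators. -/
theorem envGr_induction {P : ℤ → L.Env → Prop} (one : P 0 1)
    (zero : ∀ n, P n 0) (add : ∀ n a b, P n a → P n b → P n (a + b))
    (smul : ∀ n (q : ℚ) a, P n a → P n (q • a))
    (mul : ∀ i j, ∀ x ∈ L.gr i, ∀ a ∈ L.envGr j, P j a → P (i + j) (L.ι x * a)) {n : ℤ} {u : L.Env}
    (hu : u ∈ L.envGr n) : P n u := by
  induction hu using Submodule.span_induction with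
  | mem u hu =>
    obtain ⟨l, hl, rfl, rfl⟩ := hu
    induction l with
    | nil => simpa using one
    | cons p l ih =>
      simp only [List.map_cons, List.sum_cons, List.prod_cons]
      have hl' : ∀ q ∈ l, q.2 ∈ L.gr q.1 := fun q hq => hl q (by simp [hq])
      exact mul _ _ _ (hl p (by simp)) _ (Submodule.subset_span ⟨l, hl', rfl, rfl⟩) (ih hl')
  | zero => exact zero n
  | add a b _ _ ha hb => exact add n a b ha hb
  | smul q a _ ha => exact smul n q a ha

/-- The linear map underlying `weight`: `x ↦ x T ^ n` for `x` of degree `n`. -/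
noncomputable def weightAux : L.carrier →ₗ[ℚ] AddMonoidAlgebra L.Env ℤ :=
  (AddMonoidAlgebra.coeffLinearEquiv ℚ).symm.toLinearMap ∘ₗ
    Finsupp.mapRange.linearMap L.ι ∘ₗ components L.internal

theorem weightAux_of_mem {n : ℤ} {x : L.carrier} (hx : x ∈ L.gr n) :
    L.weightAux x = AddMonoidAlgebra.single n (L.ι x) := by
  simp only [weightAux, LinearMap.comp_apply, components_of_mem L.internal hx,
    Finsupp.mapRange.linearMap_apply, Finsupp.mapRange_single]
  rfl

theorem weightAux_rel (i j : ℤ) (x y : L.carrier) (hx : x ∈ L.gr i) (hy : y ∈ L.gr j) :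
    L.weightAux x * L.weightAux y =
      (-1 : ℚ) ^ (i * j) • (L.weightAux y * L.weightAux x) + L.weightAux (L.bracket x y) := by
  rw [L.weightAux_of_mem hx, L.weightAux_of_mem hy, L.weightAux_of_mem (L.bracket_mem hx hy),
      AddMonoidAlgebra.single_mul_single, AddMonoidAlgebra.single_mul_single, L.ι_mul hx hy,
      add_comm j i, AddMonoidAlgebra.single_add, AddMonoidAlgebra.smul_single]

/-- The algebra map which records degrees as exponents of a formal variable. -/
noncomputable def weight : L.Env →ₐ[ℚ] AddMonoidAlgebra L.Env ℤ :=
  lift L.weightAux L.weightAux_rel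

theorem weight_ι {n : ℤ} {x : L.carrier} (hx : x ∈ L.gr n) :
    L.weight (L.ι x) = AddMonoidAlgebra.single n (L.ι x) :=
  (lift_ι L L.weightAux L.weightAux_rel x).trans (L.weightAux_of_mem hx)

theorem weight_of_mem {n : ℤ} {u : L.Env} (hu : u ∈ L.envGr n) :
    L.weight u = AddMonoidAlgebra.single n u := by
  refine L.envGr_induction (P := fun n u => L.weight u = AddMonoidAlgebra.single n u) ?_ ?_ ?_ ?_ ?_ hu
  · rw [map_one, AddMonoidAlgebra.one_def]
  · intro n
    simp
  · intro n a b ha hb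
    rw [map_add, ha, hb, AddMonoidAlgebra.single_add]
  · intro n q a ha
    rw [map_smul, ha, AddMonoidAlgebra.smul_single]
  · intro i j x hx a _ ha
    rw [map_mul, L.weight_ι hx, ha,
      AddMonoidAlgebra.single_mul_single]

theorem envGr_internal : DirectSum.IsInternal L.envGr := by
  refine isInternal_of_weight
    ((AddMonoidAlgebra.coeffLinearEquiv ℚ).toLinearMap ∘ₗ L.weight.toLinearMap) ?_ ?_
  · intro n u hu
    simp only [LinearMap.comp_apply, AlgHom.toLinearMap_apply, L.weight_of_mem hu]
    rfl
  · intro u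
    induction u using L.env_induction with
    | one => exact Submodule.mem_iSup_of_mem 0 L.one_mem_envGr
    | add a b ha hb => exact add_mem ha hb
    | smul q a ha => exact Submodule.smul_mem _ _ ha
    | mul i x hx a ha =>
      induction ha using Submodule.iSup_induction' with
      | mem j y hy => exact Submodule.mem_iSup_of_mem (i + j) (L.mul_mem_envGr (L.ι_mem_envGr hx) hy)
      | zero => simp
      | add y z _ _ hy hz => rw [mul_add]; exact add_mem hy hz

/-- The matrix `[[± x, d x], [0, x]]` of an element `x` of the Lie algebra. -/
noncomputable def derivAux : L.carrier →ₗ[ℚ] Matrix (Fin 2) (Fin 2) L.Env where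
  toFun x := !![L.ι (parity L.internal x), L.ι (L.d x); 0, L.ι x]
  map_add' x y := by
    ext i j; fin_cases i <;> fin_cases j <;> simp
  map_smul' q x := by
    ext i j; fin_cases i <;> fin_cases j <;> simp

theorem derivAux_rel (i j : ℤ) (x y : L.carrier) (hx : x ∈ L.gr i) (hy : y ∈ L.gr j) :
    L.derivAux x * L.derivAux y =
      (-1 : ℚ) ^ (i * j) • (L.derivAux y * L.derivAux x) + L.derivAux (L.bracket x y) := by
  have h1 := L.ι_mul hx hy
  have h2 := L.ι_mul (L.d_mem hx) hy
  have h3 := L.ι_mul hx (L.d_mem hy)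
  have e1 : (-1 : ℚ) ^ ((i - 1) * j) = (-1) ^ (i * j) * (-1) ^ j := by
    rw [sub_mul, one_mul, zpow_sub₀ (by norm_num), div_eq_mul_inv, ← inv_zpow]; norm_num
  have e2 : (-1 : ℚ) ^ (i * (j - 1)) = (-1) ^ (i * j) * (-1) ^ i := by
    rw [mul_sub, mul_one, zpow_sub₀ (by norm_num), div_eq_mul_inv, ← inv_zpow]; norm_num
  have e3 : (-1 : ℚ) ^ i * (-1) ^ i = 1 := by rw [← mul_zpow]; norm_num
  rw [e1] at h2
  rw [e2] at h3
  ext a b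
  fin_cases a <;> fin_cases b
  · simp only [derivAux, LinearMap.coe_mk, AddHom.coe_mk, parity_of_mem _ hx, parity_of_mem _ hy,
      parity_of_mem _ (L.bracket_mem hx hy)]
    simp [Matrix.mul_apply, Fin.sum_univ_two, h1, smul_smul, zpow_add₀, smul_add]
    ring_nf
  · simp only [derivAux, LinearMap.coe_mk, AddHom.coe_mk, parity_of_mem _ hx, parity_of_mem _ hy,
      parity_of_mem _ (L.bracket_mem hx hy), L.d_bracket hx hy]
    simp [Matrix.mul_apply, Fin.sum_univ_two, h2, h3, smul_smul, smul_add]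
    rw [show (-1 : ℚ) ^ i * ((-1) ^ (i * j) * (-1) ^ i) = (-1) ^ (i * j) by
      rw [mul_left_comm, e3, mul_one]]
    abel
  · simp [derivAux, Matrix.mul_apply, Fin.sum_univ_two]
  · simp [derivAux, Matrix.mul_apply, Fin.sum_univ_two, h1]

/-- The algebra map `u ↦ [[± u, d u], [0, u]]` which encodes the differential of the universal
enveloping algebra. -/
noncomputable def deriv : L.Env →ₐ[ℚ] Matrix (Fin 2) (Fin 2) L.Env :=
  lift L.derivAux L.derivAux_rel

theorem deriv_ι (x : L.carrier) :
    L.deriv (L.ι x) = !![L.ι (parity L.internal x), L.ι (L.d x); 0, L.ι x] :=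
  lift_ι L L.derivAux L.derivAux_rel x

/-- The differential of the universal enveloping algebra. -/
noncomputable def envD : L.Env →ₗ[ℚ] L.Env where
  toFun u := L.deriv u 0 1
  map_add' u v := by simp
  map_smul' q u := by simp

theorem deriv_row (u : L.Env) : L.deriv u 1 0 = 0 ∧ L.deriv u 1 1 = u := by
  induction u using L.env_induction with
  | one => simp
  | add a b ha hb => simp [ha, hb]
  | smul q a ha => simp [ha]
  | mul i x hx a ha =>
    rw [map_mul, deriv_ι]
    simp [Matrix.mul_apply, Fin.sum_univ_two, ha]

theorem deriv_of_mem {n : ℤ} {u : L.Env} (hu : u ∈ L.envGr n) :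
    L.deriv u 0 0 = (-1 : ℚ) ^ n • u := by
  refine L.envGr_induction (P := fun n u => L.deriv u 0 0 = (-1 : ℚ) ^ n • u) ?_ ?_ ?_ ?_ ?_ hu
  · simp
  · intro n
    simp
  · intro n a b ha hb
    simp [ha, hb]
  · intro n q a ha
    rw [map_smul, Matrix.smul_apply, ha, smul_comm]
  · intro i j x hx a _ ha
    rw [map_mul, deriv_ι]
    rw [Matrix.mul_apply, Fin.sum_univ_two, ha, (L.deriv_row a).1, mul_zero, add_zero,
      parity_of_mem _ hx, map_smul]
    change ((-1 : ℚ) ^ i • L.ι x) * ((-1 : ℚ) ^ j • a) = _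
    rw [smul_mul_smul_comm, zpow_add₀ (by norm_num)]

theorem envD_ι (x : L.carrier) : L.envD (L.ι x) = L.ι (L.d x) := by
  change L.deriv (L.ι x) 0 1 = _
  rw [deriv_ι]
  simp

theorem envD_mul {n : ℤ} {a : L.Env} (b : L.Env) (ha : a ∈ L.envGr n) :
    L.envD (a * b) = L.envD a * b + (-1 : ℚ) ^ n • (a * L.envD b) := by
  change L.deriv (a * b) 0 1 = L.deriv a 0 1 * b + (-1 : ℚ) ^ n • (a * L.deriv b 0 1)
  rw [map_mul, Matrix.mul_apply, Fin.sum_univ_two, L.deriv_of_mem ha, (L.deriv_row b).2,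
    smul_mul_assoc, add_comm]

theorem envD_one : L.envD 1 = 0 := by
  change L.deriv 1 0 1 = 0
  simp

theorem envD_mem {n : ℤ} {u : L.Env} (hu : u ∈ L.envGr n) : L.envD u ∈ L.envGr (n - 1) := by
  refine L.envGr_induction (P := fun n u => L.envD u ∈ L.envGr (n - 1)) ?_ ?_ ?_ ?_ ?_ hu
  · rw [envD_one]; exact zero_mem _
  · intro n
    rw [map_zero]; exact zero_mem _
  · intro n a b ha hb
    rw [map_add]; exact add_mem ha hb
  · intro n q a ha
    rw [map_smul]; exact Submodule.smul_mem _ _ ha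
  · intro i j x hx a ha' ha
    rw [L.envD_mul _ (L.ι_mem_envGr hx), envD_ι]
    refine add_mem ?_ (Submodule.smul_mem _ _ ?_)
    · have := L.mul_mem_envGr (L.ι_mem_envGr (L.d_mem hx)) ha'
      rwa [show i - 1 + j = i + j - 1 by ring] at this
    · have := L.mul_mem_envGr (L.ι_mem_envGr hx) ha
      rwa [show i + (j - 1) = i + j - 1 by ring] at this

theorem envD_envD (u : L.Env) : L.envD (L.envD u) = 0 := by
  induction u using L.env_induction with
  | one => rw [envD_one, map_zero]
  | add a b ha hb => rw [map_add, map_add, ha, hb, add_zero]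
  | smul q a ha => rw [map_smul, map_smul, ha, smul_zero]
  | mul i x hx a ha =>
    rw [L.envD_mul _ (L.ι_mem_envGr hx), map_add, map_smul, envD_ι,
      L.envD_mul _ (L.ι_mem_envGr (L.d_mem hx)), L.envD_mul _ (L.ι_mem_envGr hx), envD_ι, ha,
      envD_ι, L.d_d, zpow_sub_one₀ (by norm_num)]
    simp [← add_smul]

/-- The universal enveloping dg algebra `U(L)` of a dg Lie algebra `L`. -/
noncomputable def env : DGAlg.{u} where
  carrier := L.Env
  gr := L.envGr
  internal := L.envGr_internal
  one_mem := L.one_mem_envGr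
  mul_mem := L.mul_mem_envGr
  d := L.envD
  d_mem := L.envD_mem
  d_d := L.envD_envD
  d_mul := L.envD_mul

/-- A dg representation of `L`: a dg module over the universal enveloping algebra of `L`. -/
abbrev Rep : Type (u + 1) := DGMod.{u} L.env

end DGLie

/-! ## The bar resolution -/

namespace DGMod

variable {A : DGAlg.{u}}

/-- The part of degree `n` of `A ⊗ X`: it is spanned by the `a ⊗ x` with `|a| + |x| = n`. -/
noncomputable def freeGr (X : DGMod A) (n : ℤ) : Submodule ℚ (A.carrier ⊗[ℚ] X.carrier) :=
  Submodule.span ℚ {t | ∃ i j : ℤ, i + j = n ∧ ∃ a ∈ A.gr i, ∃ x ∈ X.gr j, a ⊗ₜ[ℚ] x = t}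

theorem tmul_mem_freeGr (X : DGMod A) {i j : ℤ} {a : A.carrier} {x : X.carrier}
    (ha : a ∈ A.gr i) (hx : x ∈ X.gr j) : a ⊗ₜ[ℚ] x ∈ X.freeGr (i + j) :=
  Submodule.subset_span ⟨i, j, rfl, a, ha, x, hx, rfl⟩

theorem free_induction (X : DGMod A) {P : A.carrier ⊗[ℚ] X.carrier → Prop}
    (t : A.carrier ⊗[ℚ] X.carrier)
    (tmul : ∀ i j, ∀ a ∈ A.gr i, ∀ x ∈ X.gr j, P (a ⊗ₜ x)) (zero : P 0)
    (add : ∀ s t, P s → P t → P (s + t)) : P t := by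
  induction t with
  | zero => exact zero
  | add s t hs ht => exact add s t hs ht
  | tmul a x =>
    induction a using graded_induction A.internal with
    | mem i a ha =>
      induction x using graded_induction X.internal with
      | mem j x hx => exact tmul i j a ha x hx
      | zero => simpa using zero
      | add y z hy hz => rw [TensorProduct.tmul_add]; exact add _ _ hy hz
    | zero => simpa using zero
    | add y z hy hz => rw [TensorProduct.add_tmul]; exact add _ _ hy hz

/-- The differential of `A ⊗ X`: `d (a ⊗ x) = d a ⊗ x + (-1) ^ |a| a ⊗ d x`. -/
noncomputable def freeD (X : DGMod A) :
    A.carrier ⊗[ℚ] X.carrier →ₗ[ℚ] A.carrier ⊗[ℚ] X.carrier :=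
  TensorProduct.map A.d LinearMap.id + TensorProduct.map (parity A.internal) X.d

theorem freeD_tmul (X : DGMod A) (a : A.carrier) (x : X.carrier) :
    X.freeD (a ⊗ₜ x) = A.d a ⊗ₜ x + parity A.internal a ⊗ₜ X.d x := rfl

theorem freeD_mem (X : DGMod A) {n : ℤ} {t : A.carrier ⊗[ℚ] X.carrier} (ht : t ∈ X.freeGr n) :
    X.freeD t ∈ X.freeGr (n - 1) := by
  induction ht using Submodule.span_induction with
  | mem t h =>
    obtain ⟨i, j, rfl, a, ha, x, hx, rfl⟩ := h
    rw [freeD_tmul, parity_of_mem _ ha, ← TensorProduct.smul_tmul']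
    refine add_mem ?_ (Submodule.smul_mem _ _ ?_)
    · rw [show i + j - 1 = i - 1 + j by ring]; exact X.tmul_mem_freeGr (A.d_mem ha) hx
    · rw [show i + j - 1 = i + (j - 1) by ring]; exact X.tmul_mem_freeGr ha (X.d_mem hx)
  | zero => rw [map_zero]; exact zero_mem _
  | add s t _ _ hs ht => rw [map_add]; exact add_mem hs ht
  | smul q t _ ht => rw [map_smul]; exact Submodule.smul_mem _ _ ht

theorem free_internal (X : DGMod A) : DirectSum.IsInternal X.freeGr := by
  refine isInternal_of_weight
    (Finsupp.lmapDomain _ ℚ (fun p : ℤ × ℤ => p.1 + p.2) ∘ₗ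
      (finsuppTensorFinsupp ℚ ℚ A.carrier X.carrier ℤ ℤ).toLinearMap ∘ₗ
      TensorProduct.map (components A.internal) (components X.internal)) ?_ ?_
  · intro n t ht
    induction ht using Submodule.span_induction with
    | mem t h =>
      obtain ⟨i, j, rfl, a, ha, x, hx, rfl⟩ := h
      simp [components_of_mem _ ha, components_of_mem _ hx, finsuppTensorFinsupp_single]
    | zero => simp
    | add s t _ _ hs ht => rw [map_add, hs, ht, Finsupp.single_add]
    | smul q t _ ht => rw [map_smul, ht, Finsupp.smul_single]
  · intro t
    induction t using X.free_induction with
    | tmul i j a ha x hx => exact Submodule.mem_iSup_of_mem _ (X.tmul_mem_freeGr ha hx)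
    | zero => exact zero_mem _
    | add s t hs ht => exact add_mem hs ht

/-- The free dg module `A ⊗ X` on the chain complex underlying a dg module `X`. -/
noncomputable def free (X : DGMod A) : DGMod A where
  carrier := A.carrier ⊗[ℚ] X.carrier
  gr := X.freeGr
  internal := X.free_internal
  smul_mem := by
    intro i n a t ha ht
    induction ht using Submodule.span_induction with
    | mem t h =>
      obtain ⟨j, k, rfl, b, hb, x, hx, rfl⟩ := h
      rw [TensorProduct.smul_tmul', ← add_assoc]
      exact X.tmul_mem_freeGr (A.mul_mem ha hb) hx
    | zero => rw [smul_zero]; exact zero_mem _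
    | add s t _ _ hs ht => rw [smul_add]; exact add_mem hs ht
    | smul q t _ ht => rw [smul_comm]; exact Submodule.smul_mem _ _ ht
  d := X.freeD
  d_mem := X.freeD_mem
  d_d := by
    intro t
    induction t using X.free_induction with
    | tmul i j a ha x hx =>
      rw [freeD_tmul, map_add, freeD_tmul, freeD_tmul, A.d_d, X.d_d, TensorProduct.zero_tmul,
        TensorProduct.tmul_zero, zero_add, add_zero, A.parity_d, TensorProduct.neg_tmul,
        neg_add_cancel]
    | zero => simp
    | add s t hs ht => rw [map_add, map_add, hs, ht, add_zero]
  d_smul := by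
    intro i a t ha
    induction t using X.free_induction with
    | tmul j k b hb x hx =>
      rw [TensorProduct.smul_tmul', freeD_tmul, freeD_tmul, smul_eq_mul, A.d_mul b ha,
        parity_of_mem _ (A.mul_mem ha hb), parity_of_mem _ hb, smul_add, TensorProduct.smul_tmul',
        TensorProduct.smul_tmul', TensorProduct.smul_tmul', smul_add, TensorProduct.smul_tmul',
        TensorProduct.smul_tmul',
        TensorProduct.add_tmul, zpow_add₀ (by norm_num), smul_eq_mul, smul_eq_mul, smul_eq_mul,
        mul_smul_comm, smul_smul, add_assoc]
    | zero => simp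
    | add s t hs ht => simp only [smul_add, map_add, hs, ht]; abel

/-- The element `a ⊗ x` of the free dg module `A ⊗ X`. -/
noncomputable def tmul (X : DGMod A) : A.carrier →ₗ[ℚ] X.carrier →ₗ[ℚ] X.free.carrier :=
  TensorProduct.mk ℚ A.carrier X.carrier

theorem smul_tmul (X : DGMod A) (a b : A.carrier) (x : X.carrier) :
    a • X.tmul b x = X.tmul (a * b) x := rfl

theorem d_tmul (X : DGMod A) (a : A.carrier) (x : X.carrier) :
    X.free.d (X.tmul a x) = X.tmul (A.d a) x + X.tmul (parity A.internal a) (X.d x) := rfl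

theorem tmul_mem (X : DGMod A) {i j : ℤ} {a : A.carrier} {x : X.carrier}
    (ha : a ∈ A.gr i) (hx : x ∈ X.gr j) : X.tmul a x ∈ X.free.gr (i + j) :=
  X.tmul_mem_freeGr ha hx

theorem free_ind (X : DGMod A) {P : X.free.carrier → Prop} (t : X.free.carrier)
    (tmul : ∀ a x, P (X.tmul a x)) (zero : P 0) (add : ∀ s t, P s → P t → P (s + t)) : P t :=
  X.free_induction t (fun _ _ a _ x _ => tmul a x) zero add

theorem free_gr_ind (X : DGMod A) {n : ℤ} {P : X.free.carrier → Prop}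
    (tmul : ∀ i j, i + j = n → ∀ a ∈ A.gr i, ∀ x ∈ X.gr j, P (X.tmul a x)) (zero : P 0)
    (add : ∀ s t, P s → P t → P (s + t)) (smul : ∀ (q : ℚ) t, P t → P (q • t))
    (t : X.free.carrier) (ht : t ∈ X.free.gr n) : P t := by
  refine Submodule.span_induction (p := fun t _ => P t) ?_ zero (fun s t _ _ hs ht => add s t hs ht)
    (fun q t _ ht => smul q t ht) ht
  rintro _ ⟨i, j, hij, a, ha, x, hx, rfl⟩
  exact tmul i j hij a ha x hx

/-- The action map `A ⊗ X → X`. -/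
noncomputable def act (X : DGMod A) : X.free.carrier →ₗ[A.carrier] X.carrier :=
  TensorProduct.AlgebraTensorModule.lift
    (LinearMap.toSpanSingleton A.carrier (X.carrier →ₗ[ℚ] X.carrier) LinearMap.id)

theorem act_tmul (X : DGMod A) (a : A.carrier) (x : X.carrier) : X.act (X.tmul a x) = a • x := rfl

/-- The map `A ⊗ X → A ⊗ Y`, `a ⊗ x ↦ a ⊗ f x`, induced by a map `f : X → Y`. -/
noncomputable def freeMap {X Y : DGMod A} (f : X.carrier →ₗ[ℚ] Y.carrier) :
    X.free.carrier →ₗ[A.carrier] Y.free.carrier :=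
  f.baseChange A.carrier

/-- The image of `A ⊗ S` in `A ⊗ X`, for a submodule `S` of `X`. -/
noncomputable def freeSub (X : DGMod A) (S : Submodule A.carrier X.carrier) :
    Submodule A.carrier X.free.carrier :=
  Submodule.span A.carrier {t | ∃ a, ∃ x ∈ S, X.tmul a x = t}

/-- A graded submodule: one that contains the homogeneous components of its elements. -/
def IsHomogeneous (X : DGMod A) (S : Submodule A.carrier X.carrier) : Prop :=
  ∀ n, ∀ x ∈ S, component X.internal n x ∈ S

/-- The differential of the quotient of a dg module by a dg submodule. -/
noncomputable def quotD (X : DGMod A) (S : Submodule A.carrier X.carrier)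
    (hd : ∀ x ∈ S, X.d x ∈ S) : X.carrier ⧸ S →ₗ[ℚ] X.carrier ⧸ S :=
  (Submodule.Quotient.restrictScalarsEquiv ℚ S).toLinearMap ∘ₗ
    (S.restrictScalars ℚ).mapQ (S.restrictScalars ℚ) X.d hd ∘ₗ
    (Submodule.Quotient.restrictScalarsEquiv ℚ S).symm.toLinearMap

/-- The quotient of a dg module by a dg submodule. -/
noncomputable def quot (X : DGMod A) (S : Submodule A.carrier X.carrier) (hS : X.IsHomogeneous S)
    (hd : ∀ x ∈ S, X.d x ∈ S) : DGMod A where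
  carrier := X.carrier ⧸ S
  gr n := (X.gr n).map (S.mkQ.restrictScalars ℚ)
  internal := isInternal_map X.internal _ S.mkQ_surjective (by
    intro n x hx
    exact (Submodule.Quotient.mk_eq_zero S).2 (hS n x ((Submodule.Quotient.mk_eq_zero S).1 hx)))
  smul_mem := by
    rintro i j a _ ha ⟨x, hx, rfl⟩
    exact ⟨a • x, X.smul_mem ha hx, rfl⟩
  d := X.quotD S hd
  d_mem := by
    rintro i _ ⟨x, hx, rfl⟩
    exact ⟨X.d x, X.d_mem hx, rfl⟩
  d_d := by
    intro x
    obtain ⟨x, rfl⟩ := S.mkQ_surjective x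
    change S.mkQ (X.d (X.d x)) = 0
    rw [X.d_d, map_zero]
  d_smul := by
    intro i a x ha
    obtain ⟨x, rfl⟩ := S.mkQ_surjective x
    change S.mkQ (X.d (a • x)) = S.mkQ (A.d a • x + (-1 : ℚ) ^ i • (a • X.d x))
    rw [X.d_smul x ha]

end DGMod

namespace DGMod

variable {A : DGAlg.{u}}

/-- To see that a submodule is graded it suffices that its elements are sums of homogeneous
elements of it. -/
theorem isHomogeneous_of_span (X : DGMod A) (S : Submodule A.carrier X.carrier)
    (h : ∀ x ∈ S, x ∈ Submodule.span ℚ {y | y ∈ S ∧ ∃ n, y ∈ X.gr n}) : X.IsHomogeneous S := by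
  intro n x hx
  have hx' := h x hx
  clear hx
  induction hx' using Submodule.span_induction with
  | mem y hy =>
    obtain ⟨hy, m, hm⟩ := hy
    by_cases hmn : m = n
    · subst hmn; rwa [component_of_mem _ hm]
    · rw [component_of_mem_ne _ hmn hm]; exact zero_mem _
  | zero => rw [map_zero]; exact zero_mem _
  | add y z _ _ hy hz => rw [map_add]; exact add_mem hy hz
  | smul q y _ hy => rw [map_smul]; exact (S.restrictScalars ℚ).smul_mem q hy

theorem sum_homogeneous (X : DGMod A) (S : Submodule A.carrier X.carrier) (hS : X.IsHomogeneous S)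
    (x : X.carrier) (hx : x ∈ S) : x ∈ Submodule.span ℚ {y | y ∈ S ∧ ∃ n, y ∈ X.gr n} := by
  have h1 := isInternal_comap X.internal (S.restrictScalars ℚ) hS
  have h2 : (⟨x, hx⟩ : S.restrictScalars ℚ) ∈
      ⨆ n, (X.gr n).comap (S.restrictScalars ℚ).subtype := by
    rw [h1.submodule_iSup_eq_top]; trivial
  have h3 := Submodule.mem_map_of_mem (f := (S.restrictScalars ℚ).subtype) h2
  rw [Submodule.map_iSup] at h3
  refine (iSup_le fun n => ?_ : (⨆ n, Submodule.map (S.restrictScalars ℚ).subtype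
    ((X.gr n).comap (S.restrictScalars ℚ).subtype)) ≤ _) h3
  rintro _ ⟨y, hy, rfl⟩
  exact Submodule.subset_span ⟨y.2, n, hy⟩

theorem freeSub_ind (X : DGMod A) (S : Submodule A.carrier X.carrier)
    {P : X.free.carrier → Prop} (tmul : ∀ (a : A.carrier), ∀ x ∈ S, P (X.tmul a x)) (zero : P 0)
    (add : ∀ s t, P s → P t → P (s + t)) {t : X.free.carrier} (ht : t ∈ X.freeSub S) : P t := by
  have key : ∀ b : A.carrier, P (b • t) := by
    refine Submodule.span_induction (p := fun t _ => ∀ b : A.carrier, P (b • t)) ?_ ?_ ?_ ?_ ht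
    · rintro _ ⟨a, x, hx, rfl⟩ b
      rw [smul_tmul]
      exact tmul _ x hx
    · intro b; rw [smul_zero]; exact zero
    · intro s t _ _ hs ht b; rw [smul_add]; exact add _ _ (hs b) (ht b)
    · intro c t _ ht b; rw [smul_smul]; exact ht _
  simpa using key 1

theorem tmul_mem_freeSub (X : DGMod A) {S : Submodule A.carrier X.carrier} (a : A.carrier)
    {x : X.carrier} (hx : x ∈ S) : X.tmul a x ∈ X.freeSub S :=
  Submodule.subset_span ⟨a, x, hx, rfl⟩

/-- The submodule of `A ⊗ (A ⊗ X)` generated by the elements `a ⊗ (1 ⊗ x)`, and by the `a ⊗ s`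
with `s` in a given submodule `S` of `A ⊗ X`. -/
noncomputable def degenStep (X : DGMod A) (S : Submodule A.carrier X.free.carrier) :
    Submodule A.carrier X.free.free.carrier :=
  Submodule.span A.carrier {t | ∃ a x, X.free.tmul a (X.tmul 1 x) = t} ⊔ X.free.freeSub S

theorem unit_mem_degenStep (X : DGMod A) (S : Submodule A.carrier X.free.carrier) (a : A.carrier)
    (x : X.carrier) : X.free.tmul a (X.tmul 1 x) ∈ X.degenStep S :=
  Submodule.mem_sup_left (Submodule.subset_span ⟨a, x, rfl⟩)

theorem tmul_mem_degenStep (X : DGMod A) (S : Submodule A.carrier X.free.carrier) (a : A.carrier)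
    {x : X.free.carrier} (hx : x ∈ S) : X.free.tmul a x ∈ X.degenStep S :=
  Submodule.mem_sup_right (X.free.tmul_mem_freeSub a hx)

theorem degenStep_ind (X : DGMod A) (S : Submodule A.carrier X.free.carrier)
    {P : X.free.free.carrier → Prop}
    (unit : ∀ a x, P (X.free.tmul a (X.tmul 1 x)))
    (tmul : ∀ a, ∀ x ∈ S, P (X.free.tmul a x))
    (zero : P 0) (add : ∀ s t, P s → P t → P (s + t)) {t : X.free.free.carrier}
    (ht : t ∈ X.degenStep S) : P t := by
  obtain ⟨s, hs, r, hr, rfl⟩ := Submodule.mem_sup.1 ht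
  refine add _ _ ?_ (X.free.freeSub_ind S tmul zero add hr)
  have key : ∀ b : A.carrier, P (b • s) := by
    refine Submodule.span_induction (p := fun t _ => ∀ b : A.carrier, P (b • t)) ?_ ?_ ?_ ?_ hs
    · rintro _ ⟨a, x, rfl⟩ b
      rw [smul_tmul]
      exact unit _ x
    · intro b; rw [smul_zero]; exact zero
    · intro s t _ _ hs ht b; rw [smul_add]; exact add _ _ (hs b) (ht b)
    · intro c t _ ht b; rw [smul_smul]; exact ht _
  simpa using key 1

theorem d_degenStep (X : DGMod A) {S : Submodule A.carrier X.free.carrier}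
    (hS : ∀ x ∈ S, X.free.d x ∈ S) : ∀ x ∈ X.degenStep S, X.free.free.d x ∈ X.degenStep S := by
  intro t ht
  refine X.degenStep_ind S (P := fun t => X.free.free.d t ∈ X.degenStep S) ?_ ?_ ?_ ?_ ht
  · intro a x
    rw [d_tmul, d_tmul, A.d_one, map_zero, LinearMap.zero_apply, zero_add,
      parity_of_mem _ A.one_mem, zpow_zero, one_smul]
    exact add_mem (X.unit_mem_degenStep S _ _) (X.unit_mem_degenStep S _ _)
  · intro a x hx
    rw [d_tmul]
    exact add_mem (X.tmul_mem_degenStep S _ hx) (X.tmul_mem_degenStep S _ (hS x hx))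
  · rw [map_zero]; exact zero_mem _
  · intro s t hs ht; rw [map_add]; exact add_mem hs ht

theorem homogeneous_degenStep (X : DGMod A) {S : Submodule A.carrier X.free.carrier}
    (hS : X.free.IsHomogeneous S) : X.free.free.IsHomogeneous (X.degenStep S) := by
  refine isHomogeneous_of_span _ _ fun t ht => ?_
  refine X.degenStep_ind S (P := fun t => t ∈ Submodule.span ℚ
    {y | y ∈ X.degenStep S ∧ ∃ m, y ∈ X.free.free.gr m}) ?_ ?_ ?_ ?_ ht
  · intro a x
    induction a using graded_induction A.internal with
    | mem i a ha =>
      induction x using graded_induction X.internal with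
      | mem j x hx =>
        exact Submodule.subset_span ⟨X.unit_mem_degenStep S a x, _,
          X.free.tmul_mem ha (X.tmul_mem A.one_mem hx)⟩
      | zero => rw [map_zero, map_zero]; exact zero_mem _
      | add y z hy hz => rw [map_add, map_add]; exact add_mem hy hz
    | zero => rw [map_zero, LinearMap.zero_apply]; exact zero_mem _
    | add y z hy hz => rw [map_add, LinearMap.add_apply]; exact add_mem hy hz
  · intro a x hx
    have hx' := sum_homogeneous _ _ hS x hx
    clear hx
    induction a using graded_induction A.internal with
    | mem i a ha =>
      induction hx' using Submodule.span_induction with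
      | mem x hx =>
        obtain ⟨hx, j, hj⟩ := hx
        exact Submodule.subset_span ⟨X.tmul_mem_degenStep S a hx, _, X.free.tmul_mem ha hj⟩
      | zero => rw [map_zero]; exact zero_mem _
      | add y z _ _ hy hz => rw [map_add]; exact add_mem hy hz
      | smul q y _ hy => rw [map_smul]; exact Submodule.smul_mem _ _ hy
    | zero => rw [map_zero, LinearMap.zero_apply]; exact zero_mem _
    | add y z hy hz => rw [map_add, LinearMap.add_apply]; exact add_mem hy hz
  · exact zero_mem _
  · intro s t hs ht; exact add_mem hs ht

/-- The map `A ⊗ (A ⊗ X) → A ⊗ X`, `a ⊗ y ↦ a y - a ⊗ f y`. -/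
noncomputable def facesStep (X : DGMod A) (f : X.free.carrier →ₗ[A.carrier] X.carrier) :
    X.free.free.carrier →ₗ[A.carrier] X.free.carrier :=
  X.free.act - freeMap (f.restrictScalars ℚ)

theorem facesStep_tmul (X : DGMod A) (f : X.free.carrier →ₗ[A.carrier] X.carrier)
    (a : A.carrier) (y : X.free.carrier) :
    X.facesStep f (X.free.tmul a y) = a • y - X.tmul a (f y) := rfl

theorem act_mem (X : DGMod A) (m : ℤ) : ∀ t ∈ X.free.gr m, X.act t ∈ X.gr m := by
  refine X.free_gr_ind ?_ ?_ ?_ ?_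
  · rintro i j rfl a ha x hx
    rw [act_tmul]; exact X.smul_mem ha hx
  · rw [map_zero]; exact zero_mem _
  · intro s t hs ht; rw [map_add]; exact add_mem hs ht
  · intro q t ht; rw [LinearMap.map_smul_of_tower]; exact Submodule.smul_mem _ _ ht

theorem facesStep_mem (X : DGMod A) (f : X.free.carrier →ₗ[A.carrier] X.carrier)
    (hf : ∀ m, ∀ t ∈ X.free.gr m, f t ∈ X.gr m) (m : ℤ) :
    ∀ t ∈ X.free.free.gr m, X.facesStep f t ∈ X.free.gr m := by
  refine X.free.free_gr_ind ?_ ?_ ?_ ?_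
  · rintro i j rfl a ha x hx
    rw [facesStep_tmul]
    exact sub_mem (X.free.smul_mem ha hx) (X.tmul_mem ha (hf j x hx))
  · rw [map_zero]; exact zero_mem _
  · intro s t hs ht; rw [map_add]; exact add_mem hs ht
  · intro q t ht; rw [LinearMap.map_smul_of_tower]; exact Submodule.smul_mem _ _ ht

theorem act_d (X : DGMod A) (t : X.free.carrier) : X.act (X.free.d t) = X.d (X.act t) := by
  induction t using X.free_ind with
  | tmul a x => rw [d_tmul, map_add, act_tmul, act_tmul, act_tmul, X.d_smul']
  | zero => simp only [map_zero]
  | add s t hs ht => simp only [map_add, hs, ht]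

theorem facesStep_d (X : DGMod A) (f : X.free.carrier →ₗ[A.carrier] X.carrier)
    (hf : ∀ t, f (X.free.d t) = X.d (f t)) (t : X.free.free.carrier) :
    X.facesStep f (X.free.free.d t) = X.free.d (X.facesStep f t) := by
  induction t using X.free.free_ind with
  | tmul a x =>
    rw [d_tmul, map_add, facesStep_tmul, facesStep_tmul, facesStep_tmul, map_sub, X.free.d_smul',
      d_tmul, hf]
    abel
  | zero => simp only [map_zero]
  | add s t hs ht => simp only [map_add, hs, ht]

theorem act_facesStep (X : DGMod A) (t : X.free.free.carrier) :
    X.act (X.facesStep X.act t) = 0 := by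
  induction t using X.free.free_ind with
  | tmul a x => rw [facesStep_tmul, map_sub, map_smul, act_tmul, sub_self]
  | zero => simp only [map_zero]
  | add s t hs ht => simp only [map_add, hs, ht, add_zero]

theorem facesStep_facesStep (X : DGMod A) (f : X.free.carrier →ₗ[A.carrier] X.carrier)
    (hf : ∀ t, f (X.facesStep f t) = 0) (t : X.free.free.free.carrier) :
    X.facesStep f (X.free.facesStep (X.facesStep f) t) = 0 := by
  induction t using X.free.free.free_ind with
  | tmul a x =>
    rw [facesStep_tmul, map_sub, map_smul, facesStep_tmul, hf, map_zero, sub_zero, sub_self]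
  | zero => simp only [map_zero]
  | add s t hs ht => simp only [map_add, hs, ht, add_zero]

theorem facesStep_act_degen (X : DGMod A) :
    ∀ t ∈ X.degenStep ⊥, X.facesStep X.act t ∈ (⊥ : Submodule A.carrier X.free.carrier) := by
  intro t ht
  refine X.degenStep_ind ⊥ (P := fun t => X.facesStep X.act t ∈ (⊥ : Submodule A.carrier _))
    ?_ ?_ ?_ ?_ ht
  · intro a x
    rw [facesStep_tmul, act_tmul, smul_tmul, mul_one, one_smul, sub_self]
    exact zero_mem _
  · rintro a x rfl
    rw [map_zero, map_zero]; exact zero_mem _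
  · rw [map_zero]; exact zero_mem _
  · intro s t hs ht; rw [map_add]; exact add_mem hs ht

theorem facesStep_degenStep (X : DGMod A) (f : X.free.carrier →ₗ[A.carrier] X.carrier)
    (S : Submodule A.carrier X.free.carrier)
    (hf : ∀ t ∈ X.degenStep S, X.facesStep f t ∈ S) :
    ∀ t ∈ X.free.degenStep (X.degenStep S), X.free.facesStep (X.facesStep f) t ∈
      X.degenStep S := by
  intro t ht
  refine X.free.degenStep_ind _ (P := fun t => X.free.facesStep (X.facesStep f) t ∈ X.degenStep S)
    ?_ ?_ ?_ ?_ ht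
  · intro a x
    rw [facesStep_tmul, facesStep_tmul, one_smul, map_sub, smul_tmul, mul_one, sub_sub_cancel]
    exact X.unit_mem_degenStep S _ _
  · intro a x hx
    rw [facesStep_tmul]
    exact sub_mem (Submodule.smul_mem _ _ hx) (X.tmul_mem_degenStep S _ (hf x hx))
  · rw [map_zero]; exact zero_mem _
  · intro s t hs ht; rw [map_add]; exact add_mem hs ht

/-- The iterated free modules `A ⊗ ⋯ ⊗ A ⊗ V` with `n` factors `A`. -/
noncomputable def tensor (V : DGMod A) : ℕ → DGMod A
  | 0 => V
  | n + 1 => (tensor V n).free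

/-- The augmented bar differential `A^{⊗ (n + 1)} ⊗ V → A^{⊗ n} ⊗ V`, the alternating sum of the
face maps: `a₀ ⊗ x ↦ a₀ x - a₀ ⊗ δ x`, so that
`δ (a₀ ⊗ ⋯ ⊗ aₙ ⊗ v) = ∑ i < n, (-1) ^ i a₀ ⊗ ⋯ ⊗ aᵢ aᵢ₊₁ ⊗ ⋯ ⊗ v + (-1) ^ n a₀ ⊗ ⋯ ⊗ aₙ v`. -/
noncomputable def faces (V : DGMod A) :
    ∀ n, (V.tensor (n + 1)).carrier →ₗ[A.carrier] (V.tensor n).carrier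
  | 0 => V.act
  | n + 1 => (V.tensor n).facesStep (faces V n)

/-- The degenerate part of `A^{⊗ (p + 1)} ⊗ V`: the submodule generated by the images of the
degeneracy maps, that is, by the `a₀ ⊗ a₁ ⊗ ⋯ ⊗ aₚ ⊗ v` with `aᵢ = 1` for some `i ≥ 1`. -/
noncomputable def degen (V : DGMod A) : ∀ p, Submodule A.carrier (V.tensor (p + 1)).carrier
  | 0 => ⊥
  | p + 1 => (V.tensor p).degenStep (degen V p)

theorem d_degen (V : DGMod A) :
    ∀ p, ∀ x ∈ V.degen p, (V.tensor (p + 1)).d x ∈ V.degen p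
  | 0 => by rintro _ rfl; rw [map_zero]; exact zero_mem _
  | p + 1 => (V.tensor p).d_degenStep (d_degen V p)

theorem homogeneous_degen (V : DGMod A) : ∀ p, (V.tensor (p + 1)).IsHomogeneous (V.degen p)
  | 0 => by rintro n _ rfl; rw [map_zero]; exact zero_mem _
  | p + 1 => (V.tensor p).homogeneous_degenStep (homogeneous_degen V p)

theorem faces_mem (V : DGMod A) : ∀ (n : ℕ) (m : ℤ), ∀ x ∈ (V.tensor (n + 1)).gr m,
    V.faces n x ∈ (V.tensor n).gr m
  | 0 => V.act_mem
  | n + 1 => (V.tensor n).facesStep_mem _ (faces_mem V n)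

theorem faces_d (V : DGMod A) : ∀ (n : ℕ) (x : (V.tensor (n + 1)).carrier),
    V.faces n ((V.tensor (n + 1)).d x) = (V.tensor n).d (V.faces n x)
  | 0 => V.act_d
  | n + 1 => (V.tensor n).facesStep_d _ (faces_d V n)

theorem faces_faces (V : DGMod A) : ∀ (n : ℕ) (x : (V.tensor (n + 2)).carrier),
    V.faces n (V.faces (n + 1) x) = 0
  | 0 => V.act_facesStep
  | n + 1 => (V.tensor n).facesStep_facesStep _ (faces_faces V n)

theorem faces_degen (V : DGMod A) : ∀ (p : ℕ), ∀ x ∈ V.degen (p + 1),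
    V.faces (p + 1) x ∈ V.degen p
  | 0 => V.facesStep_act_degen
  | p + 1 => (V.tensor p).facesStep_degenStep _ _ (faces_degen V p)

/-- The normalised bar construction in simplicial degree `p`, the quotient
`A ⊗ (A / ℚ)^{⊗ p} ⊗ V` of `A ⊗ A^{⊗ p} ⊗ V` by its degenerate part. -/
noncomputable def normalised (V : DGMod A) (p : ℕ) : DGMod A :=
  (V.tensor (p + 1)).quot (V.degen p) (V.homogeneous_degen p) (V.d_degen p)

/-- The simplicial differential of the normalised bar construction. -/
noncomputable def barDelta (V : DGMod A) (p : ℕ) :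
    (V.normalised (p + 1)).carrier →ₗ[A.carrier] (V.normalised p).carrier :=
  (V.degen (p + 1)).mapQ (V.degen p) (V.faces (p + 1)) (V.faces_degen p)

theorem barDelta_mem (V : DGMod A) (p : ℕ) (m : ℤ) :
    ∀ x ∈ (V.normalised (p + 1)).gr m, V.barDelta p x ∈ (V.normalised p).gr m := by
  rintro _ ⟨x, hx, rfl⟩
  exact ⟨V.faces (p + 1) x, V.faces_mem (p + 1) m x hx, rfl⟩

theorem barDelta_d (V : DGMod A) (p : ℕ) (x : (V.normalised (p + 1)).carrier) :
    V.barDelta p ((V.normalised (p + 1)).d x) = (V.normalised p).d (V.barDelta p x) := by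
  obtain ⟨x, rfl⟩ := (V.degen (p + 1)).mkQ_surjective x
  exact congrArg (V.degen p).mkQ (V.faces_d (p + 1) x)

theorem barDelta_barDelta (V : DGMod A) (p : ℕ) (x : (V.normalised (p + 2)).carrier) :
    V.barDelta p (V.barDelta (p + 1) x) = 0 := by
  obtain ⟨x, rfl⟩ := (V.degen (p + 2)).mkQ_surjective x
  exact (congrArg (V.degen p).mkQ (V.faces_faces (p + 1) x)).trans (map_zero _)

/-! ### Total complexes -/

/-- The part of degree `n` of the direct sum of the `X p`, with `X p` shifted up by `p`. -/
noncomputable def totalGr (X : ℕ → DGMod A) (n : ℤ) :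
    Submodule ℚ (DirectSum ℕ fun p => (X p).carrier) :=
  ⨆ p : ℕ, ((X p).gr (n - p)).map (DirectSum.lof ℚ ℕ (fun p => (X p).carrier) p)

/-- The total differential: `x ↦ d x + (-1) ^ |x| δ x`, where `|x|` is the degree of `x` in `X p`,
before shifting. -/
noncomputable def totalD (X : ℕ → DGMod A)
    (δ : ∀ p, (X (p + 1)).carrier →ₗ[A.carrier] (X p).carrier) :
    (DirectSum ℕ fun p => (X p).carrier) →ₗ[ℚ] DirectSum ℕ fun p => (X p).carrier :=
  DirectSum.toModule ℚ ℕ _ fun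
    | 0 => DirectSum.lof ℚ ℕ (fun p => (X p).carrier) 0 ∘ₗ (X 0).d
    | p + 1 => DirectSum.lof ℚ ℕ (fun p => (X p).carrier) (p + 1) ∘ₗ (X (p + 1)).d +
        DirectSum.lof ℚ ℕ (fun p => (X p).carrier) p ∘ₗ (δ p).restrictScalars ℚ ∘ₗ
          parity (X (p + 1)).internal


theorem lof_mem_totalGr (X : ℕ → DGMod A) (p : ℕ) {m n : ℤ} (h : m + p = n) {x : (X p).carrier}
    (hx : x ∈ (X p).gr m) : DirectSum.lof ℚ ℕ (fun p => (X p).carrier) p x ∈ totalGr X n := by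
  subst h
  refine Submodule.mem_iSup_of_mem p ⟨x, ?_, rfl⟩
  rwa [add_sub_cancel_right]

theorem totalGr_induction (X : ℕ → DGMod A) {n : ℤ}
    {P : (DirectSum ℕ fun p => (X p).carrier) → Prop}
    (lof : ∀ (p : ℕ) (m : ℤ), m + p = n → ∀ x ∈ (X p).gr m,
      P (DirectSum.lof ℚ ℕ (fun p => (X p).carrier) p x)) (zero : P 0)
    (add : ∀ s t, P s → P t → P (s + t)) (t : DirectSum ℕ fun p => (X p).carrier)
    (ht : t ∈ totalGr X n) : P t := by
  refine Submodule.iSup_induction _ (motive := P) ht ?_ zero add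
  rintro p _ ⟨x, hx, rfl⟩
  exact lof p (n - p) (by ring) x hx

theorem total_induction (X : ℕ → DGMod A) {P : (DirectSum ℕ fun p => (X p).carrier) → Prop}
    (lof : ∀ (p : ℕ) (x : (X p).carrier),
      P (DirectSum.lof ℚ ℕ (fun p => (X p).carrier) p x)) (zero : P 0)
    (add : ∀ s t, P s → P t → P (s + t)) (t : DirectSum ℕ fun p => (X p).carrier) : P t :=
  DirectSum.induction_on t zero lof add

theorem totalD_zero (X : ℕ → DGMod A) (δ : ∀ p, (X (p + 1)).carrier →ₗ[A.carrier] (X p).carrier)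
    (x : (X 0).carrier) : totalD X δ (DirectSum.lof ℚ ℕ (fun p => (X p).carrier) 0 x) =
      DirectSum.lof ℚ ℕ (fun p => (X p).carrier) 0 ((X 0).d x) := by
  rw [totalD, DirectSum.toModule_lof]; rfl

theorem totalD_succ (X : ℕ → DGMod A) (δ : ∀ p, (X (p + 1)).carrier →ₗ[A.carrier] (X p).carrier)
    (p : ℕ) (x : (X (p + 1)).carrier) :
    totalD X δ (DirectSum.lof ℚ ℕ (fun p => (X p).carrier) (p + 1) x) =
      DirectSum.lof ℚ ℕ (fun p => (X p).carrier) (p + 1) ((X (p + 1)).d x) +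
      DirectSum.lof ℚ ℕ (fun p => (X p).carrier) p (δ p (parity (X (p + 1)).internal x)) := by
  rw [totalD, DirectSum.toModule_lof]; rfl

theorem total_internal (X : ℕ → DGMod A) : DirectSum.IsInternal (totalGr X) := by
  refine isInternal_of_weight (DirectSum.toModule ℚ ℕ _ fun p =>
    Finsupp.lmapDomain _ ℚ (fun m : ℤ => m + p) ∘ₗ
      Finsupp.mapRange.linearMap (DirectSum.lof ℚ ℕ (fun p => (X p).carrier) p) ∘ₗ
      components (X p).internal) ?_ ?_
  · intro n
    refine totalGr_induction X ?_ ?_ ?_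
    · rintro p m rfl x hx
      rw [DirectSum.toModule_lof]
      simp [components_of_mem _ hx]
    · simp
    · intro s t hs ht; rw [map_add, hs, ht, Finsupp.single_add]
  · refine total_induction X ?_ (zero_mem _) (fun s t hs ht => add_mem hs ht)
    intro p x
    induction x using graded_induction (X p).internal with
    | mem m x hx => exact Submodule.mem_iSup_of_mem _ (lof_mem_totalGr X p rfl hx)
    | zero => rw [map_zero]; exact zero_mem _
    | add y z hy hz => rw [map_add]; exact add_mem hy hz

theorem smul_lof (X : ℕ → DGMod A) (a : A.carrier) (p : ℕ) (x : (X p).carrier) :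
    a • DirectSum.lof ℚ ℕ (fun p => (X p).carrier) p x =
      DirectSum.lof ℚ ℕ (fun p => (X p).carrier) p (a • x) :=
  (LinearMap.map_smul (DirectSum.lof A.carrier ℕ (fun p => (X p).carrier) p) a x).symm

/-- The total dg module of a complex `⋯ → X 1 → X 0` of dg modules: the sum of the `X p` shifted
up by `p`, with the total differential. -/
noncomputable def total (X : ℕ → DGMod A)
    (δ : ∀ p, (X (p + 1)).carrier →ₗ[A.carrier] (X p).carrier)
    (δ_mem : ∀ p m, ∀ x ∈ (X (p + 1)).gr m, δ p x ∈ (X p).gr m)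
    (δ_d : ∀ p x, δ p ((X (p + 1)).d x) = (X p).d (δ p x))
    (δ_δ : ∀ p x, δ p (δ (p + 1) x) = 0) : DGMod A where
  carrier := DirectSum ℕ fun p => (X p).carrier
  tower := ⟨fun q a t => by
    induction t using total_induction X with
    | lof p x => rw [smul_lof, smul_lof, smul_assoc, map_smul]
    | zero => simp only [smul_zero]
    | add s t hs ht => simp only [smul_add, hs, ht]⟩
  gr := totalGr X
  internal := total_internal X
  smul_mem := by
    intro i n a t ha
    refine totalGr_induction X (P := fun t => a • t ∈ totalGr X (i + n)) ?_ ?_ ?_ t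
    · rintro p m rfl x hx
      rw [smul_lof]
      exact lof_mem_totalGr X p (by ring) ((X p).smul_mem ha hx)
    · rw [smul_zero]; exact zero_mem _
    · intro s t hs ht; rw [smul_add]; exact add_mem hs ht
  d := totalD X δ
  d_mem := by
    intro n t
    refine totalGr_induction X (P := fun t => totalD X δ t ∈ totalGr X (n - 1)) ?_ ?_ ?_ t
    · rintro (_ | p) m rfl x hx
      · rw [totalD_zero]
        exact lof_mem_totalGr X 0 (by ring) ((X 0).d_mem hx)
      · rw [totalD_succ, parity_of_mem _ hx, LinearMap.map_smul_of_tower, map_smul]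
        exact add_mem (lof_mem_totalGr X (p + 1) (by ring) ((X (p + 1)).d_mem hx))
          (Submodule.smul_mem _ _ (lof_mem_totalGr X p (by push_cast; ring) (δ_mem p _ x hx)))
    · rw [map_zero]; exact zero_mem _
    · intro s t hs ht; rw [map_add]; exact add_mem hs ht
  d_d := by
    refine total_induction X ?_ ?_ ?_
    · rintro (_ | _ | p) x
      · rw [totalD_zero, totalD_zero, (X 0).d_d, map_zero]
      · rw [totalD_succ, map_add, totalD_succ, totalD_zero, (X _).d_d, map_zero, (X _).parity_d,
          map_neg, map_neg, δ_d, zero_add, neg_add_cancel]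
      · have hp : δ (p + 1) (parity (X (p + 2)).internal x) =
            parity (X (p + 1)).internal (δ (p + 1) x) :=
          map_parity (X (p + 2)).internal (X (p + 1)).internal
            ((δ (p + 1)).restrictScalars ℚ) (δ_mem (p + 1)) x
        rw [totalD_succ, map_add, totalD_succ, totalD_succ, (X _).d_d, map_zero, (X _).parity_d,
          map_neg, map_neg, δ_d, zero_add, neg_add_cancel_left,
          hp, parity_parity, δ_δ, map_zero]
    · rw [map_zero, map_zero]
    · intro s t hs ht; rw [map_add, map_add, hs, ht, add_zero]
  d_smul := by
    intro i a t ha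
    induction t using total_induction X with
    | lof p x =>
      rcases p with _ | p
      · rw [smul_lof, totalD_zero, totalD_zero, smul_lof, smul_lof, (X 0).d_smul x ha, map_add,
          LinearMap.map_smul (DirectSum.lof ℚ ℕ (fun p => (X p).carrier) 0) ((-1 : ℚ) ^ i)]
      · have hl := fun (p : ℕ) (y : (X p).carrier) =>
          LinearMap.map_smul (DirectSum.lof ℚ ℕ (fun p => (X p).carrier) p) ((-1 : ℚ) ^ i) y
        have h1 : δ p (parity (X (p + 1)).internal (a • x)) =
            (-1 : ℚ) ^ i • (a • δ p (parity (X (p + 1)).internal x)) := by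
          rw [(X _).parity_smul, parity_of_mem _ ha, smul_assoc, LinearMap.map_smul_of_tower,
            LinearMap.map_smul (δ p) a]
        rw [smul_lof, totalD_succ, totalD_succ, h1, (X _).d_smul x ha, map_add, hl, hl, smul_lof,
          smul_add, smul_add, smul_lof, smul_lof, add_assoc]
    | zero => simp only [smul_zero, map_zero, add_zero]
    | add s t hs ht => simp only [smul_add, map_add, hs, ht]; abel

/-! ### The bar resolution and its skeletal filtration -/

/-- The bar resolution `B(A, V)`: the total dg module of the normalised bar construction. -/
noncomputable def bar (V : DGMod A) : DGMod A :=
  total V.normalised V.barDelta V.barDelta_mem V.barDelta_d V.barDelta_barDelta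

/-- The part of simplicial degree `≤ p` of a total dg module. -/
noncomputable def totalSkeleton (X : ℕ → DGMod A) (p : ℤ) :
    Submodule A.carrier (DirectSum ℕ fun j => (X j).carrier) :=
  ⨆ (j : ℕ) (_ : (j : ℤ) ≤ p),
    LinearMap.range (DirectSum.lof A.carrier ℕ (fun j => (X j).carrier) j)

theorem lof_mem_totalSkeleton (X : ℕ → DGMod A) {p : ℤ} {j : ℕ} (h : (j : ℤ) ≤ p)
    (x : (X j).carrier) :
    DirectSum.lof ℚ ℕ (fun j => (X j).carrier) j x ∈ totalSkeleton X p :=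
  Submodule.mem_iSup_of_mem j (Submodule.mem_iSup_of_mem h ⟨x, rfl⟩)

theorem totalD_skeleton (X : ℕ → DGMod A)
    (δ : ∀ p, (X (p + 1)).carrier →ₗ[A.carrier] (X p).carrier) (p : ℤ) :
    ∀ b ∈ totalSkeleton X p, totalD X δ b ∈ totalSkeleton X p := by
  intro b hb
  refine Submodule.iSup_induction _ (motive := fun b => totalD X δ b ∈ totalSkeleton X p) hb
    ?_ ?_ ?_
  · intro j b hb
    by_cases h : (j : ℤ) ≤ p
    · rw [iSup_pos h] at hb
      obtain ⟨x, rfl⟩ := hb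
      rcases j with _ | j
      · exact (totalD_zero X δ x).symm ▸ lof_mem_totalSkeleton X h _
      · exact (totalD_succ X δ j x).symm ▸
          add_mem (lof_mem_totalSkeleton X h _) (lof_mem_totalSkeleton X (by push_cast at h; lia) _)
    · rw [iSup_neg h] at hb
      obtain rfl : b = 0 := hb
      rw [map_zero]; exact zero_mem _
  · rw [map_zero]; exact zero_mem _
  · intro s t hs ht; rw [map_add]; exact add_mem hs ht

/-- The `p`-skeleton `B_p(A, V)` of the bar resolution, spanned by the simplicial degrees `≤ p`;
it vanishes for `p < 0`. -/
noncomputable def skeleton (V : DGMod A) (p : ℤ) : Submodule A.carrier V.bar.carrier :=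
  totalSkeleton V.normalised p

theorem skeleton_mono (V : DGMod A) {p p' : ℤ} (h : p ≤ p') : V.skeleton p ≤ V.skeleton p' :=
  iSup_mono fun _ => iSup_mono' fun hj => ⟨hj.trans h, le_rfl⟩

theorem d_skeleton (V : DGMod A) (p : ℤ) : ∀ b ∈ V.skeleton p, V.bar.d b ∈ V.skeleton p :=
  totalD_skeleton V.normalised V.barDelta p

end DGMod

/-! ## Complexes of homomorphisms -/

/-- The homogeneous maps of degree `n` between graded modules: linear maps `f` which raise degrees
by `n` and satisfy `f (a x) = (-1) ^ (n |a|) a f x`. -/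
def GrMod.homGr {R : GrAlg.{u}} (M N : GrMod R) (n : ℤ) :
    Submodule ℚ (M.carrier →ₗ[ℚ] N.carrier) where
  carrier := {f | (∀ i, ∀ x ∈ M.gr i, f x ∈ N.gr (i + n)) ∧
    ∀ i, ∀ a ∈ R.gr i, ∀ x, f (a • x) = (-1 : ℚ) ^ (n * i) • (a • f x)}
  add_mem' := by
    rintro f g ⟨hf, hf'⟩ ⟨hg, hg'⟩
    refine ⟨fun i x hx => add_mem (hf i x hx) (hg i x hx), fun i a ha x => ?_⟩
    rw [LinearMap.add_apply, LinearMap.add_apply, hf' i a ha, hg' i a ha, smul_add, smul_add]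
  zero_mem' := ⟨fun i x hx => zero_mem _, fun i a ha x => by simp⟩
  smul_mem' := by
    rintro q f ⟨hf, hf'⟩
    refine ⟨fun i x hx => Submodule.smul_mem _ _ (hf i x hx), fun i a ha x => ?_⟩
    rw [LinearMap.smul_apply, LinearMap.smul_apply, hf' i a ha, smul_comm q, smul_comm q a]

/-- The differential `f ↦ d f - (-1) ^ n f d` on maps of degree `n` between dg modules. -/
noncomputable def DGMod.homD {A : DGAlg.{u}} (M N : DGMod A) (n : ℤ) :
    (M.carrier →ₗ[ℚ] N.carrier) →ₗ[ℚ] (M.carrier →ₗ[ℚ] N.carrier) :=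
  LinearMap.llcomp ℚ _ _ _ N.d - (-1 : ℚ) ^ n • LinearMap.lcomp ℚ N.carrier M.d

theorem DGMod.homD_apply {A : DGAlg.{u}} (M N : DGMod A) (n : ℤ) (f : M.carrier →ₗ[ℚ] N.carrier)
    (x : M.carrier) : M.homD N n f x = N.d (f x) - (-1 : ℚ) ^ n • f (M.d x) := rfl

theorem DGMod.homD_mem {A : DGAlg.{u}} (M N : DGMod A) {n : ℤ} {f : M.carrier →ₗ[ℚ] N.carrier}
    (hf : f ∈ M.homGr N.toGrMod n) : M.homD N n f ∈ M.homGr N.toGrMod (n - 1) := by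
  have e : ∀ m : ℤ, (-1 : ℚ) ^ m * (-1) ^ m = 1 := fun m => by rw [← mul_zpow]; norm_num
  obtain ⟨h1, h2⟩ := hf
  refine ⟨fun i x hx => ?_, fun i a ha x => ?_⟩
  · rw [homD_apply]
    refine sub_mem ?_ (Submodule.smul_mem _ _ ?_)
    · have := N.d_mem (h1 i x hx)
      rwa [add_sub_assoc] at this
    · have := h1 _ _ (M.d_mem hx)
      rwa [show i - 1 + n = i + (n - 1) by ring] at this
  · have e1 : (-1 : ℚ) ^ ((n - 1) * i) = (-1) ^ (n * i) * (-1) ^ i := by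
      rw [sub_mul, one_mul, zpow_sub₀ (by norm_num), div_eq_mul_inv, ← inv_zpow]; norm_num
    have e2 : (-1 : ℚ) ^ (n * (i - 1)) = (-1) ^ (n * i) * (-1) ^ n := by
      rw [mul_sub, mul_one, zpow_sub₀ (by norm_num), div_eq_mul_inv, ← inv_zpow]; norm_num
    have h3 : f ((-1 : ℚ) ^ i • (a • M.d x)) = (-1 : ℚ) ^ i • f (a • M.d x) := map_smul f _ _
    have h4 : N.d ((-1 : ℚ) ^ (n * i) • (a • f x)) = (-1 : ℚ) ^ (n * i) • N.d (a • f x) :=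
      map_smul N.d _ _
    rw [homD_apply, homD_apply, h2 i a ha, h4, N.d_smul _ ha, M.d_smul _ ha, map_add, h3,
      h2 _ _ (A.d_mem ha), h2 i a ha, e1, e2]
    simp only [smul_add, smul_sub, smul_smul, smul_comm a ((-1 : ℚ) ^ n)]
    rw [show (-1 : ℚ) ^ n * ((-1) ^ (n * i) * (-1) ^ n) = (-1) ^ (n * i) by
        rw [mul_left_comm, e, mul_one],
      show (-1 : ℚ) ^ n * ((-1) ^ i * (-1) ^ (n * i)) = (-1) ^ (n * i) * (-1) ^ i * (-1) ^ n by
        ring]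
    abel

theorem DGMod.homD_homD {A : DGAlg.{u}} (M N : DGMod A) (n : ℤ) (f : M.carrier →ₗ[ℚ] N.carrier) :
    M.homD N (n - 1) (M.homD N n f) = 0 := by
  ext x
  rw [homD_apply, homD_apply, homD_apply, map_sub, N.d_d, M.d_d, map_zero, smul_zero, sub_zero,
    map_smul, zpow_sub_one₀ (by norm_num)]
  simp

/-! ## Filtered complexes and their spectral sequences -/

/-- A complex of rational vector spaces with a decreasing filtration. The terms `gr n` of the
complex are subspaces of a common ambient space, and `d n` is the differential on `gr n`. -/
structure FilteredComplex : Type (u + 1) where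
  carrier : Type u
  [addCommGroup : AddCommGroup carrier]
  [module : Module ℚ carrier]
  gr : ℤ → Submodule ℚ carrier
  d : ℤ → carrier →ₗ[ℚ] carrier
  d_mem : ∀ {n : ℤ} {x : carrier}, x ∈ gr n → d n x ∈ gr (n - 1)
  d_d : ∀ {n : ℤ} {x : carrier}, x ∈ gr n → d (n - 1) (d n x) = 0
  fil : ℤ → Submodule ℚ carrier
  fil_antitone : Antitone fil
  d_fil : ∀ {n p : ℤ} {x : carrier}, x ∈ gr n → x ∈ fil p → d n x ∈ fil p

attribute [instance] FilteredComplex.addCommGroup FilteredComplex.module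

namespace FilteredComplex

variable (K : FilteredComplex.{u})

/-- The cycles of degree `n`. -/
def cycles (n : ℤ) : Submodule ℚ K.carrier := K.gr n ⊓ LinearMap.ker (K.d n)

/-- The boundaries of degree `n`. -/
def boundaries (n : ℤ) : Submodule ℚ K.carrier := (K.gr (n + 1)).map (K.d (n + 1))

/-- The homology in degree `n`. -/
abbrev Homology (n : ℤ) : Type u := K.cycles n ⧸ (K.boundaries n).comap (K.cycles n).subtype

/-- The induced filtration of the homology: the classes of the cycles of filtration `≥ p`. -/
def homologyFil (n p : ℤ) : Submodule ℚ (K.Homology n) :=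
  ((K.fil p).comap (K.cycles n).subtype).map (Submodule.mkQ _)

/-- The `r`-th approximate cycles: elements `x` of degree `n` and filtration `≥ p` such that `d x`
has filtration `≥ p + r`. -/
def pageCycles (r p n : ℤ) : Submodule ℚ K.carrier :=
  K.gr n ⊓ K.fil p ⊓ (K.fil (p + r)).comap (K.d n)

/-- The elements of `pageCycles r p n` which represent zero on the `r`-th page. -/
def pageBoundaries (r p n : ℤ) : Submodule ℚ K.carrier :=
  K.pageCycles (r - 1) (p + 1) n ⊔ (K.pageCycles (r - 1) (p - r + 1) (n + 1)).map (K.d (n + 1))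

end FilteredComplex

/-- Spectral sequences of rational vector spaces with pages `r ≥ 1`, indexed so that the
differentials are maps `d_r : E_r^{p,q} → E_r^{p+r,q+r-1}`. -/
abbrev SpecSeq : Type (u + 1) :=
  CategoryTheory.SpectralSequence (ModuleCat.{u} ℚ)
    (fun r => ComplexShape.up' ((r, r - 1) : ℤ × ℤ)) 1

/-- An identification of `E` with the spectral sequence of the filtered complex `K`: the term
`E_r^{p,q}` is the space of `r`-th approximate cycles of degree `q - p` and filtration `p` modulo
those that represent zero, the differentials are induced by that of `K`, and so are the
isomorphisms between the homology of each page and the next page. -/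
structure FilteredComplex.SpectralSequenceIso (K : FilteredComplex.{u}) (E : SpecSeq.{u}) where
  π (r : ℤ) (hr : 1 ≤ r) (p q : ℤ) : K.pageCycles r p (q - p) →ₗ[ℚ] (E.page r hr).X (p, q)
  surjective (r : ℤ) (hr : 1 ≤ r) (p q : ℤ) : Function.Surjective (π r hr p q)
  eq_zero_iff (r : ℤ) (hr : 1 ≤ r) (p q : ℤ) (z : K.pageCycles r p (q - p)) :
    π r hr p q z = 0 ↔ (z : K.carrier) ∈ K.pageBoundaries r p (q - p)
  d_π (r : ℤ) (hr : 1 ≤ r) (p q : ℤ) (z : K.pageCycles r p (q - p))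
    (z' : K.pageCycles r (p + r) (q + (r - 1) - (p + r)))
    (h : K.d (q - p) (z : K.carrier) = z') :
    ((E.page r hr).d (p, q) (p + r, q + (r - 1))).hom (π r hr p q z) =
      π r hr (p + r) (q + (r - 1)) z'
  iso_π (r : ℤ) (hr : 1 ≤ r) (p q : ℤ) (z : K.pageCycles r p (q - p))
    (z' : K.pageCycles (r + 1) p (q - p)) (h : (z : K.carrier) = z')
    (c : (E.page r hr).cycles (p, q)) (hc : ((E.page r hr).iCycles (p, q)).hom c = π r hr p q z) :
    (E.iso r (r + 1) (p, q) rfl hr).hom.hom (((E.page r hr).homologyπ (p, q)).hom c) =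
      π (r + 1) (by lia) p q z'

/-- Strong convergence `E_r^{p,q} ⇒ H_{q-p}` with respect to a decreasing filtration `F` of each
`H n`: the filtration of each `H n` is finite, and for each `(p, q)` the differentials into and out
of `E_r^{p,q}` eventually vanish and its stable value is the `p`-th graded piece of `H (q - p)`. -/
structure SpecSeq.StronglyConverges (E : SpecSeq.{u}) (H : ℤ → Type u)
    [∀ n, AddCommGroup (H n)] [∀ n, Module ℚ (H n)] (F : ∀ n, ℤ → Submodule ℚ (H n)) : Prop where
  antitone (n : ℤ) : Antitone (F n)
  exhaustive (n : ℤ) : ∃ p, F n p = ⊤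
  separated (n : ℤ) : ∃ p, F n p = ⊥
  stable (p q : ℤ) : ∃ r₀ : ℤ, ∀ (r : ℤ) (hr : 1 ≤ r), r₀ ≤ r →
    (∀ x, (E.page r hr).d (p, q) x = 0) ∧ (∀ x, (E.page r hr).d x (p, q) = 0) ∧
    Nonempty ((E.page r hr).X (p, q) ≃ₗ[ℚ]
      (F (q - p) p ⧸ (F (q - p) (p + 1)).comap (F (q - p) p).subtype))

/-- The complex `[B(A, V), W]_A` of `A`-linear maps, filtered by the subcomplexes of maps that
vanish on the skeleta: `f` has filtration `≥ p` if it vanishes on `B_{p-1}(A, V)`, that is, if it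
lies in the kernel of the restriction to `[B_{p-1}(A, V), W]_A`. -/
noncomputable def DGMod.barHom {A : DGAlg.{u}} (V W : DGMod A) : FilteredComplex.{u} where
  carrier := V.bar.carrier →ₗ[ℚ] W.carrier
  gr n := V.bar.homGr W.toGrMod n
  d n := V.bar.homD W n
  d_mem := fun hf => V.bar.homD_mem W hf
  d_d := fun _ => V.bar.homD_homD W _ _
  fil p :=
    { carrier := {f | ∀ b ∈ V.skeleton (p - 1), f b = 0}
      add_mem' := fun {f g} hf hg b hb => by rw [LinearMap.add_apply, hf b hb, hg b hb, add_zero]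
      zero_mem' := fun b _ => rfl
      smul_mem' := fun q f hf b hb => by rw [LinearMap.smul_apply, hf b hb, smul_zero] }
  fil_antitone := fun p p' h f hf b hb => hf b (V.skeleton_mono (by lia) hb)
  d_fil := fun {n p f} _ hf b hb => by
    rw [homD_apply, hf b hb, hf _ (V.d_skeleton _ b hb), map_zero, smul_zero, sub_zero]

/-- The hyper-Ext group `Ext^n_A(V, W) = H_n [B(A, V), W]_A`. -/
abbrev DGMod.Ext {A : DGAlg.{u}} (V W : DGMod A) (n : ℤ) : Type u := (V.barHom W).Homology n

/-! ## Ext groups of graded modules -/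

namespace GrMod

variable {R : GrAlg.{u}}

/-- A map of graded modules is graded if it preserves degrees. -/
def IsGraded {M N : GrMod R} (f : M.carrier →ₗ[R.carrier] N.carrier) : Prop :=
  ∀ n, ∀ x ∈ M.gr n, f x ∈ N.gr n

/-- Projective objects of the category of graded modules. -/
def IsProjective (P : GrMod R) : Prop :=
  ∀ (M N : GrMod.{u} R) (g : M.carrier →ₗ[R.carrier] N.carrier)
    (f : P.carrier →ₗ[R.carrier] N.carrier), IsGraded g → Function.Surjective g → IsGraded f →
    ∃ h : P.carrier →ₗ[R.carrier] M.carrier, IsGraded h ∧ g ∘ₗ h = f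

/-- A projective resolution `⋯ → P₁ → P₀ → M → 0` in the category of graded modules. -/
structure ProjRes (M : GrMod.{u} R) : Type (u + 1) where
  X : ℕ → GrMod.{u} R
  projective : ∀ p, (X p).IsProjective
  δ : ∀ p, (X (p + 1)).carrier →ₗ[R.carrier] (X p).carrier
  δ_graded : ∀ p, IsGraded (δ p)
  ε : (X 0).carrier →ₗ[R.carrier] M.carrier
  ε_graded : IsGraded ε
  ε_surjective : Function.Surjective ε
  exact_zero : Function.Exact (δ 0) ε
  exact_succ : ∀ p, Function.Exact (δ (p + 1)) (δ p)

namespace ProjRes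

variable {M : GrMod.{u} R} (P : ProjRes M) (N : GrMod.{u} R)

/-- The `p`-cocycles of the complex `Hom_R(P_•, N)_q` of maps of internal degree `q`. -/
def cocycles (p : ℕ) (q : ℤ) : Submodule ℚ ((P.X p).carrier →ₗ[ℚ] N.carrier) :=
  (P.X p).homGr N q ⊓
    LinearMap.ker (LinearMap.lcomp ℚ N.carrier ((P.δ p).restrictScalars ℚ))

/-- The `p`-coboundaries of the complex `Hom_R(P_•, N)_q`. -/
def coboundaries : ∀ (p : ℕ) (_ : ℤ), Submodule ℚ ((P.X p).carrier →ₗ[ℚ] N.carrier)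
  | 0, _ => ⊥
  | p + 1, q => ((P.X p).homGr N q).map
      (LinearMap.lcomp ℚ N.carrier ((P.δ p).restrictScalars ℚ))

/-- The group `Ext^{p,q}_R(M, N)`, computed by the projective resolution `P` of `M`. -/
abbrev Ext (p : ℕ) (q : ℤ) : Type u :=
  P.cocycles N p q ⧸ (P.coboundaries N p q).comap (P.cocycles N p q).subtype

end ProjRes

end GrMod

end HyperExt

/-! In simplicial degree `p` the normalised bar construction is `A ⊗ C_p`, where `C_p = Ā^{⊗p} ⊗ V`
is a complex of vector spaces. Over the field `ℚ` such a complex is the sum of its homology and a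
contractible complex, so it has a homogeneous basis of the form `h ⊔ c ⊔ d c` with cycles `h`
(`exists_split_basis`). The same vectors form a basis of `A ⊗ C_p` over `A`
(`IsFreeSub.exists_splitBasis`). From such a `SplitBasis` one reads off all that is needed about
maps from `A ⊗ C_p` to `W`. The homology of `A ⊗ C_p` is free over `H(A)` on the classes of the `h`
(`homologyBasis`). Every homogeneous `H(A)`-linear map into `H(W)` is induced by a cocycle
(`exists_homologyMap_eq`). A cocycle that induces zero is a coboundary
(`exists_of_homologyMap_eq_zero`). In other words, the first page is `Hom_{H(A)}(H(A ⊗ C_p), H(W))`.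

The contraction `x ↦ 1 ⊗ x` of the bar construction is not `A`-linear, but it commutes with the
internal differentials. It therefore survives to homology and shows that the modules `H(A ⊗ C_p)`
form a projective resolution of `H(V)` (`homologyRes`). Hence the second page is `Ext` over `H(A)`.
The argument treats the second page directly: an approximate cycle is sent to the map on homology
induced by its leading component (`leading`), and `nonempty_page_two_equiv` determines the kernel
and the image. The comparison theorem (`nonempty_ext_equiv`) then allows any projective resolution.

For convergence, `F^0` is the whole complex, so only high filtrations matter. As the Lie algebra is
reduced, `Ā` lives in degrees `≥ 1`, so the lower bound on the homology of `C_p` rises with `p`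
(`barKer_acyclic`). A map `A ⊗ C_p → W` of degree `n + p` sends the cycles `h` to degrees that grow
with `p`, and these eventually lie where `W` has no homology. For fixed `n` and large `p` every
cocycle of this kind is then a coboundary. Maps out of a direct sum form a product, so primitives
can be assembled one simplicial degree after another, and `F^p` is exact in degree `n` for large `p`
(`exists_homD_eq_of_fil`). Strong convergence follows formally
(`FilteredComplex.stronglyConverges`). -/

namespace HyperExt

open CategoryTheory
open scoped TensorProduct

/-- Two surjections with the same kernel have isomorphic targets. -/
noncomputable def equivOfKerEq {R N P Q : Type*} [Ring R] [AddCommGroup N] [Module R N]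
    [AddCommGroup P] [Module R P] [AddCommGroup Q] [Module R Q] (f : N →ₗ[R] P) (g : N →ₗ[R] Q)
    (hf : Function.Surjective f) (hg : Function.Surjective g)
    (h : LinearMap.ker f = LinearMap.ker g) : P ≃ₗ[R] Q :=
  (f.quotKerEquivOfSurjective hf).symm ≪≫ₗ Submodule.quotEquivOfEq _ _ h ≪≫ₗ
    g.quotKerEquivOfSurjective hg

theorem equivOfKerEq_apply {R N P Q : Type*} [Ring R] [AddCommGroup N] [Module R N]
    [AddCommGroup P] [Module R P] [AddCommGroup Q] [Module R Q] (f : N →ₗ[R] P) (g : N →ₗ[R] Q)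
    (hf : Function.Surjective f) (hg : Function.Surjective g)
    (h : LinearMap.ker f = LinearMap.ker g) (x : N) : equivOfKerEq f g hf hg h (f x) = g x := by
  have h1 : (f.quotKerEquivOfSurjective hf).symm (f x) = Submodule.Quotient.mk x := by
    rw [LinearEquiv.symm_apply_eq]; rfl
  simp only [equivOfKerEq, LinearEquiv.trans_apply, h1]
  rfl

/-! ### The spectral sequence of a filtered complex -/

namespace FilteredComplex

variable (K : FilteredComplex.{u})

theorem mem_pageCycles {r p n : ℤ} {x : K.carrier} :
    x ∈ K.pageCycles r p n ↔ x ∈ K.gr n ∧ x ∈ K.fil p ∧ K.d n x ∈ K.fil (p + r) := by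
  simp [pageCycles, and_assoc]

theorem mem_pageBoundaries {r p n : ℤ} {x : K.carrier} :
    x ∈ K.pageBoundaries r p n ↔ ∃ a ∈ K.pageCycles (r - 1) (p + 1) n,
      ∃ b ∈ K.pageCycles (r - 1) (p - r + 1) (n + 1), a + K.d (n + 1) b = x := by
  simp [pageBoundaries, Submodule.mem_sup]

theorem d_d' {n m : ℤ} (h : m = n - 1) {x : K.carrier} (hx : x ∈ K.gr n) :
    K.d m (K.d n x) = 0 := by
  subst h; exact K.d_d hx

theorem d_mem' {n m : ℤ} (h : m = n - 1) {x : K.carrier} (hx : x ∈ K.gr n) :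
    K.d n x ∈ K.gr m := by
  subst h; exact K.d_mem hx

theorem d_mem_pageCycles {r p n p' n' s : ℤ} (hp : p' = p + r) (hn : n' = n - 1) {x : K.carrier}
    (hx : x ∈ K.pageCycles r p n) : K.d n x ∈ K.pageCycles s p' n' := by
  subst hp
  rw [mem_pageCycles] at *
  refine ⟨K.d_mem' hn hx.1, hx.2.2, ?_⟩
  rw [K.d_d' hn hx.1]
  exact zero_mem _

theorem pageCycles_mono {r p n r' p' : ℤ} (hp : p' ≤ p) (hr : p' + r' ≤ p + r) :
    K.pageCycles r p n ≤ K.pageCycles r' p' n := by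
  intro x hx
  rw [mem_pageCycles] at *
  exact ⟨hx.1, K.fil_antitone hp hx.2.1, K.fil_antitone hr hx.2.2⟩

/-- The differential `x ↦ d x` on approximate cycles. -/
def pageCyclesD {r p n p' n' : ℤ} (hp : p' = p + r) (hn : n' = n - 1) :
    K.pageCycles r p n →ₗ[ℚ] K.pageCycles r p' n' :=
  (K.d n ∘ₗ (K.pageCycles r p n).subtype).codRestrict _ fun x => K.d_mem_pageCycles hp hn x.2

/-- The term of filtration `p` and degree `n` of the `r`-th page. -/
abbrev Page (r p n : ℤ) : Type u :=
  K.pageCycles r p n ⧸ (K.pageBoundaries r p n).comap (K.pageCycles r p n).subtype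

/-- The projection of approximate cycles to the `r`-th page. -/
def pageMk (r p n : ℤ) : K.pageCycles r p n →ₗ[ℚ] K.Page r p n := Submodule.mkQ _

theorem pageMk_surjective (r p n : ℤ) : Function.Surjective (K.pageMk r p n) :=
  Submodule.mkQ_surjective _

theorem pageMk_eq_zero {r p n : ℤ} {x : K.pageCycles r p n} :
    K.pageMk r p n x = 0 ↔ (x : K.carrier) ∈ K.pageBoundaries r p n := by
  simp [pageMk]

theorem pageMk_eq {r p n : ℤ} {x y : K.pageCycles r p n} :
    K.pageMk r p n x = K.pageMk r p n y ↔ (x - y : K.carrier) ∈ K.pageBoundaries r p n := by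
  rw [← sub_eq_zero, ← map_sub, pageMk_eq_zero]; rfl

/-- In `a + d b` the differential kills `d b`, while `a` has filtration `p + 1 = p' - r + 1`, which
is the bound imposed on sources of boundaries in filtration `p'`. -/
theorem d_mem_pageBoundaries {r p n p' n' : ℤ} (hp : p' = p + r) (hn : n' = n - 1) {x : K.carrier}
    (hx : x ∈ K.pageBoundaries r p n) : K.d n x ∈ K.pageBoundaries r p' n' := by
  obtain ⟨a, ha, b, hb, rfl⟩ := K.mem_pageBoundaries.1 hx
  refine K.mem_pageBoundaries.2 ⟨0, zero_mem _, a, ?_, ?_⟩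
  · subst hp hn; convert ha using 2 <;> ring
  · rw [map_add, K.d_d' (by ring) (K.mem_pageCycles.1 hb).1, zero_add, add_zero, hn,
      sub_add_cancel]

/-- The differential of the `r`-th page. -/
def pageDiff {r p n p' n' : ℤ} (hp : p' = p + r) (hn : n' = n - 1) :
    K.Page r p n →ₗ[ℚ] K.Page r p' n' :=
  Submodule.mapQ _ _ (K.pageCyclesD hp hn) fun _ hx => K.d_mem_pageBoundaries hp hn hx

theorem pageDiff_pageMk {r p n p' n' : ℤ} (hp : p' = p + r) (hn : n' = n - 1)
    (x : K.pageCycles r p n) :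
    K.pageDiff hp hn (K.pageMk r p n x) = K.pageMk r p' n' (K.pageCyclesD hp hn x) := rfl

theorem pageDiff_pageDiff {r p n p' n' p'' n'' : ℤ} (hp : p' = p + r) (hn : n' = n - 1)
    (hp' : p'' = p' + r) (hn' : n'' = n' - 1) (x : K.Page r p n) :
    K.pageDiff hp' hn' (K.pageDiff hp hn x) = 0 := by
  obtain ⟨x, rfl⟩ := K.pageMk_surjective r p n x
  rw [pageDiff_pageMk, pageDiff_pageMk, pageMk_eq_zero]
  have : K.d n' (K.d n x) = 0 := K.d_d' hn (K.mem_pageCycles.1 x.2).1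
  change K.d n' (K.d n x) ∈ _
  rw [this]; exact zero_mem _

/-- If `d x = a + d b` represents zero in filtration `p + r`, then `b` has filtration `p + 1` and
represents zero in filtration `p`. So `x - b` represents the class of `x`, and its differential `a`
has filtration `p + r + 1`. -/
theorem exists_of_pageDiff_eq_zero {r p n p' n' : ℤ} (hp : p' = p + r) (hn : n' = n - 1)
    (x : K.Page r p n) (hx : K.pageDiff hp hn x = 0) :
    ∃ z : K.pageCycles (r + 1) p n,
      K.pageMk r p n ⟨z, K.pageCycles_mono le_rfl (by lia) z.2⟩ = x := by
  obtain ⟨x, rfl⟩ := K.pageMk_surjective r p n x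
  rw [pageDiff_pageMk, pageMk_eq_zero] at hx
  obtain ⟨a, ha, b, hb, e⟩ := K.mem_pageBoundaries.1 hx
  change _ = K.d n x at e
  subst hp hn
  rw [show p + r - r + 1 = p + 1 by ring, sub_add_cancel] at hb
  rw [sub_add_cancel] at e
  have hb' := K.mem_pageCycles.1 hb
  have hx' := K.mem_pageCycles.1 x.2
  refine ⟨⟨x - b, ?_⟩, ?_⟩
  · rw [mem_pageCycles]
    refine ⟨sub_mem hx'.1 hb'.1, sub_mem hx'.2.1 (K.fil_antitone (by lia) hb'.2.1), ?_⟩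
    rw [map_sub, ← e, add_sub_cancel_right, ← add_assoc]
    exact (K.mem_pageCycles.1 ha).2.1
  · rw [pageMk_eq]
    refine K.mem_pageBoundaries.2 ⟨-b, neg_mem hb, 0, zero_mem _, ?_⟩
    simp

theorem pageDiff_of_mem {r p n p' n' : ℤ} (hp : p' = p + r) (hn : n' = n - 1)
    (x : K.pageCycles r p n) (hx : (x : K.carrier) ∈ K.pageCycles (r + 1) p n) :
    K.pageDiff hp hn (K.pageMk r p n x) = 0 := by
  rw [pageDiff_pageMk, pageMk_eq_zero]
  refine K.mem_pageBoundaries.2 ⟨K.d n x, ?_, 0, zero_mem _, by rw [map_zero, add_zero]; rfl⟩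
  exact K.d_mem_pageCycles (by lia) hn hx

/-- Write `Z_r^p` for `pageCycles r p`. The claim compares `Z_r^{p+1} + d Z_r^{p-r}` with
`Z_{r-1}^{p+1} + d Z_{r-1}^{p-r+1} + d Z_r^{p-r}`. The middle term is contained in the last one. A
summand in `Z_{r-1}^{p+1}` differs from `x` by a boundary, so its differential is `d x`, of
filtration `p + r + 1`, and the summand lies in `Z_r^{p+1}`. -/
theorem mem_pageBoundaries_succ {r p n p' n' : ℤ} (hp : p = p' + r) (hn : n = n' - 1)
    (x : K.pageCycles r p n) (hx : (x : K.carrier) ∈ K.pageCycles (r + 1) p n) :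
    (x : K.carrier) ∈ K.pageBoundaries (r + 1) p n ↔
      ∃ y, K.pageDiff hp hn y = K.pageMk r p n x := by
  obtain rfl : n' = n + 1 := by lia
  obtain rfl : p' = p - r := by lia
  constructor
  · intro h
    obtain ⟨a, ha, b, hb, e⟩ := K.mem_pageBoundaries.1 h
    rw [add_sub_cancel_right] at ha hb
    rw [show p - (r + 1) + 1 = p - r by ring] at hb
    refine ⟨K.pageMk r _ _ ⟨b, hb⟩, ?_⟩
    rw [pageDiff_pageMk, pageMk_eq]
    refine K.mem_pageBoundaries.2 ⟨-a, neg_mem (K.pageCycles_mono le_rfl (by lia) ha), 0,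
      zero_mem _, ?_⟩
    rw [map_zero, add_zero, ← e]
    change -a = K.d (n + 1) b - _
    abel
  · rintro ⟨y, hy⟩
    obtain ⟨y, rfl⟩ := K.pageMk_surjective _ _ _ y
    rw [pageDiff_pageMk, eq_comm, pageMk_eq] at hy
    obtain ⟨a, ha, b, hb, e⟩ := K.mem_pageBoundaries.1 hy
    change _ = _ - K.d (n + 1) y at e
    have ha' := K.mem_pageCycles.1 ha
    have hb' := K.mem_pageCycles.1 hb
    have hy' := K.mem_pageCycles.1 y.2
    have e' : a = x - K.d (n + 1) (y + b) := by
      rw [map_add, ← sub_sub, ← e, add_sub_cancel_right]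
    refine K.mem_pageBoundaries.2 ⟨a, ?_, y + b, ?_, ?_⟩
    · rw [mem_pageCycles]
      refine ⟨ha'.1, ha'.2.1, ?_⟩
      rw [e', map_sub, K.d_d' (by ring) (add_mem hy'.1 hb'.1), sub_zero]
      exact K.fil_antitone (by lia) (K.mem_pageCycles.1 hx).2.2
    · rw [add_sub_cancel_right, show p - (r + 1) + 1 = p - r by ring]
      exact add_mem y.2 (K.pageCycles_mono (by lia) (by lia) hb)
    · rw [e', sub_add_cancel]

open Classical in
/-- The `r`-th page of the spectral sequence. -/
noncomputable def page (r : ℤ) :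
    HomologicalComplex (ModuleCat.{u} ℚ) (ComplexShape.up' ((r, r - 1) : ℤ × ℤ)) where
  X pq := ModuleCat.of ℚ (K.Page r pq.1 (pq.2 - pq.1))
  d pq pq' := if h : pq + (r, r - 1) = pq' then
      ModuleCat.ofHom (K.pageDiff (by rw [← h]; rfl)
        (by rw [← h, Prod.fst_add, Prod.snd_add]; ring))
    else 0
  shape pq pq' h := dif_neg h
  d_comp_d' pq pq' pq'' h h' := by
    rw [dif_pos (show pq + (r, r - 1) = pq' from h), dif_pos (show pq' + (r, r - 1) = pq'' from h')]
    refine ModuleCat.hom_ext (LinearMap.ext fun x => ?_)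
    exact K.pageDiff_pageDiff _ _ _ _ x

theorem page_d {r : ℤ} {pq pq' : ℤ × ℤ} (h : pq + (r, r - 1) = pq') (h1 : pq'.1 = pq.1 + r)
    (h2 : pq'.2 - pq'.1 = pq.2 - pq.1 - 1) :
    (K.page r).d pq pq' = ModuleCat.ofHom (K.pageDiff h1 h2) := dif_pos h

/-- The map from approximate cycles of the next page to cycles of the `r`-th page. -/
noncomputable def toKer (r : ℤ) (pq : ℤ × ℤ) : K.pageCycles (r + 1) pq.1 (pq.2 - pq.1) →ₗ[ℚ]
    LinearMap.ker ((K.page r).sc pq).g.hom :=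
  LinearMap.codRestrict _ (K.pageMk r pq.1 (pq.2 - pq.1) ∘ₗ
    Submodule.inclusion (K.pageCycles_mono le_rfl (by lia))) fun z => by
      have h : pq + (r, r - 1) = (ComplexShape.up' ((r, r - 1) : ℤ × ℤ)).next pq :=
        (ComplexShape.next_eq' _ rfl).symm
      change ((K.page r).d pq _).hom _ = 0
      rw [K.page_d h (by rw [← h]; rfl) (by rw [← h, Prod.fst_add, Prod.snd_add]; ring)]
      exact K.pageDiff_of_mem _ _ _ z.2

theorem toKer_surjective (r : ℤ) (pq : ℤ × ℤ) : Function.Surjective (K.toKer r pq) := by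
  rintro ⟨x, hx⟩
  have h : pq + (r, r - 1) = (ComplexShape.up' ((r, r - 1) : ℤ × ℤ)).next pq :=
    (ComplexShape.next_eq' _ rfl).symm
  change ((K.page r).d pq _).hom _ = 0 at hx
  rw [K.page_d h (by rw [← h]; rfl) (by rw [← h, Prod.fst_add, Prod.snd_add]; ring)] at hx
  obtain ⟨z, hz⟩ := K.exists_of_pageDiff_eq_zero _ _ x hx
  exact ⟨z, Subtype.ext hz⟩

theorem ker_mkQ_toKer (r : ℤ) (pq : ℤ × ℤ) :
    LinearMap.ker ((LinearMap.range ((K.page r).sc pq).moduleCatToCycles).mkQ ∘ₗ K.toKer r pq) =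
      LinearMap.ker (K.pageMk (r + 1) pq.1 (pq.2 - pq.1)) := by
  ext z
  have h : (ComplexShape.up' ((r, r - 1) : ℤ × ℤ)).prev pq + (r, r - 1) = pq := by
    have h0 : (ComplexShape.up' ((r, r - 1) : ℤ × ℤ)).Rel (pq - (r, r - 1)) pq := sub_add_cancel _ _
    rw [ComplexShape.prev_eq' _ h0, sub_add_cancel]
  have h1 : pq.1 = ((ComplexShape.up' ((r, r - 1) : ℤ × ℤ)).prev pq).1 + r :=
    (congrArg Prod.fst h).symm
  have h2 : pq.2 = ((ComplexShape.up' ((r, r - 1) : ℤ × ℤ)).prev pq).2 + (r - 1) :=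
    (congrArg Prod.snd h).symm
  have h3 : pq.2 - pq.1 = ((ComplexShape.up' ((r, r - 1) : ℤ × ℤ)).prev pq).2 -
    ((ComplexShape.up' ((r, r - 1) : ℤ × ℤ)).prev pq).1 - 1 := by lia
  rw [LinearMap.mem_ker, LinearMap.mem_ker, LinearMap.comp_apply, Submodule.mkQ_apply,
    Submodule.Quotient.mk_eq_zero, pageMk_eq_zero, LinearMap.mem_range,
    K.mem_pageBoundaries_succ h1 h3 ⟨z, K.pageCycles_mono le_rfl (by lia) z.2⟩ z.2]
  refine exists_congr fun y => ?_
  rw [Subtype.ext_iff]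
  change ((K.page r).d _ pq).hom y = _ ↔ _
  rw [K.page_d h h1 h3]
  rfl

/-- The homology of the `r`-th page is the next page. -/
noncomputable def homologyEquiv (r : ℤ) (pq : ℤ × ℤ) :
    (LinearMap.ker ((K.page r).sc pq).g.hom ⧸
      LinearMap.range ((K.page r).sc pq).moduleCatToCycles) ≃ₗ[ℚ]
      K.Page (r + 1) pq.1 (pq.2 - pq.1) :=
  equivOfKerEq ((LinearMap.range ((K.page r).sc pq).moduleCatToCycles).mkQ ∘ₗ K.toKer r pq) _
    (by
      rw [LinearMap.coe_comp]
      exact (Submodule.mkQ_surjective _).comp (K.toKer_surjective r pq))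
    (K.pageMk_surjective _ _ _) (K.ker_mkQ_toKer r pq)

/-- The spectral sequence of a filtered complex. -/
noncomputable def specSeq : SpecSeq.{u} where
  page r _ := K.page r
  iso r r' pq h _ := ((K.page r).sc pq).moduleCatHomologyIso ≪≫
    (K.homologyEquiv r pq).toModuleIso ≪≫
    eqToIso (by subst h; rfl)

/-- The spectral sequence of a filtered complex, with its description in terms of approximate
cycles. -/
noncomputable def specSeqIso : K.SpectralSequenceIso K.specSeq where
  π r _ p q := K.pageMk r p (q - p)
  surjective r _ p q := K.pageMk_surjective r p (q - p)
  eq_zero_iff _ _ _ _ _ := K.pageMk_eq_zero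
  d_π r hr p q z z' h := by
    change ((K.page r).d (p, q) (p + r, q + (r - 1))).hom (K.pageMk r p (q - p) z) = _
    have h1 := K.page_d (r := r) (pq := (p, q)) (pq' := (p + r, q + (r - 1))) rfl rfl
      (by simp; ring)
    refine (congrArg (fun f => f.hom (K.pageMk r p (q - p) z)) h1).trans ?_
    exact congrArg (K.pageMk r (p + r) _) (Subtype.ext h)
  iso_π r hr p q z z' h c hc := by
    have h1 : (((K.page r).sc (p, q)).moduleCatCyclesIso.hom.hom c) = K.toKer r (p, q) z' := by
      apply Subtype.ext
      have := congrArg (fun f => f.hom c) ((K.page r).sc (p, q)).moduleCatCyclesIso_hom_i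
      refine Eq.trans this (hc.trans ?_)
      exact congrArg _ (Subtype.ext h)
    have h2 := congrArg (fun f => f.hom c) ((K.page r).sc (p, q)).π_moduleCatCyclesIso_hom
    change (K.homologyEquiv r (p, q)) (((K.page r).sc (p, q)).moduleCatHomologyIso.hom.hom
      ((((K.page r).sc (p, q)).homologyπ).hom c)) = _
    refine (congrArg (K.homologyEquiv r (p, q)) h2).trans ?_
    change (K.homologyEquiv r (p, q)) (Submodule.mkQ _
      ((((K.page r).sc (p, q)).moduleCatCyclesIso.hom.hom c))) = _
    rw [h1]
    exact equivOfKerEq_apply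
      ((LinearMap.range ((K.page r).sc (p, q)).moduleCatToCycles).mkQ ∘ₗ K.toKer r (p, q))
      (K.pageMk (r + 1) p (q - p)) _ _ _ z'

/-! ### Vanishing of terms and strong convergence -/

theorem page_subsingleton_of_neg {r p n : ℤ} (h0 : ∀ p ≤ 0, ∀ x, x ∈ K.fil p) (hp : p < 0) :
    Subsingleton (K.Page r p n) := by
  refine subsingleton_of_forall_eq 0 fun x => ?_
  obtain ⟨x, rfl⟩ := K.pageMk_surjective r p n x
  rw [pageMk_eq_zero, mem_pageBoundaries]
  have hx := K.mem_pageCycles.1 x.2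
  refine ⟨x, K.mem_pageCycles.2 ⟨hx.1, h0 _ (by lia) _, ?_⟩, 0, zero_mem _, by simp⟩
  rw [add_add_sub_cancel]
  exact hx.2.2

/-- Exactness of `F^{p+r}` gives `y` in `F^{p+r}` with `d y = d x`, and exactness of `F^p` makes the
cycle `x - y` equal to some `d u`. In `x = y + d u` both summands are page boundaries because `r ≥
1`. -/
theorem page_subsingleton_of_exact {r p n : ℤ} (hr : 1 ≤ r)
    (hn : ∀ x ∈ K.gr n, x ∈ K.fil p → K.d n x = 0 →
      ∃ y ∈ K.gr (n + 1), y ∈ K.fil p ∧ K.d (n + 1) y = x)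
    (hn' : ∀ x ∈ K.gr (n - 1), x ∈ K.fil (p + r) → K.d (n - 1) x = 0 →
      ∃ y ∈ K.gr n, y ∈ K.fil (p + r) ∧ K.d n y = x) :
    Subsingleton (K.Page r p n) := by
  refine subsingleton_of_forall_eq 0 fun x => ?_
  obtain ⟨x, rfl⟩ := K.pageMk_surjective r p n x
  rw [pageMk_eq_zero, mem_pageBoundaries]
  have hx := K.mem_pageCycles.1 x.2
  obtain ⟨y, hy, hyf, e⟩ := hn' _ (K.d_mem hx.1) hx.2.2 (K.d_d hx.1)
  obtain ⟨u, hu, huf, e'⟩ := hn (x - y) (sub_mem hx.1 hy)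
    (sub_mem hx.2.1 (K.fil_antitone (by lia) hyf)) (by rw [map_sub, e, sub_self])
  refine ⟨y, K.mem_pageCycles.2 ⟨hy, K.fil_antitone (by lia) hyf, ?_⟩, u,
    K.mem_pageCycles.2 ⟨hu, K.fil_antitone (by lia) huf, ?_⟩, by rw [e', add_sub_cancel]⟩
  · rw [e, add_add_sub_cancel]
    exact hx.2.2
  · rw [e']
    exact sub_mem (K.fil_antitone (by lia) hx.2.1) (K.fil_antitone (by lia) hyf)

theorem mem_homologyFil {n p : ℤ} {x : K.cycles n} :
    (Submodule.Quotient.mk x : K.Homology n) ∈ K.homologyFil n p ↔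
      ∃ y ∈ K.gr (n + 1), (x - K.d (n + 1) y : K.carrier) ∈ K.fil p := by
  simp only [homologyFil, Submodule.mem_map, Submodule.mem_comap, Submodule.mkQ_apply]
  constructor
  · rintro ⟨z, hz, e⟩
    rw [Submodule.Quotient.eq] at e
    obtain ⟨y, hy, e⟩ := e
    refine ⟨-y, neg_mem hy, ?_⟩
    have : (x - K.d (n + 1) (-y) : K.carrier) = z := by
      rw [map_neg, e]; change (x : K.carrier) - -(z - x) = z; abel
    rw [this]
    exact hz
  · rintro ⟨y, hy, h⟩
    refine ⟨⟨x - K.d (n + 1) y, sub_mem x.2.1 (K.d_mem' (by ring) hy), ?_⟩, h, ?_⟩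
    · rw [SetLike.mem_coe, LinearMap.mem_ker, map_sub, K.d_d' (by ring) hy, sub_zero]
      exact x.2.2
    · rw [Submodule.Quotient.eq]
      refine ⟨-y, neg_mem hy, ?_⟩
      rw [map_neg]
      change _ = (x - K.d (n + 1) y - x : K.carrier)
      abel

theorem homologyFil_antitone (n : ℤ) : Antitone (K.homologyFil n) := fun _ _ h =>
  Submodule.map_mono (Submodule.comap_mono (K.fil_antitone h))

/-- The stable value of the spectral sequence. -/
theorem nonempty_page_equiv {r p n : ℤ} (h0 : ∀ p ≤ 0, ∀ x, x ∈ K.fil p) (hr : 1 ≤ r) (hp : p < r)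
    (hn : ∀ x ∈ K.gr (n - 1), x ∈ K.fil (p + r) → K.d (n - 1) x = 0 →
      ∃ y ∈ K.gr n, y ∈ K.fil (p + r) ∧ K.d n y = x) :
    Nonempty (K.Page r p n ≃ₗ[ℚ]
      (K.homologyFil n p ⧸ (K.homologyFil n (p + 1)).comap (K.homologyFil n p).subtype)) := by
  -- Both sides are exhibited as quotients of the genuine cycles in `F^p`, by the same subspace.
  let Z : Submodule ℚ K.carrier := K.cycles n ⊓ K.fil p
  have hZ : Z ≤ K.pageCycles r p n := fun x hx => K.mem_pageCycles.2 ⟨hx.1.1, hx.2, by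
    rw [show K.d n x = 0 from hx.1.2]; exact zero_mem _⟩
  let f : Z →ₗ[ℚ] K.Page r p n := K.pageMk r p n ∘ₗ Submodule.inclusion hZ
  let g' : Z →ₗ[ℚ] K.homologyFil n p :=
    (Submodule.mkQ _ ∘ₗ Submodule.inclusion inf_le_left).codRestrict _ fun x =>
      Submodule.mem_map_of_mem x.2.2
  let g := ((K.homologyFil n (p + 1)).comap (K.homologyFil n p).subtype).mkQ ∘ₗ g'
  refine ⟨equivOfKerEq f g ?_ ?_ ?_⟩
  -- An approximate cycle becomes a genuine one after subtracting some `y` in `F^{p+r}` with the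
  -- same differential; such a `y` represents zero since `r ≥ 1`.
  · intro x
    obtain ⟨x, rfl⟩ := K.pageMk_surjective r p n x
    have hx := K.mem_pageCycles.1 x.2
    obtain ⟨y, hy, hyf, e⟩ := hn _ (K.d_mem hx.1) hx.2.2 (K.d_d hx.1)
    refine ⟨⟨x - y, ⟨sub_mem hx.1 hy, ?_⟩, sub_mem hx.2.1 (K.fil_antitone (by lia) hyf)⟩, ?_⟩
    · rw [SetLike.mem_coe, LinearMap.mem_ker, map_sub, e, sub_self]
    · change K.pageMk r p n _ = _
      rw [pageMk_eq]
      change (x : K.carrier) - y - x ∈ _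
      refine K.mem_pageBoundaries.2 ⟨-y, neg_mem (K.mem_pageCycles.2 ⟨hy,
        K.fil_antitone (by lia) hyf, ?_⟩), 0, zero_mem _, by rw [map_zero]; abel⟩
      rw [e, add_add_sub_cancel]
      exact hx.2.2
  · rw [LinearMap.coe_comp]
    refine (Submodule.mkQ_surjective _).comp ?_
    rintro ⟨_, x, hx, rfl⟩
    exact ⟨⟨x, x.2, hx⟩, rfl⟩
  · ext x
    have h1 : f x = 0 ↔ (x : K.carrier) ∈ K.pageBoundaries r p n :=
      K.pageMk_eq_zero (x := Submodule.inclusion hZ x)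
    have h2 : g x = 0 ↔ (Submodule.Quotient.mk ⟨x, x.2.1⟩ : K.Homology n) ∈
        K.homologyFil n (p + 1) :=
      Submodule.Quotient.mk_eq_zero _ (x := g' x)
    -- Since `p < r`, the filtration `p - r + 1` required of the source of a boundary is
    -- nonpositive, so this condition is void by `h0`.
    rw [LinearMap.mem_ker, LinearMap.mem_ker, h1, h2, mem_homologyFil, mem_pageBoundaries]
    constructor
    · rintro ⟨a, ha, b, hb, e⟩
      refine ⟨b, (K.mem_pageCycles.1 hb).1, ?_⟩
      rw [← e, add_sub_cancel_right]
      exact (K.mem_pageCycles.1 ha).2.1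
    · rintro ⟨y, hy, h⟩
      refine ⟨x - K.d (n + 1) y, K.mem_pageCycles.2 ⟨sub_mem x.2.1.1
        (K.d_mem' (by ring) hy), h, ?_⟩,
        y, K.mem_pageCycles.2 ⟨hy, h0 _ (by lia) _, ?_⟩, by rw [sub_add_cancel]⟩
      · rw [map_sub, K.d_d' (by ring) hy, show K.d n x = 0 from x.2.1.2, sub_zero]
        exact zero_mem _
      · have h3 := sub_mem x.2.2 (K.fil_antitone (by lia : p ≤ p + 1) h)
        rw [sub_sub_cancel] at h3
        exact K.fil_antitone (by lia) h3

/-- Strong convergence for filtrations that are exhausted by `fil 0` and whose terms of high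
filtration are exact, in each degree. -/
theorem stronglyConverges (h0 : ∀ p ≤ 0, ∀ x, x ∈ K.fil p)
    (h : ∀ n, ∃ m, ∀ p ≥ m, ∀ x ∈ K.gr n, x ∈ K.fil p → K.d n x = 0 →
      ∃ y ∈ K.gr (n + 1), y ∈ K.fil p ∧ K.d (n + 1) y = x) :
    K.specSeq.StronglyConverges K.Homology K.homologyFil where
  antitone := K.homologyFil_antitone
  exhaustive n := ⟨0, eq_top_iff.2 fun x _ => by
    obtain ⟨x, rfl⟩ := Submodule.Quotient.mk_surjective _ x
    exact Submodule.mem_map_of_mem (h0 0 le_rfl x)⟩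
  separated n := by
    obtain ⟨m, hm⟩ := h n
    refine ⟨m, eq_bot_iff.2 ?_⟩
    rintro _ ⟨x, hx, rfl⟩
    obtain ⟨y, hy, -, e⟩ := hm m le_rfl x x.2.1 hx x.2.2
    exact (Submodule.Quotient.mk_eq_zero _).2 ⟨y, hy, e⟩
  stable p q := by
    obtain ⟨m₁, h₁⟩ := h (q - p - 1)
    obtain ⟨m₂, h₂⟩ := h (q - p - 1 - 1)
    rw [sub_add_cancel] at h₁ h₂
    -- For `r > p` the incoming differential starts in negative filtration `p - r`, where the page
    -- is zero. For `r ≥ m₁ - p` and `r ≥ m₂ - p` the subcomplexes `F^{p+r}` and `F^{p+2r}` are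
    -- exact in degrees `q - p - 1` and `q - p - 2`, which makes the target of the outgoing
    -- differential zero.
    refine ⟨max (p + 1) (max (m₁ - p) (m₂ - p)), fun r hr hr' => ⟨fun x => ?_, fun x => ?_, ?_⟩⟩
    · by_cases hx : (p, q) + (r, r - 1) = x
      · subst hx
        have : Subsingleton (K.Page r (p + r) (q + (r - 1) - (p + r))) := by
          rw [show q + (r - 1) - (p + r) = q - p - 1 by ring]
          refine K.page_subsingleton_of_exact hr ?_ ?_
          · rw [sub_add_cancel]; exact h₁ _ (by lia)
          · exact h₂ _ (by lia)
        exact ModuleCat.hom_ext (LinearMap.ext fun y => this.elim _ _)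
      · exact (K.page r).shape _ _ hx
    · by_cases hx : x + (r, r - 1) = (p, q)
      · have : Subsingleton (K.Page r x.1 (x.2 - x.1)) :=
          K.page_subsingleton_of_neg h0 (by have := congrArg Prod.fst hx; simp at this; lia)
        exact ModuleCat.hom_ext (LinearMap.ext fun y => by
          rw [show y = 0 from this.elim _ _, map_zero, map_zero])
      · exact (K.page r).shape _ _ hx
    · exact K.nonempty_page_equiv h0 hr (by lia) (h₁ _ (by lia))

end FilteredComplex

/-- Dependent choice along the natural numbers. -/
theorem exists_seq {X : ℕ → Type*} (P : ∀ p, X p → Prop) (r : ∀ p, X p → X (p + 1) → Prop)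
    (x₀ : X 0) (hx₀ : P 0 x₀) (hs : ∀ p x, P p x → ∃ y, P (p + 1) y ∧ r p x y) :
    ∃ s : ∀ p, X p, s 0 = x₀ ∧ (∀ p, P p (s p)) ∧ ∀ p, r p (s p) (s (p + 1)) := by
  choose next hnext hr using hs
  let s : ∀ p, {x : X p // P p x} := fun p =>
    Nat.rec (motive := fun p => {x : X p // P p x}) ⟨x₀, hx₀⟩
      (fun p x => ⟨next p x.1 x.2, hnext p x.1 x.2⟩) p
  exact ⟨fun p => (s p).1, rfl, fun p => (s p).2, fun p => hr p _ _⟩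

/-! ### Projective resolutions of graded modules and their comparison -/

namespace GrMod

variable {R : GrAlg.{u}}

/-- A graded submodule of a graded module. -/
def sub (M : GrMod R) (S : Submodule R.carrier M.carrier)
    (hS : ∀ n, ∀ x ∈ S, component M.internal n x ∈ S) : GrMod R where
  carrier := S.restrictScalars ℚ
  gr n := (M.gr n).comap (S.restrictScalars ℚ).subtype
  internal := isInternal_comap M.internal (S.restrictScalars ℚ) hS
  smul_mem := by
    intro i j a x ha hx
    exact M.smul_mem (x := (x : M.carrier)) ha hx

theorem IsGraded.map_component {M N : GrMod R} {f : M.carrier →ₗ[R.carrier] N.carrier}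
    (hf : IsGraded f) (n : ℤ) (x : M.carrier) :
    f (component M.internal n x) = component N.internal n (f x) := by
  have := HyperExt.map_component M.internal N.internal (f.restrictScalars ℚ) 0
    (fun n x hx => by rw [add_zero]; exact hf n x hx) n x
  rwa [add_zero] at this

/-- A graded map from a projective module lifts along a graded map whose range contains its
range. -/
theorem IsProjective.exists_lift {P M N : GrMod.{u} R} (hP : P.IsProjective)
    {g : M.carrier →ₗ[R.carrier] N.carrier} {f : P.carrier →ₗ[R.carrier] N.carrier}
    (hg : IsGraded g) (hf : IsGraded f) (h : ∀ x, ∃ y, g y = f x) :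
    ∃ k : P.carrier →ₗ[R.carrier] M.carrier, IsGraded k ∧ g ∘ₗ k = f := by
  have hS : ∀ n, ∀ x ∈ LinearMap.range g, component N.internal n x ∈ LinearMap.range g := by
    rintro n _ ⟨x, rfl⟩
    exact ⟨component M.internal n x, hg.map_component n x⟩
  -- Projectivity speaks of surjections, so the target is cut down to the range of `g`, which is a
  -- graded submodule.
  obtain ⟨k, hk, e⟩ := hP M (N.sub (LinearMap.range g) hS) (LinearMap.rangeRestrict g)
    (LinearMap.codRestrict (LinearMap.range g) f h)
    (fun n x hx => hg n x hx) g.surjective_rangeRestrict (fun n x hx => hf n x hx)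
  refine ⟨k, hk, LinearMap.ext fun x => ?_⟩
  exact congrArg Subtype.val (LinearMap.congr_fun e x)

theorem IsGraded.comp {M N L : GrMod R} {f : N.carrier →ₗ[R.carrier] L.carrier}
    {g : M.carrier →ₗ[R.carrier] N.carrier} (hf : IsGraded f) (hg : IsGraded g) :
    IsGraded (f ∘ₗ g : M.carrier →ₗ[R.carrier] L.carrier) :=
  fun n x hx => hf n _ (hg n x hx)

theorem IsGraded.sub {M N : GrMod R} {f g : M.carrier →ₗ[R.carrier] N.carrier} (hf : IsGraded f)
    (hg : IsGraded g) : IsGraded (f - g) :=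
  fun n x hx => sub_mem (hf n x hx) (hg n x hx)

theorem isGraded_id (M : GrMod R) : IsGraded (LinearMap.id : M.carrier →ₗ[R.carrier] M.carrier) :=
  fun _ _ hx => hx

theorem homGr_comp {M M' N : GrMod R} {g : M'.carrier →ₗ[ℚ] N.carrier} {q : ℤ}
    (hg : g ∈ M'.homGr N q) {f : M.carrier →ₗ[R.carrier] M'.carrier} (hf : IsGraded f) :
    g ∘ₗ f.restrictScalars ℚ ∈ M.homGr N q :=
  ⟨fun i x hx => hg.1 i _ (hf i x hx), fun i a ha x => by
    change g (f (a • x)) = _ • a • g (f x)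
    rw [map_smul, hg.2 i a ha]⟩

namespace ProjRes

variable {M : GrMod.{u} R}

theorem δ_δ (P : ProjRes M) (p : ℕ) (x : (P.X (p + 2)).carrier) : P.δ p (P.δ (p + 1) x) = 0 :=
  (P.exact_succ p _).2 ⟨x, rfl⟩

/-- The comparison theorem: projective resolutions map to each other. -/
theorem exists_chainMap (P Q : ProjRes M) :
    ∃ F : ∀ p, (P.X p).carrier →ₗ[R.carrier] (Q.X p).carrier, (∀ p, IsGraded (F p)) ∧
      (∀ x, Q.ε (F 0 x) = P.ε x) ∧ ∀ p x, Q.δ p (F (p + 1) x) = F p (P.δ p x) := by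
  obtain ⟨f, hf, e⟩ := (P.projective 0).exists_lift Q.ε_graded P.ε_graded
    (fun x => Q.ε_surjective _)
  have e' : ∀ x, Q.ε (f x) = P.ε x := LinearMap.congr_fun e
  have h0 : ∀ x, ∃ y, Q.δ 0 y = f (P.δ 0 x) := fun x => (Q.exact_zero _).1 (by
    rw [e']; exact (P.exact_zero _).2 ⟨x, rfl⟩)
  -- The invariant carried through the recursion says that `F ∘ δ` lands in the range of `Q.δ p`,
  -- which is what the next lift requires.
  have key := exists_seq
    (X := fun p => (P.X p).carrier →ₗ[R.carrier] (Q.X p).carrier)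
    (fun p F => IsGraded F ∧ ∀ x, ∃ y, Q.δ p y = F (P.δ p x))
    (fun p F G => ∀ x, Q.δ p (G x) = F (P.δ p x)) f ⟨hf, h0⟩ ?_
  · obtain ⟨F, rfl, hF, hr⟩ := key
    exact ⟨F, fun p => (hF p).1, e', hr⟩
  · rintro p F ⟨hF, h⟩
    obtain ⟨G, hG, e⟩ := (P.projective (p + 1)).exists_lift (Q.δ_graded p)
      (hF.comp (P.δ_graded p)) h
    have e : ∀ x, Q.δ p (G x) = F (P.δ p x) := LinearMap.congr_fun e
    refine ⟨G, ⟨hG, fun x => (Q.exact_succ p _).1 ?_⟩, e⟩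
    rw [e, P.δ_δ, map_zero]

/-- A chain map between projective resolutions that lifts zero is null-homotopic. -/
theorem exists_homotopy (P Q : ProjRes M)
    (D : ∀ p, (P.X p).carrier →ₗ[R.carrier] (Q.X p).carrier) (hD : ∀ p, IsGraded (D p))
    (h0 : ∀ x, Q.ε (D 0 x) = 0) (h : ∀ p x, Q.δ p (D (p + 1) x) = D p (P.δ p x)) :
    ∃ s : ∀ p, (P.X p).carrier →ₗ[R.carrier] (Q.X (p + 1)).carrier, (∀ p, IsGraded (s p)) ∧
      (∀ x, Q.δ 0 (s 0 x) = D 0 x) ∧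
      ∀ p x, Q.δ (p + 1) (s (p + 1) x) + s p (P.δ p x) = D (p + 1) x := by
  obtain ⟨f, hf, e⟩ := (P.projective 0).exists_lift (Q.δ_graded 0) (hD 0)
    (fun x => (Q.exact_zero _).1 (h0 x))
  have e' : ∀ x, Q.δ 0 (f x) = D 0 x := LinearMap.congr_fun e
  -- Here the invariant is that `D (p + 1) - F ∘ δ` lands in the range of `Q.δ (p + 1)`.
  have key := exists_seq
    (X := fun p => (P.X p).carrier →ₗ[R.carrier] (Q.X (p + 1)).carrier)
    (fun p F => IsGraded F ∧ ∀ x, ∃ y, Q.δ (p + 1) y = (D (p + 1) - F ∘ₗ P.δ p) x)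
    (fun p F G => ∀ x, Q.δ (p + 1) (G x) = (D (p + 1) - F ∘ₗ P.δ p) x)
    f ⟨hf, fun x => (Q.exact_succ 0 _).1 ?_⟩ ?_
  · obtain ⟨F, rfl, hF, hr⟩ := key
    refine ⟨F, fun p => (hF p).1, e', fun p x => ?_⟩
    rw [hr]; exact sub_add_cancel _ _
  · rw [LinearMap.sub_apply, map_sub, h, LinearMap.comp_apply, e', sub_self]
  · rintro p F ⟨hF, h'⟩
    obtain ⟨G, hG, e⟩ := (P.projective (p + 1)).exists_lift (Q.δ_graded (p + 1))
      ((hD (p + 1)).sub (hF.comp (P.δ_graded p))) h'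
    have e : ∀ x, Q.δ (p + 1) (G x) = (D (p + 1) - F ∘ₗ P.δ p) x := LinearMap.congr_fun e
    refine ⟨G, ⟨hG, fun x => (Q.exact_succ (p + 1) _).1 ?_⟩, e⟩
    rw [LinearMap.sub_apply, map_sub, h, LinearMap.comp_apply, e, LinearMap.sub_apply,
      LinearMap.comp_apply, P.δ_δ, map_zero, sub_zero, sub_self]

variable (N : GrMod.{u} R)

theorem mem_cocycles {P : ProjRes M} {p : ℕ} {q : ℤ} {g : (P.X p).carrier →ₗ[ℚ] N.carrier} :
    g ∈ P.cocycles N p q ↔ g ∈ (P.X p).homGr N q ∧ ∀ x, g (P.δ p x) = 0 :=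
  and_congr Iff.rfl LinearMap.ext_iff

section map

variable {P Q : ProjRes M} (F : ∀ p, (P.X p).carrier →ₗ[R.carrier] (Q.X p).carrier)
  (hF : ∀ p, IsGraded (F p)) (h : ∀ p x, Q.δ p (F (p + 1) x) = F p (P.δ p x))
include hF h

theorem comp_mem_cocycles {p : ℕ} {q : ℤ} {g : (Q.X p).carrier →ₗ[ℚ] N.carrier}
    (hg : g ∈ Q.cocycles N p q) : g ∘ₗ (F p).restrictScalars ℚ ∈ P.cocycles N p q := by
  rw [mem_cocycles] at *
  refine ⟨homGr_comp hg.1 (hF p), fun x => ?_⟩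
  change g (F p (P.δ p x)) = 0
  rw [← h, hg.2]

theorem comp_mem_coboundaries' {p : ℕ} {q : ℤ} {g : (Q.X p).carrier →ₗ[ℚ] N.carrier}
    (hg : g ∈ Q.coboundaries N p q) : g ∘ₗ (F p).restrictScalars ℚ ∈ P.coboundaries N p q := by
  cases p with
  | zero =>
    obtain rfl : g = 0 := hg
    rw [LinearMap.zero_comp]; exact zero_mem _
  | succ p =>
    obtain ⟨g, hg, rfl⟩ := hg
    refine ⟨g ∘ₗ (F p).restrictScalars ℚ, homGr_comp hg (hF p), LinearMap.ext fun x => ?_⟩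
    exact congrArg g (h p x).symm

end map

/-- The map of Ext groups induced by a chain map. -/
def extMap {P Q : ProjRes M} (F : ∀ p, (P.X p).carrier →ₗ[R.carrier] (Q.X p).carrier)
    (hF : ∀ p, IsGraded (F p)) (h : ∀ p x, Q.δ p (F (p + 1) x) = F p (P.δ p x)) (p : ℕ) (q : ℤ) :
    Q.Ext N p q →ₗ[ℚ] P.Ext N p q :=
  Submodule.mapQ _ _
    ((LinearMap.lcomp ℚ N.carrier ((F p).restrictScalars ℚ)).restrict
      fun _ hg => comp_mem_cocycles N F hF h hg)
    fun _ hg => comp_mem_coboundaries' N F hF h hg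

/-- The chain map `G ∘ F` lifts the identity of `M`, so `G ∘ F - id` is null-homotopic. Composing a
cocycle `g` with it leaves only `g ∘ s ∘ δ`, a coboundary, because `g` vanishes on the range of `δ`.
-/
theorem extMap_extMap {P Q : ProjRes M} (F : ∀ p, (P.X p).carrier →ₗ[R.carrier] (Q.X p).carrier)
    (hF : ∀ p, IsGraded (F p)) (h : ∀ p x, Q.δ p (F (p + 1) x) = F p (P.δ p x))
    (hε : ∀ x, Q.ε (F 0 x) = P.ε x)
    (G : ∀ p, (Q.X p).carrier →ₗ[R.carrier] (P.X p).carrier)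
    (hG : ∀ p, IsGraded (G p)) (h' : ∀ p x, P.δ p (G (p + 1) x) = G p (Q.δ p x))
    (hε' : ∀ x, P.ε (G 0 x) = Q.ε x) (p : ℕ) (q : ℤ) (x : P.Ext N p q) :
    extMap N F hF h p q (extMap N G hG h' p q x) = x := by
  obtain ⟨⟨g, hg⟩, rfl⟩ := Submodule.Quotient.mk_surjective _ x
  refine (Submodule.Quotient.eq _).2 ?_
  obtain ⟨s, hs, h0, h1⟩ := exists_homotopy P P (fun p => G p ∘ₗ F p - LinearMap.id)
    (fun p => ((hG p).comp (hF p)).sub (isGraded_id _))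
    (fun x => by
      rw [LinearMap.sub_apply, map_sub, LinearMap.comp_apply, hε', hε, LinearMap.id_apply,
          sub_self])
    (fun p x => by
      rw [LinearMap.sub_apply, map_sub, LinearMap.comp_apply, h', h]; rfl)
  rw [mem_cocycles] at hg
  rw [Submodule.mem_comap]
  have key : ∀ x, g ((G p ∘ₗ F p - LinearMap.id : _ →ₗ[R.carrier] _) x) =
      g (G p (F p x)) - g x := fun x => map_sub g _ _
  cases p with
  | zero =>
    refine LinearMap.ext fun x => ?_
    exact (key x).symm.trans ((congrArg g (h0 x)).symm.trans (hg.2 _))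
  | succ p =>
    refine ⟨g ∘ₗ (s p).restrictScalars ℚ, homGr_comp hg.1 (hs p), LinearMap.ext fun x => ?_⟩
    refine Eq.trans ?_ (key x)
    rw [← h1, map_add, hg.2, zero_add]
    rfl

/-- Ext groups do not depend on the projective resolution. -/
theorem nonempty_ext_equiv (P Q : ProjRes M) (p : ℕ) (q : ℤ) :
    Nonempty (P.Ext N p q ≃ₗ[ℚ] Q.Ext N p q) := by
  obtain ⟨F, hF, hε, h⟩ := exists_chainMap P Q
  obtain ⟨G, hG, hε', h'⟩ := exists_chainMap Q P
  exact ⟨LinearEquiv.ofLinearMap (extMap N G hG h' p q) (extMap N F hF h p q)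
    (LinearMap.ext fun x => extMap_extMap N G hG h' hε' F hF h hε p q x)
    (LinearMap.ext fun x => extMap_extMap N F hF h hε G hG h' hε' p q x)⟩

end ProjRes

end GrMod

/-- The map induced on the target of a surjection. -/
noncomputable def liftOfSurjective {R N P Q : Type*} [Ring R] [AddCommGroup N] [Module R N]
    [AddCommGroup P] [Module R P] [AddCommGroup Q] [Module R Q] (f : N →ₗ[R] P) (g : N →ₗ[R] Q)
    (hf : Function.Surjective f) (h : ∀ x, f x = 0 → g x = 0) : P →ₗ[R] Q :=
  (LinearMap.ker f).liftQ g h ∘ₗ (f.quotKerEquivOfSurjective hf).symm.toLinearMap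

theorem liftOfSurjective_apply {R N P Q : Type*} [Ring R] [AddCommGroup N] [Module R N]
    [AddCommGroup P] [Module R P] [AddCommGroup Q] [Module R Q] (f : N →ₗ[R] P) (g : N →ₗ[R] Q)
    (hf : Function.Surjective f) (h : ∀ x, f x = 0 → g x = 0) (x : N) :
    liftOfSurjective f g hf h (f x) = g x := by
  have h1 : (f.quotKerEquivOfSurjective hf).symm (f x) = Submodule.Quotient.mk x := by
    rw [LinearEquiv.symm_apply_eq]; rfl
  rw [liftOfSurjective, LinearMap.comp_apply, LinearEquiv.coe_coe, h1]
  rfl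

/-! ### Split bases of complexes of vector spaces -/

section Split

variable {M : Type u} [AddCommGroup M] [Module ℚ M] {𝓜 : ℤ → Submodule ℚ M}

theorem span_homogeneous (h : DirectSum.IsInternal 𝓜) (d : M →ₗ[ℚ] M)
    (hd : ∀ n, ∀ x ∈ 𝓜 n, d x ∈ 𝓜 (n - 1)) (z : M) (hz : d z = 0) :
    z ∈ Submodule.span ℚ {z | d z = 0 ∧ ∃ n, z ∈ 𝓜 n} := by
  have h1 := isInternal_comap h (LinearMap.ker d) fun n x hx => by
    have := map_component h h d (-1) hd n x
    rw [LinearMap.mem_ker] at *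
    rw [this, hx, map_zero]
  have h2 : (⟨z, hz⟩ : LinearMap.ker d) ∈ ⨆ n, (𝓜 n).comap (LinearMap.ker d).subtype := by
    rw [h1.submodule_iSup_eq_top]; trivial
  have h3 := Submodule.mem_map_of_mem (f := (LinearMap.ker d).subtype) h2
  rw [Submodule.map_iSup] at h3
  refine (iSup_le fun n => ?_ : (⨆ n, Submodule.map (LinearMap.ker d).subtype
    ((𝓜 n).comap (LinearMap.ker d).subtype)) ≤ _) h3
  rintro _ ⟨y, hy, rfl⟩
  exact Submodule.subset_span ⟨y.2, n, hy⟩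

/-- A complex of vector spaces has a homogeneous basis of the form `h ⊔ c ⊔ d c`, where the `h` are
cycles which are not boundaries. -/
theorem exists_split_basis (h : DirectSum.IsInternal 𝓜) (d : M →ₗ[ℚ] M)
    (hd : ∀ n, ∀ x ∈ 𝓜 n, d x ∈ 𝓜 (n - 1)) (hdd : ∀ x, d (d x) = 0) :
    ∃ (I J : Type u) (b : Module.Basis (I ⊕ J ⊕ J) ℚ M) (eI : I → ℤ) (eJ : J → ℤ),
      (∀ i, b (.inl i) ∈ 𝓜 (eI i)) ∧ (∀ j, b (.inr (.inl j)) ∈ 𝓜 (eJ j)) ∧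
      (∀ i, d (b (.inl i)) = 0) ∧ (∀ j, d (b (.inr (.inl j))) = b (.inr (.inr j))) ∧
      ∀ i x, d x ≠ b (.inl i) := by
  -- `b₁` is a basis of the boundaries consisting of differentials of homogeneous elements, and `b₂`
  -- extends it by homogeneous cycles to a basis of all cycles. The `h` are the elements of `b₂ \
  -- b₁`, and the `c` are chosen preimages of the elements of `b₁`.
  obtain ⟨b₁, hb₁, -, hs₁, hi₁⟩ := exists_linearIndepOn_id_extension
    (linearIndepOn_empty ℚ (id : M → M)) (Set.empty_subset {y | ∃ n, ∃ c ∈ 𝓜 n, d c = y})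
  have hsub : b₁ ⊆ {z | d z = 0 ∧ ∃ n, z ∈ 𝓜 n} := by
    intro y hy
    obtain ⟨n, c, hc, rfl⟩ := hb₁ hy
    exact ⟨hdd c, _, hd n c hc⟩
  obtain ⟨b₂, hb₂, h12, hs₂, hi₂⟩ := exists_linearIndepOn_id_extension hi₁ hsub
  choose e c hc hdc using fun y : b₁ => hb₁ y.2
  choose hz eI heI using fun i : ↥(b₂ \ b₁) => hb₂ i.2.1
  have hrange : LinearMap.range d ≤ Submodule.span ℚ b₁ := by
    rintro _ ⟨x, rfl⟩
    induction x using graded_induction h with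
    | mem n y hy => exact hs₁ ⟨n, y, hy, rfl⟩
    | zero => rw [map_zero]; exact zero_mem _
    | add y z hy hz => rw [map_add]; exact add_mem hy hz
  have hdc' : d ∘ c = ((↑) : b₁ → M) := funext hdc
  have hindc : LinearIndependent ℚ c := LinearIndependent.of_comp d (by rw [hdc']; exact hi₁)
  let v : (↥(b₂ \ b₁) ⊕ b₁) → M := Sum.elim (↑) (↑)
  have hindv : LinearIndependent ℚ v := by
    have : v = (fun y : b₂ => (y : M)) ∘
        (Sum.elim (fun i : ↥(b₂ \ b₁) => ⟨i, i.2.1⟩) (fun j : b₁ => ⟨j, h12 j.2⟩)) := by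
      ext (i | j) <;> rfl
    rw [this]
    refine LinearIndependent.comp hi₂ _ ?_
    rintro (i | i) (j | j) hij
    · simpa [Subtype.ext_iff] using hij
    · simp only [Sum.elim_inl, Sum.elim_inr, Subtype.mk.injEq] at hij
      exact (i.2.2 (hij ▸ j.2)).elim
    · simp only [Sum.elim_inl, Sum.elim_inr, Subtype.mk.injEq] at hij
      exact (j.2.2 (hij ▸ i.2)).elim
    · simpa [Subtype.ext_iff] using hij
  -- A combination of the `c` that is a cycle is trivial, because `d` maps the `c` to the
  -- independent family `b₁`.
  have hdisj : Disjoint (Submodule.span ℚ (Set.range v)) (Submodule.span ℚ (Set.range c)) := by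
    rw [Submodule.disjoint_def]
    intro x hx hx'
    have h0 : d x = 0 := by
      refine (Submodule.span_le.2 ?_ : _ ≤ LinearMap.ker d) hx
      rintro _ ⟨i | j, rfl⟩
      · exact hz i
      · exact (hsub j.2).1
    obtain ⟨l, rfl⟩ := (Finsupp.mem_span_range_iff_exists_finsupp).1 hx'
    have hl : Finsupp.linearCombination ℚ ((↑) : b₁ → M) l = 0 := by
      rw [← hdc', ← Finsupp.apply_linearCombination, Finsupp.linearCombination_apply]
      exact h0
    rw [(linearIndependent_iff.1 hi₁) l hl]
    simp
  have hind := (hindv.sum_type hindc hdisj).comp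
    (Sum.elim (fun i => .inl (.inl i)) (Sum.elim .inr (fun j => .inl (.inr j))) :
      ↥(b₂ \ b₁) ⊕ b₁ ⊕ b₁ → (↥(b₂ \ b₁) ⊕ b₁) ⊕ b₁)
    (by rintro (i | i | i) (j | j | j) hij <;> simp_all)
  have hspan : ⊤ ≤ Submodule.span ℚ (Set.range (Sum.elim v c ∘
      (Sum.elim (fun i => .inl (.inl i)) (Sum.elim .inr (fun j => .inl (.inr j))) :
      ↥(b₂ \ b₁) ⊕ b₁ ⊕ b₁ → (↥(b₂ \ b₁) ⊕ b₁) ⊕ b₁))) := by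
    set S := Submodule.span ℚ (Set.range (Sum.elim v c ∘
      (Sum.elim (fun i => .inl (.inl i)) (Sum.elim .inr (fun j => .inl (.inr j))) :
      ↥(b₂ \ b₁) ⊕ b₁ ⊕ b₁ → (↥(b₂ \ b₁) ⊕ b₁) ⊕ b₁)))
    have h2 : ∀ z, d z = 0 → z ∈ S := by
      intro z hz
      have h3 := Submodule.span_le.2 hs₂ (span_homogeneous h d hd z hz)
      refine Submodule.span_le.2 ?_ h3
      intro y hy
      by_cases hy' : y ∈ b₁
      · exact Submodule.subset_span ⟨.inr (.inr ⟨y, hy'⟩), rfl⟩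
      · exact Submodule.subset_span ⟨.inl ⟨y, hy, hy'⟩, rfl⟩
    rintro x -
    -- A combination of the `c` has the same differential as `x`, so it differs from `x` by a cycle,
    -- and cycles are already covered by `h2`.
    have h4 := hrange ⟨x, rfl⟩
    rw [← Subtype.range_coe (s := b₁), ← hdc'] at h4
    obtain ⟨l, hl⟩ := (Finsupp.mem_span_range_iff_exists_finsupp).1 h4
    have h5 : d (Finsupp.linearCombination ℚ c l) = d x := by
      rw [← hl]
      exact Finsupp.apply_linearCombination ℚ d c l
    have h6 : Finsupp.linearCombination ℚ c l ∈ S := by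
      refine Submodule.span_mono ?_ (Finsupp.mem_span_range_iff_exists_finsupp.2 ⟨l, rfl⟩)
      rintro _ ⟨j, rfl⟩
      exact ⟨.inr (.inl j), rfl⟩
    have h7 := add_mem (h2 (x - Finsupp.linearCombination ℚ c l) (by rw [map_sub, h5, sub_self])) h6
    rwa [sub_add_cancel] at h7
  refine ⟨↥(b₂ \ b₁), b₁, Module.Basis.mk hind hspan, eI, e, ?_, ?_, ?_, ?_, ?_⟩
  · intro i; rw [Module.Basis.mk_apply]; exact heI i
  · intro j; rw [Module.Basis.mk_apply]; exact hc j
  · intro i; rw [Module.Basis.mk_apply]; exact hz i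
  · intro j; rw [Module.Basis.mk_apply, Module.Basis.mk_apply]; exact hdc j
  · intro i x hx
    rw [Module.Basis.mk_apply] at hx
    have h1 : d x = (i : M) := hx
    have h2 : (i : M) ∈ Submodule.span ℚ b₁ := h1 ▸ hrange ⟨x, rfl⟩
    exact i.2.2 (hi₁.mem_span_iff_id.1 h2 (hi₂.mono (Set.insert_subset i.2.1 h12)))

end Split

/-! ### Koszul signs -/

section Twist

variable {M : Type*} [AddCommGroup M] [Module ℚ M] {𝓜 : ℤ → Submodule ℚ M}

/-- Multiplication by `(-1) ^ (q n)` in degree `n`. -/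
noncomputable def twist (h : DirectSum.IsInternal 𝓜) (q : ℤ) : M →ₗ[ℚ] M :=
  DirectSum.toModule ℚ ℤ M (fun n => (-1 : ℚ) ^ (q * n) • (𝓜 n).subtype) ∘ₗ
    (LinearEquiv.ofBijective (DirectSum.coeLinearMap 𝓜) h).symm.toLinearMap

theorem twist_of_mem (h : DirectSum.IsInternal 𝓜) (q : ℤ) {n : ℤ} {x : M} (hx : x ∈ 𝓜 n) :
    twist h q x = (-1 : ℚ) ^ (q * n) • x := by
  simp [twist, ofBijective_symm_of_mem h hx]

theorem neg_one_zpow_mul_self (n : ℤ) : (-1 : ℚ) ^ n * (-1) ^ n = 1 := by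
  rw [← mul_zpow]; norm_num

theorem twist_zero (h : DirectSum.IsInternal 𝓜) (x : M) : twist h 0 x = x := by
  induction x using graded_induction h with
  | mem n y hy => rw [twist_of_mem h 0 hy, zero_mul, zpow_zero, one_smul]
  | zero => rw [map_zero]
  | add y z hy hz => rw [map_add, hy, hz]

theorem eq_of_forall_mem (h : DirectSum.IsInternal 𝓜) {N : Type*} [AddCommGroup N] [Module ℚ N]
    {f g : M →ₗ[ℚ] N} (hfg : ∀ n, ∀ x ∈ 𝓜 n, f x = g x) : f = g := by
  ext x
  induction x using graded_induction h with
  | mem n y hy => exact hfg n y hy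
  | zero => rw [map_zero, map_zero]
  | add y z hy hz => rw [map_add, map_add, hy, hz]

end Twist

/-! ### Graded modules with a homogeneous basis -/

namespace GrMod

variable {R : GrAlg.{u}}

theorem component_smul (M : GrMod R) {e : ℤ} {x : M.carrier} (hx : x ∈ M.gr e) (n : ℤ)
    (a : R.carrier) :
    component M.internal n (a • x) = component R.internal (n - e) a • x := by
  induction a using graded_induction R.internal with
  | mem i a ha =>
    have hax := M.smul_mem ha hx
    by_cases hi : i + e = n
    · rw [component_of_mem R.internal (by rwa [show n - e = i by lia]),
        component_of_mem M.internal (by rwa [← hi])]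
    · rw [component_of_mem_ne R.internal (by lia) ha, component_of_mem_ne M.internal hi hax,
        zero_smul]
  | zero => rw [zero_smul, map_zero, map_zero, zero_smul]
  | add y z hy hz => rw [add_smul, map_add, map_add, hy, hz, add_smul]

theorem twist_smul (M : GrMod R) (q : ℤ) (a : R.carrier) (x : M.carrier) :
    twist M.internal q (a • x) = twist R.internal q a • twist M.internal q x := by
  induction a using graded_induction R.internal with
  | mem i a ha =>
    induction x using graded_induction M.internal with
    | mem j x hx =>
      rw [twist_of_mem _ _ ha, twist_of_mem _ _ hx, twist_of_mem _ _ (M.smul_mem ha hx), mul_add,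
        zpow_add₀ (by norm_num), smul_comm _ ((-1 : ℚ) ^ (q * j)), smul_assoc, smul_smul, mul_comm]
    | zero => simp only [smul_zero, map_zero]
    | add y z hy hz => rw [smul_add, map_add, map_add, hy, hz, smul_add]
  | zero => rw [zero_smul, map_zero, map_zero, zero_smul]
  | add y z hy hz => rw [add_smul, map_add, map_add, hy, hz, add_smul]

theorem map_smul_of_mem_homGr {M N : GrMod R} {q : ℤ} {f : M.carrier →ₗ[ℚ] N.carrier}
    (hf : f ∈ M.homGr N q) (a : R.carrier) (x : M.carrier) :
    f (a • x) = twist R.internal q a • f x := by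
  induction a using graded_induction R.internal with
  | mem i a ha => rw [hf.2 i a ha, twist_of_mem _ _ ha, smul_assoc]
  | zero => rw [zero_smul, map_zero, map_zero, zero_smul]
  | add y z hy hz => rw [add_smul, map_add, map_add, hy, hz, add_smul]

section Basis

variable {M N : GrMod R} {ι : Type*} (b : Module.Basis ι R.carrier M.carrier)

theorem basis_induction {P : M.carrier → Prop} (x : M.carrier)
    (smul : ∀ (a : R.carrier) (i : ι), P (a • b i))
    (zero : P 0) (add : ∀ x y, P x → P y → P (x + y)) : P x := by
  have : ∀ l : ι →₀ R.carrier, P (Finsupp.linearCombination R.carrier b l) := by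
    intro l
    induction l using Finsupp.induction_linear with
    | zero => rw [map_zero]; exact zero
    | add l l' hl hl' => rw [map_add]; exact add _ _ hl hl'
    | single i a => rw [Finsupp.linearCombination_single]; exact smul a i
  rw [← b.linearCombination_repr x]
  exact this _

theorem eq_of_basis {q : ℤ} {f g : M.carrier →ₗ[ℚ] N.carrier} (hf : f ∈ M.homGr N q)
    (hg : g ∈ M.homGr N q) (h : ∀ i, f (b i) = g (b i)) : f = g := by
  ext x
  refine basis_induction b (P := fun x => f x = g x) x (fun a i => ?_) ?_ ?_
  · rw [map_smul_of_mem_homGr hf, map_smul_of_mem_homGr hg, h]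
  · rw [map_zero, map_zero]
  · intro x y hx hy; rw [map_add, map_add, hx, hy]

/-- The coefficients of a homogeneous element are not known to be homogeneous at this point. The
claim is therefore recast as compatibility of `L` with the projections to components, an additive
identity that can be checked on multiples of basis vectors. -/
theorem map_mem_of_basis {e : ι → ℤ} (hb : ∀ i, b i ∈ M.gr (e i)) (q : ℤ)
    (L : M.carrier →ₗ[R.carrier] N.carrier) (hL : ∀ i, L (b i) ∈ N.gr (e i + q)) (n : ℤ)
    (x : M.carrier) (hx : x ∈ M.gr n) : L x ∈ N.gr (n + q) := by
  have key : ∀ x, L (component M.internal n x) = component N.internal (n + q) (L x) := by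
    intro x
    refine basis_induction b (P := fun x => L (component M.internal n x) =
      component N.internal (n + q) (L x)) x (fun a i => ?_) ?_ ?_
    · rw [M.component_smul (hb i), map_smul, map_smul, N.component_smul (hL i),
        add_sub_add_right_eq_sub]
    · simp only [map_zero]
    · intro x y hx hy; simp only [map_add, hx, hy]
  rw [← component_of_mem M.internal hx, key]
  exact component_mem _ _ _

/-- An `R`-linear map composed with `twist` obeys the sign rule of `homGr`. The values on the basis
are prescribed for the `R`-linear factor, with a sign that the twist cancels. -/
theorem exists_homGr_of_basis {e : ι → ℤ} (hb : ∀ i, b i ∈ M.gr (e i)) (q : ℤ)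
    (w : ι → N.carrier) (hw : ∀ i, w i ∈ N.gr (e i + q)) :
    ∃ f ∈ M.homGr N q, ∀ i, f (b i) = w i := by
  let L : M.carrier →ₗ[R.carrier] N.carrier := b.constr ℕ fun i => (-1 : ℚ) ^ (q * e i) • w i
  have hL : ∀ i, L (b i) = (-1 : ℚ) ^ (q * e i) • w i := fun i => b.constr_basis ..
  have hL' := map_mem_of_basis b hb q L fun i => by rw [hL]; exact Submodule.smul_mem _ _ (hw i)
  refine ⟨L.restrictScalars ℚ ∘ₗ twist M.internal q, ⟨fun i x hx => ?_, fun i a ha x => ?_⟩,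
    fun i => ?_⟩
  · rw [LinearMap.comp_apply, twist_of_mem _ _ hx, map_smul]
    exact Submodule.smul_mem _ _ (hL' i x hx)
  · rw [LinearMap.comp_apply, twist_smul, twist_of_mem _ _ ha, LinearMap.restrictScalars_apply,
      map_smul, smul_assoc]
    rfl
  · rw [LinearMap.comp_apply, twist_of_mem _ _ (hb i), map_smul, LinearMap.restrictScalars_apply,
      hL, smul_smul, neg_one_zpow_mul_self, one_smul]

/-- A graded surjection is surjective in each degree. -/
theorem IsGraded.exists_mem {M N : GrMod R} {g : M.carrier →ₗ[R.carrier] N.carrier}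
    (hg : IsGraded g) (hs : Function.Surjective g) {n : ℤ} {y : N.carrier} (hy : y ∈ N.gr n) :
    ∃ x ∈ M.gr n, g x = y := by
  obtain ⟨x, rfl⟩ := hs y
  exact ⟨component M.internal n x, component_mem _ _ _, by
    rw [hg.map_component, component_of_mem _ hy]⟩

/-- A graded module with a homogeneous basis is projective. -/
theorem isProjective_of_basis {e : ι → ℤ} (hb : ∀ i, b i ∈ M.gr (e i)) : M.IsProjective := by
  intro L N g f hg hs hf
  choose w hw hw' using fun i => hg.exists_mem hs (hf _ _ (hb i))
  refine ⟨b.constr ℕ w, fun n x hx => ?_, b.ext fun i => ?_⟩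
  · have := map_mem_of_basis b hb 0 (b.constr ℕ w)
      (fun i => by rw [b.constr_basis, add_zero]; exact hw i) n x hx
    rwa [add_zero] at this
  · rw [LinearMap.comp_apply, b.constr_basis, hw']

end Basis

end GrMod

/-! ### Homology classes and maps induced on homology -/

/-- The homology class of a cycle of a dg algebra. -/
noncomputable def DGAlg.cls (A : DGAlg.{u}) : A.cycles →ₗ[ℚ] A.homology.carrier := A.homologyMk

theorem DGAlg.cls_surjective (A : DGAlg.{u}) : Function.Surjective A.cls :=
  A.homologyMk_surjective

theorem DGAlg.cls_eq_zero (A : DGAlg.{u}) {z : A.cycles} : A.cls z = 0 ↔ ∃ b, A.d b = z :=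
  A.homologyMk_eq_zero

namespace DGMod

variable {A : DGAlg.{u}} (X W : DGMod A)

/-- The homology class of a cycle of a dg module. -/
noncomputable def cls : (X.cycles.restrictScalars ℚ) →ₗ[ℚ] X.homology.carrier := X.homologyMk

theorem cls_surjective : Function.Surjective X.cls := X.homologyMk_surjective

theorem cls_eq_zero {z : X.cycles.restrictScalars ℚ} : X.cls z = 0 ↔ ∃ y, X.d y = z :=
  X.homologyMk_eq_zero

theorem smul_mem_cycles {a : A.carrier} (ha : a ∈ A.cycles) {x : X.carrier}
    (hx : x ∈ X.cycles.restrictScalars ℚ) : a • x ∈ X.cycles.restrictScalars ℚ :=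
  X.cycles.smul_mem ⟨a, ha⟩ hx

theorem cls_smul_cls (a : A.cycles) (x : X.cycles.restrictScalars ℚ) :
    A.cls a • X.cls x = X.cls ⟨a • (x : X.carrier), X.smul_mem_cycles a.2 x.2⟩ := rfl

theorem cls_mem {n : ℤ} {z : X.cycles.restrictScalars ℚ} (hz : (z : X.carrier) ∈ X.gr n) :
    X.cls z ∈ X.homology.gr n := ⟨z, hz, rfl⟩

theorem exists_cls_eq {n : ℤ} {x : X.homology.carrier} (hx : x ∈ X.homology.gr n) :
    ∃ z : X.cycles.restrictScalars ℚ, (z : X.carrier) ∈ X.gr n ∧ X.cls z = x := hx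

variable {X W}

theorem homD_eq_zero {n : ℤ} {f : X.carrier →ₗ[ℚ] W.carrier} :
    X.homD W n f = 0 ↔ ∀ x, W.d (f x) = (-1 : ℚ) ^ n • f (X.d x) := by
  simp only [LinearMap.ext_iff, homD_apply, LinearMap.zero_apply, sub_eq_zero]

/-- The map on homology induced by a map which commutes with the differentials up to sign. -/
noncomputable def homologyMap (n : ℤ) (f : X.carrier →ₗ[ℚ] W.carrier)
    (hf : X.homD W n f = 0) : X.homology.carrier →ₗ[ℚ] W.homology.carrier :=
  liftOfSurjective X.cls
    (W.cls ∘ₗ f.restrict (p := X.cycles.restrictScalars ℚ) (q := W.cycles.restrictScalars ℚ)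
      fun x hx => by
        change W.d (f x) = 0
        rw [homD_eq_zero.1 hf, show X.d x = 0 from hx, map_zero, smul_zero])
    X.cls_surjective fun x hx => by
      obtain ⟨y, hy⟩ := X.cls_eq_zero.1 hx
      refine W.cls_eq_zero.2 ⟨(-1 : ℚ) ^ n • f y, ?_⟩
      rw [map_smul, homD_eq_zero.1 hf, smul_smul, neg_one_zpow_mul_self, one_smul, hy]
      rfl

theorem homologyMap_cls {n : ℤ} {f : X.carrier →ₗ[ℚ] W.carrier} (hf : X.homD W n f = 0)
    (x : X.cycles.restrictScalars ℚ) (h : f x ∈ W.cycles.restrictScalars ℚ) :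
    homologyMap n f hf (X.cls x) = W.cls ⟨f x, h⟩ :=
  liftOfSurjective_apply _ _ _ _ x

theorem map_mem_cycles {n : ℤ} {f : X.carrier →ₗ[ℚ] W.carrier} (hf : X.homD W n f = 0)
    {x : X.carrier} (hx : x ∈ X.cycles.restrictScalars ℚ) :
    f x ∈ W.cycles.restrictScalars ℚ := by
  change W.d (f x) = 0
  rw [homD_eq_zero.1 hf, show X.d x = 0 from hx, map_zero, smul_zero]

theorem homologyMap_mem {n : ℤ} {f : X.carrier →ₗ[ℚ] W.carrier} (hf : X.homD W n f = 0)
    (hf' : f ∈ X.homGr W.toGrMod n) : homologyMap n f hf ∈ X.homology.homGr W.homology n := by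
  constructor
  · intro i x hx
    obtain ⟨z, hz, rfl⟩ := X.exists_cls_eq hx
    rw [homologyMap_cls hf z (map_mem_cycles hf z.2)]
    exact W.cls_mem (hf'.1 i z hz)
  · rintro i _ ⟨a, ha, rfl⟩ x
    obtain ⟨x, rfl⟩ := X.cls_surjective x
    change homologyMap n f hf (A.cls a • X.cls x) = _ • (A.cls a • _)
    rw [cls_smul_cls, homologyMap_cls hf x (map_mem_cycles hf x.2), cls_smul_cls, ← map_smul,
      homologyMap_cls hf _ (map_mem_cycles hf (X.smul_mem_cycles a.2 x.2))]
    congr 1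
    exact Subtype.ext (hf'.2 i a ha x)

theorem homologyMap_eq_zero {n : ℤ} {f : X.carrier →ₗ[ℚ] W.carrier} (hf : X.homD W n f = 0) :
    homologyMap n f hf = 0 ↔ ∀ x, X.d x = 0 → ∃ y, W.d y = f x := by
  constructor
  · intro h x hx
    have := LinearMap.congr_fun h (X.cls ⟨x, hx⟩)
    rw [homologyMap_cls hf _ (map_mem_cycles (x := x) hf hx)] at this
    exact W.cls_eq_zero.1 this
  · intro h
    ext x
    obtain ⟨x, rfl⟩ := X.cls_surjective x
    rw [homologyMap_cls hf x (map_mem_cycles hf x.2)]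
    exact W.cls_eq_zero.2 (h x x.2)

/-- The `H(A)`-linear map on homology induced by a map of dg modules. -/
noncomputable def homologyLin (f : X.carrier →ₗ[A.carrier] W.carrier)
    (hf : ∀ x, f (X.d x) = W.d (f x)) :
    X.homology.carrier →ₗ[A.homology.carrier] W.homology.carrier :=
  { homologyMap 0 (f.restrictScalars ℚ) (homD_eq_zero.2 fun x => by
      rw [zpow_zero, one_smul]; exact (hf x).symm) with
    map_smul' := by
      intro a x
      obtain ⟨a, rfl⟩ := A.cls_surjective a
      obtain ⟨x, rfl⟩ := X.cls_surjective x
      have h : X.homD W 0 (f.restrictScalars ℚ) = 0 := homD_eq_zero.2 fun x => by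
        rw [zpow_zero, one_smul]; exact (hf x).symm
      change homologyMap 0 (f.restrictScalars ℚ) h _ =
        A.cls a • homologyMap 0 (f.restrictScalars ℚ) h _
      rw [cls_smul_cls, homologyMap_cls h x (map_mem_cycles h x.2), cls_smul_cls,
        homologyMap_cls h _ (map_mem_cycles h (X.smul_mem_cycles a.2 x.2))]
      congr 1
      exact Subtype.ext (f.map_smul a.1 x.1) }

theorem homologyLin_cls (f : X.carrier →ₗ[A.carrier] W.carrier)
    (hf : ∀ x, f (X.d x) = W.d (f x)) (x : X.cycles.restrictScalars ℚ)
    (h : f x ∈ W.cycles.restrictScalars ℚ) : homologyLin f hf (X.cls x) = W.cls ⟨f x, h⟩ :=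
  homologyMap_cls (homD_eq_zero.2 fun x => by
      rw [zpow_zero, one_smul]; exact (hf x).symm) x h

theorem homologyLin_graded (f : X.carrier →ₗ[A.carrier] W.carrier)
    (hf : ∀ x, f (X.d x) = W.d (f x)) (h : ∀ n, ∀ x ∈ X.gr n, f x ∈ W.gr n) :
    GrMod.IsGraded (homologyLin f hf) := by
  intro n x hx
  obtain ⟨z, hz, rfl⟩ := X.exists_cls_eq hx
  have hz' : f z ∈ W.cycles.restrictScalars ℚ := by
    change W.d (f z) = 0
    rw [← hf, show X.d z = 0 from z.2, map_zero]
  rw [homologyLin_cls f hf z hz']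
  exact W.cls_mem (h n z hz)

end DGMod

/-! ### dg modules with a split basis -/

namespace DGMod

variable {A : DGAlg.{u}}

/-- A homogeneous basis of a dg module of the form `h ⊔ c ⊔ d c`, where the `h` are cycles. -/
structure SplitBasis (X : DGMod A) where
  I : Type u
  J : Type u
  basis : Module.Basis (I ⊕ J ⊕ J) A.carrier X.carrier
  degI : I → ℤ
  degJ : J → ℤ
  h_mem : ∀ i, basis (.inl i) ∈ X.gr (degI i)
  c_mem : ∀ j, basis (.inr (.inl j)) ∈ X.gr (degJ j)
  d_h : ∀ i, X.d (basis (.inl i)) = 0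
  d_c : ∀ j, X.d (basis (.inr (.inl j))) = basis (.inr (.inr j))

theorem exists_mem_d_eq {X : DGMod A} {n : ℤ} {x y : X.carrier} (hx : x ∈ X.gr n)
    (h : X.d y = x) : ∃ y ∈ X.gr (n + 1), X.d y = x :=
  ⟨component X.internal (n + 1) y, component_mem _ _ _, by
    rw [X.component_d, h, add_sub_cancel_right, component_of_mem _ hx]⟩

theorem id_mem_homGr (X : GrMod A.toGrAlg) : LinearMap.id ∈ X.homGr X 0 :=
  ⟨fun i x hx => by rw [add_zero]; exact hx, fun i a _ x => by
    rw [zero_mul, zpow_zero, one_smul]; rfl⟩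

namespace SplitBasis

variable {X W : DGMod A} (b : SplitBasis X)

/-- The degrees of the elements of a split basis. -/
def deg : b.I ⊕ b.J ⊕ b.J → ℤ := Sum.elim b.degI (Sum.elim b.degJ fun j => b.degJ j - 1)

theorem basis_mem : ∀ k, b.basis k ∈ X.gr (b.deg k)
  | .inl i => b.h_mem i
  | .inr (.inl j) => b.c_mem j
  | .inr (.inr j) => by rw [← b.d_c]; exact X.d_mem (b.c_mem j)

theorem d_dc (j : b.J) : X.d (b.basis (.inr (.inr j))) = 0 := by rw [← b.d_c, X.d_d]

/-- Maps of degree `q` which vanish on the basis elements that are not cycles can be prescribed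
freely on the others. -/
theorem exists_cocycle {q : ℤ} (w : b.I → W.carrier) (hw : ∀ i, w i ∈ W.gr (b.degI i + q))
    (hdw : ∀ i, W.d (w i) = 0) :
    ∃ f ∈ X.homGr W.toGrMod q, X.homD W q f = 0 ∧ ∀ i, f (b.basis (.inl i)) = w i := by
  obtain ⟨f, hf, e⟩ := GrMod.exists_homGr_of_basis b.basis b.basis_mem q (N := W.toGrMod)
    (Sum.elim w fun _ => 0) (by
      rintro (i | j)
      · exact hw i
      · exact zero_mem _)
  refine ⟨f, hf, ?_, fun i => e _⟩
  refine GrMod.eq_of_basis b.basis (X.homD_mem W hf) (zero_mem _) ?_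
  rintro (i | j | j)
  · rw [homD_apply, e, b.d_h, map_zero, smul_zero, sub_zero]; exact hdw i
  · rw [homD_apply, e, b.d_c, e]; simp
  · rw [homD_apply, e, b.d_dc]; simp

/-- A cocycle is a coboundary if it maps the cycles of a split basis to boundaries. -/
theorem exists_homD_eq {q : ℤ} {f : X.carrier →ₗ[ℚ] W.carrier} (hf : f ∈ X.homGr W.toGrMod q)
    (hdf : X.homD W q f = 0) (h : ∀ i, ∃ y, W.d y = f (b.basis (.inl i))) :
    ∃ g ∈ X.homGr W.toGrMod (q + 1), X.homD W (q + 1) g = f := by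
  have h' : ∀ i, ∃ y ∈ W.gr (b.degI i + q + 1), W.d y = f (b.basis (.inl i)) := fun i => by
    obtain ⟨y, hy⟩ := h i
    exact exists_mem_d_eq (hf.1 _ _ (b.h_mem i)) hy
  choose w hw e using h'
  -- On `h` the map `g` takes primitives of the values of `f`, and on `c` it is zero. The value on
  -- `d c` is then forced by evaluating `d g - (-1) ^ (q + 1) g d = f` at `c`.
  obtain ⟨g, hg, e'⟩ := GrMod.exists_homGr_of_basis b.basis b.basis_mem (q + 1) (N := W.toGrMod)
    (Sum.elim w (Sum.elim (fun _ => 0) fun j => (-1 : ℚ) ^ q • f (b.basis (.inr (.inl j))))) (by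
      rintro (i | j | j)
      · rw [← add_assoc]; exact hw i
      · exact zero_mem _
      · refine Submodule.smul_mem _ _ ?_
        have := hf.1 _ _ (b.c_mem j)
        change _ ∈ W.gr (b.degJ j - 1 + (q + 1))
        rwa [show b.degJ j - 1 + (q + 1) = b.degJ j + q by ring])
  refine ⟨g, hg, ?_⟩
  have hg' := X.homD_mem W hg
  rw [add_sub_cancel_right] at hg'
  refine GrMod.eq_of_basis b.basis hg' hf ?_
  have hs : (-1 : ℚ) ^ (q + 1) = -(-1) ^ q := by rw [zpow_add_one₀ (by norm_num)]; ring
  rintro (i | j | j)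
  · rw [homD_apply, e', b.d_h, map_zero, smul_zero, sub_zero]; exact e i
  · rw [homD_apply, e', b.d_c, e', hs]
    simp [smul_smul, neg_one_zpow_mul_self]
  · rw [homD_apply, e', b.d_dc, map_zero, smul_zero, sub_zero]
    change W.d ((-1 : ℚ) ^ q • f (b.basis (.inr (.inl j)))) = _
    rw [map_smul, homD_eq_zero.1 hdf, b.d_c, smul_smul, neg_one_zpow_mul_self, one_smul]

/-- The projection onto the span of the cycles `h` is homotopic to the identity. -/
theorem exists_homotopy : ∃ s : X.carrier →ₗ[ℚ] X.carrier, ∀ x,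
    x = X.d (s x) + s (X.d x) +
      b.basis.constr ℕ (Sum.elim (fun i => b.basis (.inl i)) fun _ => (0 : X.carrier)) x := by
  -- The homotopy sends `d c` back to `c` and kills `h` and `c`.
  obtain ⟨s, hs, e⟩ := GrMod.exists_homGr_of_basis b.basis b.basis_mem 1 (N := X.toGrMod)
    (Sum.elim (fun _ => 0) (Sum.elim (fun _ => 0) fun j => b.basis (.inr (.inl j)))) (by
      rintro (i | j | j)
      · exact zero_mem _
      · exact zero_mem _
      · change _ ∈ X.gr (b.degJ j - 1 + 1)
        rw [sub_add_cancel]; exact b.c_mem j)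
  refine ⟨s, fun x => ?_⟩
  set E := b.basis.constr ℕ (Sum.elim (fun i => b.basis (.inl i)) fun _ => (0 : X.carrier))
  have hs' := X.homD_mem X hs
  have hE : LinearMap.id - E.restrictScalars ℚ ∈ X.homGr X.toGrMod 0 := by
    refine sub_mem (id_mem_homGr _) ⟨GrMod.map_mem_of_basis b.basis b.basis_mem 0 E ?_, ?_⟩
    · rintro (i | j)
      · rw [b.basis.constr_basis, add_zero]; exact b.h_mem i
      · rw [b.basis.constr_basis]; exact zero_mem _
    · intro i a _ x
      rw [zero_mul, zpow_zero, one_smul]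
      exact E.map_smul a x
  have key : X.homD X 1 s = LinearMap.id - E.restrictScalars ℚ := by
    refine GrMod.eq_of_basis b.basis hs' hE ?_
    have hb : ∀ k, E (b.basis k) = _ := b.basis.constr_basis ℕ _
    rintro (i | j | j)
    · rw [homD_apply, e, b.d_h, LinearMap.sub_apply, LinearMap.restrictScalars_apply, hb]; simp
    · rw [homD_apply, e, b.d_c, e, LinearMap.sub_apply, LinearMap.restrictScalars_apply, hb]; simp
    · rw [homD_apply, e, b.d_dc, LinearMap.sub_apply, LinearMap.restrictScalars_apply, hb]
      simp [b.d_c]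
  have := LinearMap.congr_fun key x
  rw [homD_apply, zpow_one, neg_smul, one_smul, sub_neg_eq_add, LinearMap.sub_apply,
    LinearMap.id_apply, LinearMap.restrictScalars_apply, eq_sub_iff_add_eq] at this
  exact this.symm

/-- The coordinates with respect to the cycles `h` commute with the differential. -/
theorem repr_d (x : X.carrier) (i : b.I) :
    b.basis.repr (X.d x) (.inl i) = A.d (b.basis.repr x (.inl i)) := by
  refine GrMod.basis_induction (M := X.toGrMod) b.basis
    (P := fun x => b.basis.repr (X.d x) (.inl i) = A.d (b.basis.repr x (.inl i))) x
    (fun a k => ?_) ?_ ?_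
  · rw [X.d_smul', map_add, map_smul, map_smul, map_smul, b.basis.repr_self]
    have h0 : (b.basis.repr (X.d (b.basis k))) (.inl i) = 0 := by
      rcases k with k | k | k
      · rw [b.d_h, map_zero]; rfl
      · rw [b.d_c, b.basis.repr_self, Finsupp.single_eq_of_ne (by simp)]
      · rw [b.d_dc, map_zero]; rfl
    rw [Finsupp.add_apply, Finsupp.smul_apply, Finsupp.smul_apply, Finsupp.smul_apply, h0,
      smul_zero, add_zero]
    by_cases hk : k = .inl i
    · subst hk; simp
    · rw [Finsupp.single_eq_of_ne' hk]; simp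
  · simp
  · intro x y hx hy
    rw [map_add, map_add, map_add, Finsupp.add_apply, Finsupp.add_apply, hx, hy, map_add]

theorem repr_mem {n : ℤ} {x : X.carrier} (hx : x ∈ X.gr n) (k : b.I ⊕ b.J ⊕ b.J) :
    b.basis.repr x k ∈ A.gr (n - b.deg k) := by
  have key : ∀ x, b.basis.repr (component X.internal n x) k =
      component A.internal (n - b.deg k) (b.basis.repr x k) := fun x => by
    refine GrMod.basis_induction (M := X.toGrMod) b.basis
      (P := fun x => b.basis.repr (component X.internal n x) k =
        component A.internal (n - b.deg k) (b.basis.repr x k)) x (fun a l => ?_) ?_ ?_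
    · rw [X.component_smul (b.basis_mem l), map_smul, map_smul, b.basis.repr_self]
      by_cases hk : l = k
      · subst hk; simp
      · simp [Finsupp.single_eq_of_ne' hk]
    · simp
    · intro x y hx hy
      rw [map_add, map_add, map_add, Finsupp.add_apply, Finsupp.add_apply, hx, hy, map_add]
  rw [← component_of_mem X.internal hx, key]
  exact component_mem _ _ _

/-- The homology class of a basis element. -/
noncomputable def hcls (i : b.I) : X.homology.carrier := X.cls ⟨b.basis (.inl i), b.d_h i⟩

theorem hcls_mem (i : b.I) : b.hcls i ∈ X.homology.gr (b.degI i) := X.cls_mem (b.h_mem i)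

/-- The coordinates on homology. -/
noncomputable def coord (i : b.I) : X.homology.carrier →ₗ[ℚ] A.homology.carrier :=
  liftOfSurjective X.cls
    (A.cls ∘ₗ ((Finsupp.lapply (R := A.carrier) (Sum.inl i : b.I ⊕ b.J ⊕ b.J) ∘ₗ
      b.basis.repr.toLinearMap).restrictScalars ℚ).restrict
      (p := X.cycles.restrictScalars ℚ) (q := A.cycles.toSubmodule) fun x hx => by
        change A.d (b.basis.repr x (.inl i)) = 0
        rw [← b.repr_d, show X.d x = 0 from hx, map_zero]; rfl)
    X.cls_surjective fun x hx => by
      obtain ⟨y, hy⟩ := X.cls_eq_zero.1 hx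
      refine A.cls_eq_zero.2 ⟨b.basis.repr y (.inl i), ?_⟩
      rw [← b.repr_d, hy]
      rfl

theorem repr_mem_cycles {x : X.carrier} (hx : X.d x = 0) (i : b.I) :
    b.basis.repr x (.inl i) ∈ A.cycles := by
  change A.d (b.basis.repr x (.inl i)) = 0
  rw [← b.repr_d, hx, map_zero]; rfl

theorem coord_cls (i : b.I) (x : X.cycles.restrictScalars ℚ) :
    b.coord i (X.cls x) = A.cls ⟨b.basis.repr x (.inl i), b.repr_mem_cycles x.2 i⟩ :=
  liftOfSurjective_apply _ _ _ _ x

theorem coord_smul_hcls_self (i : b.I) (α : A.homology.carrier) :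
    b.coord i (α • b.hcls i) = α := by
  obtain ⟨a, rfl⟩ := A.cls_surjective α
  rw [hcls, cls_smul_cls, coord_cls]
  congr 1
  apply Subtype.ext
  change b.basis.repr ((a : A.carrier) • b.basis (.inl i)) (.inl i) = a
  rw [map_smul, b.basis.repr_self]
  simp

theorem coord_smul_hcls_ne {i j : b.I} (h : i ≠ j) (α : A.homology.carrier) :
    b.coord j (α • b.hcls i) = 0 := by
  obtain ⟨a, rfl⟩ := A.cls_surjective α
  rw [hcls, cls_smul_cls, coord_cls]
  rw [← map_zero A.cls]
  congr 1
  apply Subtype.ext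
  change b.basis.repr ((a : A.carrier) • b.basis (.inl i)) (.inl j) = 0
  rw [map_smul, b.basis.repr_self, Finsupp.smul_apply,
    Finsupp.single_eq_of_ne (by simpa using h.symm),
    smul_zero]

/-- No basis vector has a differential with an `h`-component, so the `h`-coordinates are chain maps
to `A`. On homology they form a family dual to the classes of the `h`. -/
theorem linearIndependent_hcls : LinearIndependent A.homology.carrier b.hcls := by
  rw [linearIndependent_iff]
  intro l hl
  ext i
  have h1 := congrArg (b.coord i) hl
  rw [Finsupp.linearCombination_apply, Finsupp.sum, map_sum, map_zero] at h1
  rw [Finset.sum_eq_single i (fun j _ hj => b.coord_smul_hcls_ne hj _)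
    (fun hi => by rw [Finsupp.notMem_support_iff.1 hi, zero_smul, map_zero]),
    b.coord_smul_hcls_self] at h1
  exact h1

/-- The decomposition of a cycle. -/
theorem exists_eq_sum {x : X.carrier} (hx : X.d x = 0) : ∃ y,
    x = X.d y + ∑ k ∈ (b.basis.repr x).support, b.basis.repr x k •
      (Sum.elim (fun i => b.basis (.inl i)) fun _ => (0 : X.carrier)) k := by
  obtain ⟨s, hs⟩ := b.exists_homotopy
  refine ⟨s x, ?_⟩
  conv_lhs => rw [hs x, hx, map_zero, add_zero, b.basis.constr_apply, Finsupp.sum]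

/-- By the homotopy, a cycle is a boundary plus a combination of the `h`, whose coefficients are
cycles of `A` by `repr_d`. -/
theorem span_hcls : ⊤ ≤ Submodule.span A.homology.carrier (Set.range b.hcls) := by
  rintro x -
  obtain ⟨x, rfl⟩ := X.cls_surjective x
  obtain ⟨y, hy⟩ := b.exists_eq_sum x.2
  have hmem : ∀ k, b.basis.repr x k • (Sum.elim (fun i => b.basis (.inl i)) fun _ => 0) k ∈
      X.cycles.restrictScalars ℚ := by
    rintro (i | j)
    · exact X.smul_mem_cycles (b.repr_mem_cycles x.2 i) (b.d_h i)
    · rw [Sum.elim_inr, smul_zero]; exact zero_mem _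
  have h2 : X.cls x = ∑ k ∈ (b.basis.repr x).support, X.cls ⟨_, hmem k⟩ := by
    rw [← sub_eq_zero, ← map_sum, ← map_sub]
    refine X.cls_eq_zero.2 ⟨y, ?_⟩
    rw [Submodule.coe_sub, Submodule.coe_sum, eq_sub_iff_add_eq]
    exact hy.symm
  rw [h2]
  refine Submodule.sum_mem _ fun k _ => ?_
  rcases k with i | j
  · have h3 : X.cls ⟨_, hmem (.inl i)⟩ = A.cls ⟨_, b.repr_mem_cycles x.2 i⟩ • b.hcls i := rfl
    rw [h3]
    exact Submodule.smul_mem _ _ (Submodule.subset_span ⟨i, rfl⟩)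
  · have h3 : X.cls ⟨_, hmem (.inr j)⟩ = 0 := X.cls_eq_zero.2 ⟨0, by simp⟩
    rw [h3]
    exact zero_mem _

/-- The basis of the homology given by the classes of the cycles `h`. -/
noncomputable def homologyBasis : Module.Basis b.I A.homology.carrier X.homology.carrier :=
  Module.Basis.mk b.linearIndependent_hcls b.span_hcls

theorem homologyBasis_apply (i : b.I) : b.homologyBasis i = b.hcls i :=
  Module.Basis.mk_apply _ _ _

theorem homologyBasis_mem (i : b.I) : b.homologyBasis i ∈ X.homology.gr (b.degI i) := by
  rw [homologyBasis_apply]; exact b.hcls_mem i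

include b in
theorem isProjective_homology : X.homology.IsProjective :=
  GrMod.isProjective_of_basis b.homologyBasis b.homologyBasis_mem

include b in
/-- Every map on homology is induced by a cocycle. -/
theorem exists_homologyMap_eq {q : ℤ} {φ : X.homology.carrier →ₗ[ℚ] W.homology.carrier}
    (hφ : φ ∈ X.homology.homGr W.homology q) :
    ∃ f ∈ X.homGr W.toGrMod q, ∃ hf : X.homD W q f = 0, homologyMap q f hf = φ := by
  choose w hw e using fun i => W.exists_cls_eq (hφ.1 _ _ (b.hcls_mem i))
  obtain ⟨f, hf, hdf, e'⟩ := b.exists_cocycle (fun i => (w i : W.carrier)) hw fun i => (w i).2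
  refine ⟨f, hf, hdf, GrMod.eq_of_basis b.homologyBasis (homologyMap_mem hdf hf) hφ fun i => ?_⟩
  rw [homologyBasis_apply, ← e, hcls,
    homologyMap_cls hdf _ (map_mem_cycles (x := b.basis (.inl i)) hdf (b.d_h i))]
  congr 1
  exact Subtype.ext (e' i)

include b in
/-- A cocycle which induces zero on homology is a coboundary. -/
theorem exists_of_homologyMap_eq_zero {q : ℤ} {f : X.carrier →ₗ[ℚ] W.carrier}
    (hf : f ∈ X.homGr W.toGrMod q) (hdf : X.homD W q f = 0) (h : homologyMap q f hdf = 0) :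
    ∃ g ∈ X.homGr W.toGrMod (q + 1), X.homD W (q + 1) g = f :=
  b.exists_homD_eq hf hdf fun i => (homologyMap_eq_zero hdf).1 h _ (b.d_h i)

end SplitBasis

theorem homologyMap_eq_zero_of_homD {X W : DGMod A} {q : ℤ} {f g : X.carrier →ₗ[ℚ] W.carrier}
    (hf : X.homD W q f = 0) (h : X.homD W (q + 1) g = f) : homologyMap q f hf = 0 := by
  refine (homologyMap_eq_zero hf).2 fun x hx => ⟨g x, ?_⟩
  rw [← h, homD_apply, hx, map_zero, smul_zero, sub_zero]

end DGMod

/-! ### Connectedness of the enveloping algebra -/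

/-- A dg algebra is connected if its part of degree `≤ 0` is spanned by the unit, which is not
zero. -/
structure DGAlg.IsConnected (A : DGAlg.{u}) : Prop where
  exists_augmentation : ∃ ε : A.carrier →ₗ[ℚ] ℚ, ε 1 = 1
  exists_smul_one : ∀ n ≤ 0, ∀ a ∈ A.gr n, ∃ q : ℚ, a = q • 1

/-- The augmentation extends the zero map `L → ℚ`. A product of homogeneous generators of total
degree `≤ 0` either has a factor of degree `≤ 0`, which is zero since `L` is reduced, or is the
empty product. -/
theorem DGLie.env_isConnected (L : DGLie.{u}) : L.env.IsConnected where
  exists_augmentation := by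
    refine ⟨(DGLie.lift (L := L) (B := ℚ) 0 fun i j x y _ _ => by simp).toLinearMap, ?_⟩
    exact map_one (DGLie.lift (L := L) (B := ℚ) 0 fun i j x y _ _ => by simp)
  exists_smul_one := by
    intro n hn a ha
    have ha' : a ∈ L.envGr n := ha
    clear ha
    change L.Env at a
    change ∃ q : ℚ, a = q • (1 : L.Env)
    induction ha' using Submodule.span_induction with
    | mem u hu =>
      obtain ⟨l, hl, hs, rfl⟩ := hu
      by_cases h : ∃ p ∈ l, p.1 ≤ 0
      · obtain ⟨p, hp, hp'⟩ := h
        refine ⟨0, ?_⟩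
        rw [zero_smul]
        refine List.prod_eq_zero (List.mem_map.2 ⟨p, hp, ?_⟩)
        have := hl p hp
        rw [L.reduced _ hp'] at this
        rw [show p.2 = 0 from this, map_zero]
      · push Not at h
        cases l with
        | nil => exact ⟨1, (one_smul _ _).symm⟩
        | cons p l =>
          have h1 : 0 ≤ (l.map Prod.fst).sum := List.sum_nonneg fun x hx => by
            obtain ⟨p, hp, rfl⟩ := List.mem_map.1 hx
            exact (h p (by simp [hp])).le
          have h2 := h p (by simp)
          rw [List.map_cons, List.sum_cons] at hs
          lia
    | zero => exact ⟨0, (zero_smul _ _).symm⟩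
    | add a b _ _ ha hb =>
      obtain ⟨q, rfl⟩ := ha
      obtain ⟨r, rfl⟩ := hb
      exact ⟨q + r, (add_smul _ _ _).symm⟩
    | smul q a _ ha =>
      obtain ⟨r, rfl⟩ := ha
      exact ⟨q * r, smul_smul _ _ _⟩

namespace DGMod

variable {A : DGAlg.{u}}

/-! ### Quotients of the form `A ⊗ (X / K)` -/

section Quot

variable (X : DGMod A) (K : Submodule ℚ X.carrier) (S : Submodule A.carrier X.free.carrier)

/-- The map `A ⊗ X → A ⊗ (X / K)`. -/
noncomputable def freeMkQ : X.free.carrier →ₗ[A.carrier] A.carrier ⊗[ℚ] (X.carrier ⧸ K) :=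
  K.mkQ.baseChange A.carrier

theorem freeMkQ_tmul (a : A.carrier) (x : X.carrier) :
    X.freeMkQ K (X.tmul a x) = a ⊗ₜ K.mkQ x := rfl

theorem freeMkQ_surjective : Function.Surjective (X.freeMkQ K) :=
  LinearMap.lTensor_surjective A.carrier K.mkQ_surjective

/-- The submodule `S` of `A ⊗ X` is the image of `A ⊗ K`. -/
structure IsFreeSub : Prop where
  tmul_mem : ∀ a, ∀ x ∈ K, X.tmul a x ∈ S
  freeMkQ_eq_zero : ∀ t ∈ S, X.freeMkQ K t = 0

variable {X K S}

/-- By right exactness of the tensor product, the kernel of `A ⊗ X → A ⊗ (X / K)` is the image of `A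
⊗ K`. -/
theorem IsFreeSub.eq_ker (h : IsFreeSub X K S) : S = LinearMap.ker (X.freeMkQ K) := by
  refine le_antisymm h.freeMkQ_eq_zero fun t ht => ?_
  obtain ⟨u, rfl⟩ := (lTensor_exact A.carrier (LinearMap.exact_subtype_mkQ K)
    K.mkQ_surjective _).1 ht
  clear ht
  induction u with
  | zero => rw [map_zero]; exact zero_mem _
  | add u v hu hv => rw [map_add]; exact S.add_mem hu hv
  | tmul a x => exact h.tmul_mem a x x.2

/-- A linear functional with value `1` at the unit gives a retraction of `X / K → A ⊗ (X / K)`, `x ↦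
1 ⊗ x`, which is therefore injective. -/
theorem IsFreeSub.one_tmul_mem (hA : A.IsConnected) (h : IsFreeSub X K S) {x : X.carrier} :
    X.tmul 1 x ∈ S ↔ x ∈ K := by
  refine ⟨fun hx => ?_, h.tmul_mem 1 x⟩
  obtain ⟨ε, hε⟩ := hA.exists_augmentation
  have h1 : (1 : A.carrier) ⊗ₜ[ℚ] K.mkQ x = 0 := h.freeMkQ_eq_zero _ hx
  have h2 := congrArg
    ((TensorProduct.lid ℚ (X.carrier ⧸ K)).toLinearMap ∘ₗ ε.rTensor (X.carrier ⧸ K)) h1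
  rw [map_zero] at h2
  have h3 : ε 1 • K.mkQ x = 0 := h2
  rw [hε, one_smul] at h3
  exact (Submodule.Quotient.mk_eq_zero K).1 h3

/-- The quotient of `A ⊗ X` by the image of `A ⊗ K`. -/
noncomputable def IsFreeSub.equiv (h : IsFreeSub X K S) :
    (X.free.carrier ⧸ S) ≃ₗ[A.carrier] A.carrier ⊗[ℚ] (X.carrier ⧸ K) :=
  (Submodule.quotEquivOfEq _ _ h.eq_ker).trans
    ((X.freeMkQ K).quotKerEquivOfSurjective (X.freeMkQ_surjective K))

theorem IsFreeSub.equiv_mk (h : IsFreeSub X K S) (a : A.carrier) (x : X.carrier) :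
    h.equiv (S.mkQ (X.tmul a x)) = a ⊗ₜ K.mkQ x := rfl

theorem d_one_tmul (X : DGMod A) (x : X.carrier) : X.free.d (X.tmul 1 x) = X.tmul 1 (X.d x) := by
  rw [d_tmul, A.d_one, map_zero, LinearMap.zero_apply, zero_add, parity_of_mem _ A.one_mem,
    zpow_zero, one_smul]

theorem one_tmul_mem (X : DGMod A) {n : ℤ} {x : X.carrier} (hx : x ∈ X.gr n) :
    X.tmul 1 x ∈ X.free.gr n := by
  have := X.tmul_mem A.one_mem hx
  rwa [zero_add] at this

theorem component_one_tmul (X : DGMod A) (n : ℤ) (x : X.carrier) :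
    component X.free.internal n (X.tmul 1 x) = X.tmul 1 (component X.internal n x) := by
  have := map_component X.internal X.free.internal (X.tmul 1) 0
    (fun n x hx => by rw [add_zero]; exact X.one_tmul_mem hx) n x
  rw [add_zero] at this
  exact this.symm

/-- The quotient of `A ⊗ X` by the image of `A ⊗ K` has a split basis, consisting of elements of
`X`. -/
theorem IsFreeSub.exists_splitBasis (h : IsFreeSub X K S)
    (hK : ∀ n, ∀ x ∈ K, component X.internal n x ∈ K) (hdK : ∀ x ∈ K, X.d x ∈ K)
    (hS : X.free.IsHomogeneous S) (hdS : ∀ x ∈ S, X.free.d x ∈ S) :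
    ∃ b : SplitBasis (X.free.quot S hS hdS), ∀ i, ∃ x ∈ X.gr (b.degI i), X.d x ∈ K ∧
      b.basis (.inl i) = S.mkQ (X.tmul 1 x) ∧ ∀ y, x - X.d y ∉ K := by
  have hint : DirectSum.IsInternal fun n => (X.gr n).map K.mkQ :=
    isInternal_map X.internal K.mkQ K.mkQ_surjective fun n x hx =>
      (Submodule.Quotient.mk_eq_zero K).2 (hK n x ((Submodule.Quotient.mk_eq_zero K).1 hx))
  obtain ⟨I, J, b, eI, eJ, hI, hJ, hdI, hdJ, hnI⟩ := exists_split_basis hint (K.mapQ K X.d hdK)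
    (by
      rintro n _ ⟨x, hx, rfl⟩
      exact ⟨X.d x, X.d_mem hx, rfl⟩)
    (fun x => by
      obtain ⟨x, rfl⟩ := K.mkQ_surjective x
      change K.mkQ (X.d (X.d x)) = 0
      rw [X.d_d, map_zero])
  choose xI hxI exI using hI
  choose xJ hxJ exJ using hJ
  -- A split basis of the complex `X / K` over `ℚ` is a basis of `A ⊗ (X / K)` over `A`.
  let B : Module.Basis (I ⊕ J ⊕ J) A.carrier (X.free.quot S hS hdS).carrier :=
    (Algebra.TensorProduct.basis A.carrier b).map h.equiv.symm
  have hB : ∀ k x, K.mkQ x = b k → B k = S.mkQ (X.tmul 1 x) := by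
    intro k x hx
    change h.equiv.symm (Algebra.TensorProduct.basis A.carrier b k) = _
    rw [Algebra.TensorProduct.basis_apply, LinearEquiv.symm_apply_eq, h.equiv_mk, hx]
  have hd : ∀ x, (X.free.quot S hS hdS).d (S.mkQ (X.tmul 1 x)) = S.mkQ (X.tmul 1 (X.d x)) :=
    fun x => congrArg S.mkQ (X.d_one_tmul x)
  have hdI' : ∀ i, X.d (xI i) ∈ K := fun i => by
    have := hdI i
    rw [← exI] at this
    exact (Submodule.Quotient.mk_eq_zero K).1 this
  refine ⟨⟨I, J, B, eI, eJ, fun i => ?_, fun j => ?_, fun i => ?_, fun j => ?_⟩, fun i =>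
    ⟨xI i, hxI i, hdI' i, hB _ _ (exI i), fun y hy => ?_⟩⟩
  · rw [hB _ _ (exI i)]
    exact ⟨_, X.one_tmul_mem (hxI i), rfl⟩
  · rw [hB _ _ (exJ j)]
    exact ⟨_, X.one_tmul_mem (hxJ j), rfl⟩
  · rw [hB _ _ (exI i), hd]
    exact (Submodule.Quotient.mk_eq_zero S).2 (h.tmul_mem 1 _ (hdI' i))
  · rw [hB _ _ (exJ j), hd, hB _ (X.d (xJ j))]
    rw [← hdJ, ← exJ]; rfl
  · refine hnI i (K.mkQ y) ?_
    rw [← exI]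
    refine (sub_eq_zero.1 ?_).symm
    exact (Submodule.Quotient.mk_eq_zero K).2 hy

/-- If `X / K` has no homology in degrees `≤ m`, then the quotient of `(A ⊗ X) / (A ⊗ K)` by the
image of `X` has no homology in degrees `≤ m + 1`. -/
theorem IsFreeSub.acyclic_succ (hA : A.IsConnected) (h : IsFreeSub X K S)
    (hK : ∀ n, ∀ x ∈ K, component X.internal n x ∈ K)
    (hS : X.free.IsHomogeneous S) (hdS : ∀ x ∈ S, X.free.d x ∈ S)
    (b : SplitBasis (X.free.quot S hS hdS))
    (hb : ∀ i, ∃ x ∈ X.gr (b.degI i), X.d x ∈ K ∧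
      b.basis (.inl i) = S.mkQ (X.tmul 1 x) ∧ ∀ y, x - X.d y ∉ K)
    {m : ℤ} (hm : ∀ n ≤ m, ∀ y ∈ X.gr n, X.d y ∈ K → ∃ z, y - X.d z ∈ K) (n : ℤ) (hn : n ≤ m + 1)
    (y : X.free.carrier) (hy : y ∈ X.free.gr n)
    (hdy : X.free.d y ∈ S.restrictScalars ℚ ⊔ LinearMap.range (X.tmul 1)) :
    ∃ z, y - X.free.d z ∈ S.restrictScalars ℚ ⊔ LinearMap.range (X.tmul 1) := by
  choose x hx hdx ex hnx using hb
  -- A basis cycle `h` of degree `≤ m` would bound in `X / K`, whereas the `h` were chosen not to be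
  -- boundaries.
  have hdeg : ∀ i, m + 1 ≤ b.degI i := fun i => by
    by_contra hlt
    obtain ⟨z, hz⟩ := hm (b.degI i) (by lia) (x i) (hx i) (hdx i)
    exact hnx i z hz
  -- This is the connecting map of `0 → X / K → A ⊗ (X / K) → Ā ⊗ (X / K) → 0` at the level of
  -- elements. Write `d y = s' + 1 ⊗ t'` with homogeneous terms. Then `t'` is a cycle modulo `K` of
  -- degree `n - 1 ≤ m`, so it bounds some `z'` modulo `K`, and `y - 1 ⊗ z'` is a cycle modulo `S`.
  obtain ⟨s, hs, _, ⟨t, rfl⟩, e⟩ := Submodule.mem_sup.1 hdy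
  have e2 : component X.free.internal (n - 1) s + X.tmul 1 (component X.internal (n - 1) t) =
      X.free.d y := by
    rw [← component_of_mem X.free.internal (X.free.d_mem hy), ← e, map_add, component_one_tmul]
  have hs' := hS (n - 1) s hs
  have ht' := component_mem X.internal (n - 1) t
  generalize component X.free.internal (n - 1) s = s' at e2 hs'
  generalize component X.internal (n - 1) t = t' at e2 ht'
  have e3 : X.tmul 1 (X.d t') = -X.free.d s' := by
    have := congrArg X.free.d e2
    rw [X.free.d_d, map_add] at this
    rw [← d_one_tmul]
    exact eq_neg_of_add_eq_zero_right this
  have h4 : X.d t' ∈ K := by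
    rw [← h.one_tmul_mem hA, e3]
    exact neg_mem (hdS s' hs')
  obtain ⟨z, hz⟩ := hm (n - 1) (by lia) t' ht' h4
  have hz' : t' - X.d (component X.internal n z) ∈ K := by
    have := hK (n - 1) _ hz
    rwa [map_sub, component_of_mem _ ht', ← X.component_d] at this
  have hz'' := component_mem X.internal n z
  generalize component X.internal n z = z' at hz' hz''
  set y' := y - X.tmul 1 z' with hy'
  have hdy' : X.free.d y' ∈ S := by
    rw [hy', map_sub, d_one_tmul, ← e2, add_sub_assoc, ← map_sub]
    exact add_mem hs' (h.tmul_mem 1 _ hz')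
  have hymem : S.mkQ y' ∈ (X.free.quot S hS hdS).gr n :=
    ⟨y', sub_mem hy (X.one_tmul_mem hz''), rfl⟩
  -- Up to a boundary, the cycle `y'` is a combination of the `h`. Their degrees are at least `m + 1
  -- ≥ n`, so the coefficients have degree `≤ 0` and are scalars by connectedness. The combination
  -- thus comes from `1 ⊗ X`.
  obtain ⟨u, hu⟩ := b.exists_eq_sum (x := S.mkQ y') ((Submodule.Quotient.mk_eq_zero S).2 hdy')
  obtain ⟨u, rfl⟩ := S.mkQ_surjective u
  have h5 : S.mkQ y' - S.mkQ (X.free.d u) ∈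
      LinearMap.range (S.mkQ.restrictScalars ℚ ∘ₗ X.tmul 1) := by
    have h6 : S.mkQ y' - S.mkQ (X.free.d u) = _ := sub_eq_of_eq_add' hu
    rw [h6]
    refine Submodule.sum_mem _ fun k _ => ?_
    rcases k with i | j
    · obtain ⟨q, hq⟩ := hA.exists_smul_one _ (by
        have := hdeg i
        change n - b.degI i ≤ 0
        lia) _ (b.repr_mem hymem (.inl i))
      rw [hq]
      refine ⟨q • x i, ?_⟩
      rw [Sum.elim_inl, smul_assoc, one_smul, ex, map_smul]
      rfl
    · rw [Sum.elim_inr, smul_zero]; exact zero_mem _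
  obtain ⟨x', hx'⟩ := h5
  refine ⟨u, ?_⟩
  have h7 : y' - X.free.d u - X.tmul 1 x' ∈ S := by
    rw [← Submodule.Quotient.mk_eq_zero]
    exact (sub_eq_zero.2 hx'.symm)
  have h8 : y - X.free.d u = (y' - X.free.d u - X.tmul 1 x') + X.tmul 1 (x' + z') := by
    rw [hy', map_add]; abel
  rw [h8]
  exact add_mem (Submodule.mem_sup_left h7) (Submodule.mem_sup_right ⟨_, rfl⟩)

end Quot

/-! ### Split bases of the normalised bar construction -/

/-- The subspace of `A^{⊗ p} ⊗ V` whose image under `x ↦ 1 ⊗ x` is degenerate. -/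
noncomputable def barKer (V : DGMod A) : ∀ p, Submodule ℚ (V.tensor p).carrier
  | 0 => ⊥
  | p + 1 => (V.degen p).restrictScalars ℚ ⊔ LinearMap.range ((V.tensor p).tmul 1)

/-- This identifies `normalised p` with `A ⊗ C_p`, where `C_p` is the quotient of `tensor p` by
`barKer p`. In turn `C_{p+1}` is `A ⊗ C_p` modulo `1 ⊗ C_p`, that is, `Ā ⊗ C_p`. -/
theorem barKer_isFreeSub (V : DGMod A) : ∀ p, IsFreeSub (V.tensor p) (V.barKer p) (V.degen p)
  | 0 => by
    constructor
    · rintro a x rfl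
      rw [map_zero]; exact zero_mem _
    · rintro t rfl
      exact map_zero _
  | p + 1 => by
    constructor
    · intro a x hx
      obtain ⟨s, hs, _, ⟨x, rfl⟩, rfl⟩ := Submodule.mem_sup.1 hx
      rw [map_add]
      exact add_mem ((V.tensor p).tmul_mem_degenStep _ a hs) ((V.tensor p).unit_mem_degenStep _ a x)
    · intro t ht
      have h0 : ∀ (a : A.carrier) (x : (V.tensor (p + 1)).carrier), x ∈ V.barKer (p + 1) →
          (V.tensor (p + 1)).freeMkQ (V.barKer (p + 1)) ((V.tensor (p + 1)).tmul a x) = 0 :=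
            fun a x hx => by
        rw [freeMkQ_tmul, show (V.barKer (p + 1)).mkQ x = 0 from
          (Submodule.Quotient.mk_eq_zero _).2 hx,
          TensorProduct.tmul_zero]
      refine (V.tensor p).degenStep_ind (V.degen p)
        (P := fun t => (V.tensor (p + 1)).freeMkQ (V.barKer (p + 1)) t = 0) ?_ ?_ ?_ ?_ ht
      · intro a x
        exact h0 a _ (Submodule.mem_sup_right ⟨x, rfl⟩)
      · intro a x hx
        exact h0 a _ (Submodule.mem_sup_left hx)
      · exact map_zero _
      · intro s t hs ht
        exact (map_add _ s t).trans ((congrArg₂ _ hs ht).trans (add_zero _))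

theorem d_barKer (V : DGMod A) : ∀ p, ∀ x ∈ V.barKer p, (V.tensor p).d x ∈ V.barKer p
  | 0 => by rintro x rfl; rw [map_zero]; exact zero_mem _
  | p + 1 => by
    intro x hx
    obtain ⟨s, hs, _, ⟨x, rfl⟩, rfl⟩ := Submodule.mem_sup.1 hx
    rw [map_add]
    refine add_mem (Submodule.mem_sup_left (V.d_degen p s hs)) (Submodule.mem_sup_right ?_)
    exact ⟨(V.tensor p).d x, ((V.tensor p).d_one_tmul x).symm⟩

theorem component_barKer (V : DGMod A) : ∀ p, ∀ n, ∀ x ∈ V.barKer p,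
    component (V.tensor p).internal n x ∈ V.barKer p
  | 0 => by rintro n x rfl; rw [map_zero]; exact zero_mem _
  | p + 1 => by
    intro n x hx
    obtain ⟨s, hs, _, ⟨x, rfl⟩, rfl⟩ := Submodule.mem_sup.1 hx
    rw [map_add]
    refine add_mem (Submodule.mem_sup_left (V.homogeneous_degen p n s hs))
      (Submodule.mem_sup_right ?_)
    exact ⟨component (V.tensor p).internal n x, ((V.tensor p).component_one_tmul n x).symm⟩

theorem exists_splitBasis_normalised (V : DGMod A) (p : ℕ) :
    ∃ b : SplitBasis (V.normalised p), ∀ i, ∃ x ∈ (V.tensor p).gr (b.degI i),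
      (V.tensor p).d x ∈ V.barKer p ∧
      b.basis (.inl i) = (V.degen p).mkQ ((V.tensor p).tmul 1 x) ∧
      ∀ y, x - (V.tensor p).d y ∉ V.barKer p :=
  (V.barKer_isFreeSub p).exists_splitBasis (V.component_barKer p) (V.d_barKer p)
    (V.homogeneous_degen p) (V.d_degen p)

/-- If the homology of `V` vanishes in degrees `≤ k`, then that of the quotient of `A^{⊗ p} ⊗ V` by
`barKer p` vanishes in degrees `≤ k + p`. -/
theorem barKer_acyclic (hA : A.IsConnected) (V : DGMod A) {k : ℤ}
    (hV : ∀ n ≤ k, V.homology.gr n = ⊥) : ∀ (p : ℕ) (n : ℤ), n ≤ k + p →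
      ∀ y ∈ (V.tensor p).gr n, (V.tensor p).d y ∈ V.barKer p →
        ∃ z, y - (V.tensor p).d z ∈ V.barKer p
  | 0 => by
    intro n hn (y : V.carrier) hy hdy
    have hdy' : V.d y = 0 := hdy
    have h1 := V.cls_mem (z := ⟨y, hdy'⟩) hy
    rw [hV n (by simpa using hn)] at h1
    obtain ⟨z, hz⟩ := V.cls_eq_zero.1 h1
    have h2 : y - V.d z = 0 := by rw [hz, sub_self]
    exact ⟨z, h2⟩
  | p + 1 => by
    intro n hn
    push_cast at hn
    obtain ⟨b, hb⟩ := V.exists_splitBasis_normalised p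
    exact (V.barKer_isFreeSub p).acyclic_succ hA (V.component_barKer p) (V.homogeneous_degen p)
      (V.d_degen p) b hb (barKer_acyclic hA V hV p) n (by lia)

/-- Split bases of the normalised bar construction, whose cycles have degrees bounded below. -/
theorem exists_splitBasis_degI_ge (hA : A.IsConnected) (V : DGMod A) {k : ℤ}
    (hV : ∀ n ≤ k, V.homology.gr n = ⊥) (p : ℕ) :
    ∃ b : SplitBasis (V.normalised p), ∀ i, k + p + 1 ≤ b.degI i := by
  obtain ⟨b, hb⟩ := V.exists_splitBasis_normalised p
  refine ⟨b, fun i => ?_⟩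
  obtain ⟨x, hx, hdx, -, hnx⟩ := hb i
  by_contra hlt
  obtain ⟨z, hz⟩ := barKer_acyclic hA V hV p (b.degI i) (by lia) x hx hdx
  exact hnx z hz

/-! ### The projective resolution given by the homology of the bar construction -/

/-- The quotient map to the normalised bar construction. -/
noncomputable def barMk (V : DGMod A) (p : ℕ) :
    (V.tensor (p + 1)).carrier →ₗ[A.carrier] (V.normalised p).carrier := (V.degen p).mkQ

theorem barMk_surjective (V : DGMod A) (p : ℕ) : Function.Surjective (V.barMk p) :=
  (V.degen p).mkQ_surjective

theorem barMk_eq_zero (V : DGMod A) {p : ℕ} {x : (V.tensor (p + 1)).carrier} :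
    V.barMk p x = 0 ↔ x ∈ V.degen p := Submodule.Quotient.mk_eq_zero _

/-- The augmentation of the normalised bar construction. -/
noncomputable def barAug (V : DGMod A) : (V.normalised 0).carrier →ₗ[A.carrier] V.carrier :=
  (V.degen 0).liftQ (V.faces 0) (by rintro x rfl; exact zero_mem _)

theorem barDelta_mkQ (V : DGMod A) (p : ℕ) (x : (V.tensor (p + 2)).carrier) :
    V.barDelta p (V.barMk (p + 1) x) = V.barMk p (V.faces (p + 1) x) := rfl

theorem d_mkQ (V : DGMod A) (p : ℕ) (x : (V.tensor (p + 1)).carrier) :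
    (V.normalised p).d (V.barMk p x) = V.barMk p ((V.tensor (p + 1)).d x) := rfl

theorem barAug_d (V : DGMod A) (x : (V.normalised 0).carrier) :
    V.barAug ((V.normalised 0).d x) = V.d (V.barAug x) := by
  obtain ⟨x, rfl⟩ := V.barMk_surjective 0 x
  exact V.faces_d 0 x

theorem barAug_mem (V : DGMod A) (n : ℤ) :
    ∀ x ∈ (V.normalised 0).gr n, V.barAug x ∈ V.gr n := by
  rintro _ ⟨x, hx, rfl⟩
  exact V.faces_mem 0 n x hx

theorem faces_succ_one_tmul (V : DGMod A) (p : ℕ) (x : (V.tensor p).free.carrier) :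
    V.faces (p + 1) ((V.tensor p).free.tmul 1 x) = x - (V.tensor p).tmul 1 (V.faces p x) :=
  ((V.tensor p).facesStep_tmul (V.faces p) 1 x).trans (by rw [one_smul]; rfl)

/-- The contracting homotopy `x ↦ 1 ⊗ x` of the normalised bar construction. -/
noncomputable def barContr (V : DGMod A) (p : ℕ) (x : (V.tensor p).carrier) :
    (V.normalised p).carrier := V.barMk p ((V.tensor p).tmul 1 x)

/-- The contraction preserves degeneracy, so relations that hold only modulo degenerate elements
remain usable after applying it. -/
theorem barContr_eq_zero (V : DGMod A) (p : ℕ) {x : (V.tensor (p + 1)).carrier}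
    (hx : x ∈ V.degen p) : V.barContr (p + 1) x = 0 :=
  (Submodule.Quotient.mk_eq_zero _).2 ((V.tensor p).tmul_mem_degenStep _ 1 hx)

theorem barContr_sub (V : DGMod A) (p : ℕ) (x y : (V.tensor p).carrier) :
    V.barContr p (x - y) = V.barContr p x - V.barContr p y := by
  rw [barContr, map_sub]; exact map_sub _ _ _

theorem d_barContr (V : DGMod A) (p : ℕ) (x : (V.tensor p).carrier) :
    (V.normalised p).d (V.barContr p x) = V.barContr p ((V.tensor p).d x) :=
  (V.d_mkQ p _).trans (congrArg _ ((V.tensor p).d_one_tmul x))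

/-- The first face of `1 ⊗ x` is `x`, and the remaining faces are `1 ⊗` the faces of `x`; this is
the contracting identity. -/
theorem barDelta_barContr (V : DGMod A) (p : ℕ) (x : (V.tensor (p + 1)).carrier) :
    V.barDelta p (V.barContr (p + 1) x) = V.barMk p x - V.barContr p (V.faces p x) :=
  (V.barDelta_mkQ p _).trans ((congrArg _ (V.faces_succ_one_tmul p x)).trans (map_sub _ _ _))

/-- The differential of the homology of the bar construction. -/
noncomputable def homologyDelta (V : DGMod A) (p : ℕ) :
    (V.normalised (p + 1)).homology.carrier →ₗ[A.homology.carrier]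
      (V.normalised p).homology.carrier := homologyLin (V.barDelta p) (V.barDelta_d p)

theorem homologyDelta_cls (V : DGMod A) (p : ℕ)
    (x : (V.normalised (p + 1)).cycles.restrictScalars ℚ)
    (h : V.barDelta p x ∈ (V.normalised p).cycles.restrictScalars ℚ) :
    V.homologyDelta p ((V.normalised (p + 1)).cls x) = (V.normalised p).cls ⟨_, h⟩ :=
  homologyLin_cls _ _ x h

theorem cls_eq_iff (X : DGMod A) {x y : X.cycles.restrictScalars ℚ} :
    X.cls x = X.cls y ↔ ∃ z, X.d z = x - y := by
  rw [← sub_eq_zero, ← map_sub, cls_eq_zero]; rfl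

theorem barDelta_mem_cycles (V : DGMod A) (p : ℕ) {x : (V.normalised (p + 1)).carrier}
    (hx : x ∈ (V.normalised (p + 1)).cycles.restrictScalars ℚ) :
    V.barDelta p x ∈ (V.normalised p).cycles.restrictScalars ℚ := by
  change (V.normalised p).d _ = 0
  rw [← V.barDelta_d, show (V.normalised (p + 1)).d x = 0 from hx, map_zero]

theorem barAug_mem_cycles (V : DGMod A) {x : (V.normalised 0).carrier}
    (hx : x ∈ (V.normalised 0).cycles.restrictScalars ℚ) :
    V.barAug x ∈ V.cycles.restrictScalars ℚ := by
  change V.d _ = 0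
  rw [← V.barAug_d, show (V.normalised 0).d x = 0 from hx, map_zero]

/-- If `x` is a cycle whose image under the augmented differential is homologous to zero, then the
class of `x` is in the image of the differential. -/
theorem exists_homologyDelta_eq (V : DGMod A) (p : ℕ) (x : (V.tensor (p + 1)).carrier)
    (hx : V.barMk p x ∈ (V.normalised p).cycles.restrictScalars ℚ) (y : (V.tensor p).carrier)
    (hy : V.barContr p (V.faces p x) = V.barContr p ((V.tensor p).d y)) :
    ∃ w, V.homologyDelta p w = (V.normalised p).cls ⟨V.barMk p x, hx⟩ := by
  have hw : V.barContr (p + 1) x ∈ (V.normalised (p + 1)).cycles.restrictScalars ℚ := by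
    change (V.normalised (p + 1)).d _ = 0
    rw [d_barContr]
    exact V.barContr_eq_zero p (V.barMk_eq_zero.1 hx)
  -- The preimage is the class of `1 ⊗ x`: its image is `x - 1 ⊗ δ x`, and `1 ⊗ δ x = d (1 ⊗ y)` by
  -- `hy`. The hypothesis `hy` is stated after contraction because for `p ≥ 1` the equation `δ x = d
  -- y` is available only modulo degenerate elements.
  refine ⟨(V.normalised (p + 1)).cls ⟨_, hw⟩, ?_⟩
  rw [homologyDelta_cls _ _ _ (V.barDelta_mem_cycles p hw), cls_eq_iff]
  refine ⟨-V.barContr p y, ?_⟩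
  change _ = V.barDelta p (V.barContr (p + 1) x) - V.barMk p x
  rw [barDelta_barContr, map_neg, d_barContr, hy]
  exact (sub_sub_cancel_left _ _).symm

/-- The homology of the normalised bar construction, as a resolution of `H(V)`. -/
noncomputable def homologyRes (V : DGMod A) (h : ∀ p, (V.normalised p).homology.IsProjective) :
    GrMod.ProjRes V.homology where
  X p := (V.normalised p).homology
  projective := h
  δ := V.homologyDelta
  δ_graded p := homologyLin_graded _ _ (V.barDelta_mem p)
  ε := homologyLin V.barAug V.barAug_d
  ε_graded := homologyLin_graded _ _ V.barAug_mem
  ε_surjective := by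
    intro v
    obtain ⟨v, rfl⟩ := V.cls_surjective v
    have h1 : V.barContr 0 v.1 ∈ (V.normalised 0).cycles.restrictScalars ℚ := by
      change (V.normalised 0).d _ = 0
      refine (V.d_barContr 0 v.1).trans ((congrArg (V.barContr 0) v.2).trans ?_)
      exact (congrArg (V.barMk 0) (map_zero ((V.tensor 0).tmul 1))).trans (map_zero _)
    refine ⟨(V.normalised 0).cls ⟨_, h1⟩, ?_⟩
    rw [homologyLin_cls _ _ _ (V.barAug_mem_cycles h1)]
    congr 1
    exact Subtype.ext (one_smul A.carrier (v : V.carrier))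
  exact_zero := by
    intro x
    obtain ⟨⟨x, hx⟩, rfl⟩ := (V.normalised 0).cls_surjective x
    constructor
    · intro h0
      obtain ⟨x, rfl⟩ := V.barMk_surjective 0 x
      rw [homologyLin_cls _ _ _ (V.barAug_mem_cycles hx)] at h0
      obtain ⟨y, hy⟩ := V.cls_eq_zero.1 h0
      exact V.exists_homologyDelta_eq 0 x hx y (congrArg (V.barContr 0) hy.symm)
    · rintro ⟨w, hw⟩
      obtain ⟨⟨w, hw'⟩, rfl⟩ := (V.normalised 1).cls_surjective w
      rw [← hw, homologyDelta_cls _ _ _ (V.barDelta_mem_cycles 0 hw'),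
        homologyLin_cls _ _ _ (V.barAug_mem_cycles (V.barDelta_mem_cycles 0 hw'))]
      refine V.cls_eq_zero.2 ⟨0, ?_⟩
      obtain ⟨w, rfl⟩ := V.barMk_surjective 1 w
      exact (map_zero _).trans (V.faces_faces 0 w).symm
  exact_succ p := by
    intro x
    obtain ⟨⟨x, hx⟩, rfl⟩ := (V.normalised (p + 1)).cls_surjective x
    constructor
    · intro h0
      obtain ⟨x, rfl⟩ := V.barMk_surjective (p + 1) x
      rw [homologyDelta_cls _ _ _ (V.barDelta_mem_cycles p hx)] at h0
      obtain ⟨y, hy⟩ := (V.normalised p).cls_eq_zero.1 h0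
      obtain ⟨y, rfl⟩ := V.barMk_surjective p y
      refine V.exists_homologyDelta_eq (p + 1) x hx y ?_
      rw [← sub_eq_zero, ← barContr_sub]
      exact V.barContr_eq_zero p ((Submodule.Quotient.eq _).1 hy.symm)
    · rintro ⟨w, hw⟩
      obtain ⟨⟨w, hw'⟩, rfl⟩ := (V.normalised (p + 2)).cls_surjective w
      rw [← hw, homologyDelta_cls _ _ _ (V.barDelta_mem_cycles (p + 1) hw'),
        homologyDelta_cls _ _ _ (V.barDelta_mem_cycles p (V.barDelta_mem_cycles (p + 1) hw'))]
      refine (V.normalised p).cls_eq_zero.2 ⟨0, ?_⟩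
      exact (map_zero _).trans (V.barDelta_barDelta p w).symm

end DGMod

theorem twist_twist {M : Type*} [AddCommGroup M] [Module ℚ M] {𝓜 : ℤ → Submodule ℚ M}
    (h : DirectSum.IsInternal 𝓜) (q : ℤ) (x : M) : twist h q (twist h q x) = x := by
  induction x using graded_induction h with
  | mem n y hy =>
    rw [twist_of_mem h q hy, map_smul, twist_of_mem h q hy, smul_smul, neg_one_zpow_mul_self,
      one_smul]
  | zero => simp only [map_zero]
  | add y z hy hz => simp only [map_add, hy, hz]

namespace DGMod

variable {A : DGAlg.{u}}

/-! ### Additivity of the maps induced on homology -/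

section homologyMap

variable {X Y W : DGMod A} {q : ℤ}

theorem homologyMap_congr {f g : X.carrier →ₗ[ℚ] W.carrier} (e : f = g) (hf : X.homD W q f = 0) :
    homologyMap q f hf = homologyMap q g (e ▸ hf) := by
  subst e; rfl

theorem homologyMap_add {f g : X.carrier →ₗ[ℚ] W.carrier} (hf : X.homD W q f = 0)
    (hg : X.homD W q g = 0) (h : X.homD W q (f + g) = 0) :
    homologyMap q (f + g) h = homologyMap q f hf + homologyMap q g hg := by
  ext x
  obtain ⟨x, rfl⟩ := X.cls_surjective x
  rw [LinearMap.add_apply, homologyMap_cls h x (map_mem_cycles h x.2),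
    homologyMap_cls hf x (map_mem_cycles hf x.2), homologyMap_cls hg x (map_mem_cycles hg x.2),
    ← map_add]
  rfl

theorem homologyMap_smul {f : X.carrier →ₗ[ℚ] W.carrier} (hf : X.homD W q f = 0) (c : ℚ)
    (h : X.homD W q (c • f) = 0) : homologyMap q (c • f) h = c • homologyMap q f hf := by
  ext x
  obtain ⟨x, rfl⟩ := X.cls_surjective x
  rw [LinearMap.smul_apply, homologyMap_cls h x (map_mem_cycles h x.2),
    homologyMap_cls hf x (map_mem_cycles hf x.2), ← map_smul]
  rfl

theorem homologyMap_eq_of_homD {f f' g : X.carrier →ₗ[ℚ] W.carrier} (hf : X.homD W q f = 0)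
    (hf' : X.homD W q f' = 0) (h : X.homD W (q + 1) g = f - f') :
    homologyMap q f hf = homologyMap q f' hf' := by
  ext x
  obtain ⟨x, rfl⟩ := X.cls_surjective x
  rw [homologyMap_cls hf x (map_mem_cycles hf x.2), homologyMap_cls hf' x (map_mem_cycles hf' x.2),
    cls_eq_iff]
  refine ⟨g x, ?_⟩
  have := LinearMap.congr_fun h x
  rwa [homD_apply, show X.d x = 0 from x.2, map_zero, smul_zero, sub_zero] at this

theorem homologyMap_comp {g : Y.carrier →ₗ[ℚ] W.carrier} (hg : Y.homD W q g = 0)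
    (δ : X.carrier →ₗ[A.carrier] Y.carrier) (hδ : ∀ x, δ (X.d x) = Y.d (δ x))
    (h : X.homD W q (g ∘ₗ δ.restrictScalars ℚ) = 0) :
    homologyMap q (g ∘ₗ δ.restrictScalars ℚ) h =
      homologyMap q g hg ∘ₗ (homologyLin δ hδ).restrictScalars ℚ := by
  ext x
  obtain ⟨x, rfl⟩ := X.cls_surjective x
  have hx : δ x ∈ Y.cycles.restrictScalars ℚ := by
    change Y.d (δ x) = 0
    rw [← hδ, show X.d x = 0 from x.2, map_zero]
  refine (homologyMap_cls h x (map_mem_cycles h x.2)).trans ?_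
  change _ = homologyMap q g hg (homologyLin δ hδ (X.cls x))
  rw [homologyLin_cls δ hδ x hx, homologyMap_cls hg ⟨_, hx⟩ (map_mem_cycles hg hx)]
  rfl

theorem homD_comp (g : Y.carrier →ₗ[ℚ] W.carrier) (δ : X.carrier →ₗ[A.carrier] Y.carrier)
    (hδ : ∀ x, δ (X.d x) = Y.d (δ x)) :
    X.homD W q (g ∘ₗ δ.restrictScalars ℚ) = Y.homD W q g ∘ₗ δ.restrictScalars ℚ := by
  ext x
  change W.d (g (δ x)) - (-1 : ℚ) ^ q • g (δ (X.d x)) =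
    W.d (g (δ x)) - (-1 : ℚ) ^ q • g (Y.d (δ x))
  rw [hδ]

end homologyMap

/-! ### The components of maps out of the bar resolution -/

section Components

variable (V W : DGMod A)

/-- The inclusion of the part of simplicial degree `p`. -/
noncomputable def barInc (p : ℕ) : (V.normalised p).carrier →ₗ[ℚ] V.bar.carrier :=
  DirectSum.lof ℚ ℕ (fun p => (V.normalised p).carrier) p

/-- The component of simplicial degree `p` of a map out of the bar resolution, with the signs that
make it a homogeneous map. -/
noncomputable def part (p : ℕ) :
    (V.bar.carrier →ₗ[ℚ] W.carrier) →ₗ[ℚ] ((V.normalised p).carrier →ₗ[ℚ] W.carrier) :=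
  LinearMap.lcomp ℚ W.carrier (V.barInc p ∘ₗ twist (V.normalised p).internal p)

variable {V W}

theorem part_apply (p : ℕ) (f : V.bar.carrier →ₗ[ℚ] W.carrier) (x : (V.normalised p).carrier) :
    part V W p f x = f (V.barInc p (twist (V.normalised p).internal p x)) := rfl

theorem apply_barInc (p : ℕ) (f : V.bar.carrier →ₗ[ℚ] W.carrier) (x : (V.normalised p).carrier) :
    f (V.barInc p x) = part V W p f (twist (V.normalised p).internal p x) := by
  rw [part_apply, twist_twist]

theorem barInc_mem (p : ℕ) {i : ℤ} {x : (V.normalised p).carrier} (hx : x ∈ (V.normalised p).gr i) :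
    V.barInc p x ∈ V.bar.gr (i + p) := lof_mem_totalGr V.normalised p rfl hx

theorem smul_barInc (a : A.carrier) (p : ℕ) (x : (V.normalised p).carrier) :
    a • V.barInc p x = V.barInc p (a • x) := smul_lof V.normalised a p x

/-- The shift by `p` raises the degree of a restriction from `n` to `n + p`, but `A` acts on the
shifted summand without a sign. The twist supplies the missing factor `(-1) ^ (p |a|)`. -/
theorem part_mem {n : ℤ} {f : V.bar.carrier →ₗ[ℚ] W.carrier} (hf : f ∈ V.bar.homGr W.toGrMod n)
    (p : ℕ) : part V W p f ∈ (V.normalised p).homGr W.toGrMod (n + p) := by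
  refine ⟨fun i x hx => ?_, fun i a ha x => ?_⟩
  · rw [part_apply, twist_of_mem _ _ hx, map_smul, map_smul]
    have := hf.1 _ _ (barInc_mem p hx)
    rw [show i + p + n = i + (n + p) by ring] at this
    exact Submodule.smul_mem _ _ this
  · rw [part_apply, GrMod.twist_smul, twist_of_mem _ _ ha, smul_assoc, map_smul, map_smul,
      ← smul_barInc, hf.2 i a ha, smul_smul, ← part_apply, ← zpow_add₀ (by norm_num)]
    ring_nf

theorem mem_fil_iff {m : ℤ} {f : V.bar.carrier →ₗ[ℚ] W.carrier} :
    f ∈ (V.barHom W).fil m ↔ ∀ p : ℕ, (p : ℤ) < m → part V W p f = 0 := by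
  constructor
  · intro h p hp
    ext x
    exact h _ (lof_mem_totalSkeleton V.normalised (by lia) _)
  · intro h b hb
    refine Submodule.iSup_induction _ (motive := fun b => f b = 0) hb ?_ (map_zero f) ?_
    · intro j b hb
      by_cases hj : (j : ℤ) ≤ m - 1
      · rw [iSup_pos hj] at hb
        obtain ⟨x, rfl⟩ := hb
        refine (apply_barInc j f x).trans ?_
        rw [h j (by lia)]; rfl
      · rw [iSup_neg hj] at hb
        obtain rfl : b = 0 := hb
        exact map_zero f
    · intro s t hs ht
      exact (map_add f s t).trans (by rw [hs, ht, add_zero])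

theorem eq_of_part_eq {f g : V.bar.carrier →ₗ[ℚ] W.carrier}
    (h : ∀ p, part V W p f = part V W p g) : f = g := by
  ext x
  refine total_induction V.normalised (P := fun x => f x = g x) (fun p x => ?_) ?_ ?_ x
  · exact (apply_barInc p f x).trans ((LinearMap.congr_fun (h p) _).trans
      (apply_barInc p g x).symm)
  · exact (map_zero f).trans (map_zero g).symm
  · intro s t hs ht
    exact (map_add f s t).trans ((congrArg₂ _ hs ht).trans (map_add g s t).symm)

/-- A map out of a direct sum is an arbitrary family of maps, so the Hom complex is a product over
simplicial degrees. This is why infinitely many components can be prescribed independently. -/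
theorem exists_part_eq {n : ℤ} (g : ∀ p, (V.normalised p).carrier →ₗ[ℚ] W.carrier)
    (hg : ∀ p, g p ∈ (V.normalised p).homGr W.toGrMod (n + p)) :
    ∃ f ∈ V.bar.homGr W.toGrMod n, ∀ p, part V W p f = g p := by
  let f : V.bar.carrier →ₗ[ℚ] W.carrier := DirectSum.toModule ℚ ℕ W.carrier fun p =>
    g p ∘ₗ twist (V.normalised p).internal p
  have hf : ∀ p x, f (V.barInc p x) = g p (twist (V.normalised p).internal p x) := fun p x =>
    DirectSum.toModule_lof ℚ (φ := fun p => g p ∘ₗ twist (V.normalised p).internal p) p x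
  refine ⟨f, ⟨fun i x hx => ?_, fun i a ha x => ?_⟩, fun p => ?_⟩
  · refine totalGr_induction V.normalised (P := fun x => f x ∈ W.gr (i + n)) ?_ ?_ ?_ x hx
    · rintro p m rfl x hx
      refine (hf p x).symm ▸ ?_
      rw [twist_of_mem _ _ hx, map_smul]
      have := (hg p).1 m x hx
      rw [show m + (n + p) = m + p + n by ring] at this
      exact Submodule.smul_mem _ _ this
    · exact (map_zero f).symm ▸ zero_mem _
    · intro s t hs ht
      exact (map_add f s t).symm ▸ add_mem hs ht
  · refine total_induction V.normalised
      (P := fun x : V.bar.carrier => f (a • x) = (-1 : ℚ) ^ (n * i) • a • f x) ?_ ?_ ?_ x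
    · intro p x
      change f (a • V.barInc p x) = _ • a • f (V.barInc p x)
      rw [smul_barInc, hf, hf, GrMod.twist_smul, twist_of_mem _ _ ha, smul_assoc, map_smul,
        (hg p).2 i a ha, smul_smul, ← zpow_add₀ (by norm_num),
        show (p : ℤ) * i + (n + p) * i = n * i + (p * i + p * i) by ring,
        zpow_add₀ (by norm_num), zpow_add₀ (by norm_num : (-1 : ℚ) ≠ 0) (p * i),
        neg_one_zpow_mul_self, mul_one]
    · change f (a • (0 : V.bar.carrier)) = (-1 : ℚ) ^ (n * i) • a • f (0 : V.bar.carrier)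
      rw [smul_zero, map_zero f, smul_zero, smul_zero]
    · intro (s : V.bar.carrier) (t : V.bar.carrier) hs ht
      change f (a • (s + t : V.bar.carrier)) = (-1 : ℚ) ^ (n * i) • a • f (s + t : V.bar.carrier)
      rw [smul_add, map_add, map_add, hs, ht, smul_add, smul_add]
  · ext x
    rw [part_apply, hf, twist_twist]

theorem exists_part_single {n : ℤ} (p : ℕ) {g : (V.normalised p).carrier →ₗ[ℚ] W.carrier}
    (hg : g ∈ (V.normalised p).homGr W.toGrMod (n + p)) :
    ∃ f ∈ V.bar.homGr W.toGrMod n, part V W p f = g ∧ ∀ j ≠ p, part V W j f = 0 := by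
  obtain ⟨f, hf, e⟩ := exists_part_eq (n := n)
    (Pi.single (M := fun p => (V.normalised p).carrier →ₗ[ℚ] W.carrier) p g) fun j => by
      by_cases hj : j = p
      · subst hj; rwa [Pi.single_eq_same]
      · rw [Pi.single_eq_of_ne hj]; exact zero_mem _
  exact ⟨f, hf, by rw [e, Pi.single_eq_same], fun j hj => by rw [e, Pi.single_eq_of_ne hj]⟩

variable (V W) in
/-- The composition of the component of simplicial degree `p - 1` with the simplicial
differential. -/
noncomputable def prevPart : ∀ (p : ℕ), (V.bar.carrier →ₗ[ℚ] W.carrier) →ₗ[ℚ]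
    ((V.normalised p).carrier →ₗ[ℚ] W.carrier)
  | 0 => 0
  | p + 1 => LinearMap.lcomp ℚ W.carrier ((V.barDelta p).restrictScalars ℚ) ∘ₗ part V W p

theorem prevPart_succ (p : ℕ) (f : V.bar.carrier →ₗ[ℚ] W.carrier) :
    prevPart V W (p + 1) f = part V W p f ∘ₗ (V.barDelta p).restrictScalars ℚ := rfl

theorem prevPart_eq_zero {m : ℤ} {f : V.bar.carrier →ₗ[ℚ] W.carrier}
    (hf : f ∈ (V.barHom W).fil m) {p : ℕ} (hp : (p : ℤ) ≤ m) : prevPart V W p f = 0 := by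
  cases p with
  | zero => rfl
  | succ p =>
    rw [prevPart_succ, mem_fil_iff.1 hf p (by push_cast at hp; lia), LinearMap.zero_comp]

theorem bar_d_zero (x : (V.normalised 0).carrier) :
    V.bar.d (V.barInc 0 x) = V.barInc 0 ((V.normalised 0).d x) :=
  totalD_zero V.normalised V.barDelta x

theorem bar_d_succ (p : ℕ) (x : (V.normalised (p + 1)).carrier) :
    V.bar.d (V.barInc (p + 1) x) = V.barInc (p + 1) ((V.normalised (p + 1)).d x) +
      V.barInc p (V.barDelta p (parity (V.normalised (p + 1)).internal x)) :=
  totalD_succ V.normalised V.barDelta p x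

/-- In components the Hom complex is a double complex, whose differentials are the internal one and
composition with `barDelta`. The signs of the total differential cancel against the twists, up to
the factor `(-1) ^ n`. -/
theorem part_homD (n : ℤ) (f : V.bar.carrier →ₗ[ℚ] W.carrier) (p : ℕ) :
    part V W p (V.bar.homD W n f) =
      (V.normalised p).homD W (n + p) (part V W p f) - (-1 : ℚ) ^ n • prevPart V W p f := by
  have hn : (-1 : ℚ) ≠ 0 := by norm_num
  refine eq_of_forall_mem (V.normalised p).internal fun i x hx => ?_
  cases p with
  | zero =>
    rw [part_apply, homD_apply, LinearMap.sub_apply, homD_apply, part_apply, part_apply]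
    simp only [Nat.cast_zero, twist_zero, add_zero, bar_d_zero]
    rw [show prevPart V W 0 f = 0 from rfl, smul_zero, LinearMap.zero_apply, sub_zero]
  | succ p =>
    have hdx := (V.normalised (p + 1)).d_mem hx
    have hδ := V.barDelta_mem p i x hx
    rw [part_apply, homD_apply, LinearMap.sub_apply, homD_apply, part_apply, part_apply,
      LinearMap.smul_apply, prevPart_succ, LinearMap.comp_apply, LinearMap.restrictScalars_apply,
      part_apply, twist_of_mem _ _ hx, twist_of_mem _ _ hdx, twist_of_mem _ _ hδ]
    simp only [map_smul, bar_d_succ, parity_of_mem _ hx, map_add, smul_add, smul_smul,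
      LinearMap.map_smul_of_tower]
    rw [sub_sub]
    congr 2
    · congr 1
      rw [← zpow_add₀ hn, ← zpow_add₀ hn,
        show n + ((p + 1 : ℕ) : ℤ) + ((p + 1 : ℕ) : ℤ) * (i - 1) =
          n + ((p + 1 : ℕ) : ℤ) * i by ring]
    · congr 1
      rw [← zpow_add₀ hn, ← zpow_add₀ hn, ← zpow_add₀ hn]
      push_cast
      rw [show n + (((p : ℤ) + 1) * i + i) = n + p * i + (i + i) by ring, zpow_add₀ hn (n + p * i),
        zpow_add₀ hn i, neg_one_zpow_mul_self, mul_one]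

end Components

end DGMod

namespace DGMod

variable {A : DGAlg.{u}} {V W : DGMod A}

/-! ### The second page -/

theorem mem_fil_of_nonpos {p : ℤ} (hp : p ≤ 0) (x : (V.barHom W).carrier) :
    x ∈ (V.barHom W).fil p := mem_fil_iff.2 fun j hj => by lia

theorem mem_fil_succ {p : ℕ} {f : V.bar.carrier →ₗ[ℚ] W.carrier} (hf : f ∈ (V.barHom W).fil p)
    (h : part V W p f = 0) : f ∈ (V.barHom W).fil (p + 1) := by
  refine mem_fil_iff.2 fun j hj => ?_
  obtain hj | rfl : j < p ∨ j = p := by lia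
  · exact mem_fil_iff.1 hf j (by exact_mod_cast hj)
  · exact h

theorem part_zero_homD (n : ℤ) (f : V.bar.carrier →ₗ[ℚ] W.carrier) :
    part V W 0 (V.bar.homD W n f) = (V.normalised 0).homD W n (part V W 0 f) := by
  rw [part_homD, Nat.cast_zero, add_zero, show prevPart V W 0 f = 0 from rfl, smul_zero, sub_zero]

theorem part_succ_homD (n : ℤ) (f : V.bar.carrier →ₗ[ℚ] W.carrier) (p : ℕ) :
    part V W (p + 1) (V.bar.homD W n f) =
      (V.normalised (p + 1)).homD W (n + p + 1) (part V W (p + 1) f) -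
        (-1 : ℚ) ^ n • part V W p f ∘ₗ (V.barDelta p).restrictScalars ℚ := by
  rw [part_homD, prevPart_succ, Nat.cast_succ, add_assoc]

theorem part_homD_of_mem_fil {n : ℤ} {f : V.bar.carrier →ₗ[ℚ] W.carrier} {p : ℕ}
    (hf : f ∈ (V.barHom W).fil p) :
    part V W p (V.bar.homD W n f) = (V.normalised p).homD W (n + p) (part V W p f) := by
  rw [part_homD, prevPart_eq_zero hf le_rfl, smul_zero, sub_zero]

theorem exists_part_eq_pair {n : ℤ} (p : ℕ) {g : (V.normalised p).carrier →ₗ[ℚ] W.carrier}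
    (hg : g ∈ (V.normalised p).homGr W.toGrMod (n + p))
    {g' : (V.normalised (p + 1)).carrier →ₗ[ℚ] W.carrier}
    (hg' : g' ∈ (V.normalised (p + 1)).homGr W.toGrMod (n + p + 1)) :
    ∃ f ∈ V.bar.homGr W.toGrMod n, f ∈ (V.barHom W).fil p ∧ part V W p f = g ∧
      part V W (p + 1) f = g' := by
  obtain ⟨f, hf, e, h⟩ := exists_part_single p hg
  obtain ⟨f', hf', e', h'⟩ := exists_part_single (n := n) (p + 1) (g := g')
    (by rwa [Nat.cast_succ, ← add_assoc])
  refine ⟨f + f', add_mem hf hf', mem_fil_iff.2 fun j hj => ?_, ?_, ?_⟩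
  · rw [map_add, h j (by lia), h' j (by lia), add_zero]
  · rw [map_add, e, h' p (by lia), add_zero]
  · rw [map_add, e', h (p + 1) (by lia), zero_add]

theorem homD_part {n : ℤ} {p : ℕ} {r : ℤ} (hr : 1 ≤ r) {z : V.bar.carrier →ₗ[ℚ] W.carrier}
    (hz : z ∈ (V.barHom W).pageCycles r p n) :
    (V.normalised p).homD W (n + p) (part V W p z) = 0 := by
  have hz := (V.barHom W).mem_pageCycles.1 hz
  rw [← part_homD_of_mem_fil hz.2.1]
  exact mem_fil_iff.1 hz.2.2 p (by lia)

/-- The map on homology induced by the leading component of a cycle of the second page. -/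
noncomputable def leading {p : ℕ} {n : ℤ} {z : V.bar.carrier →ₗ[ℚ] W.carrier}
    (hz : z ∈ (V.barHom W).pageCycles 2 p n) :
    (V.normalised p).homology.carrier →ₗ[ℚ] W.homology.carrier :=
  homologyMap (n + p) (part V W p z) (homD_part one_le_two hz)

theorem leading_mem {p : ℕ} {n : ℤ} {z : V.bar.carrier →ₗ[ℚ] W.carrier}
    (hz : z ∈ (V.barHom W).pageCycles 2 p n) :
    leading hz ∈ (V.normalised p).homology.homGr W.homology (n + p) :=
  homologyMap_mem _ (part_mem ((V.barHom W).mem_pageCycles.1 hz).1 p)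

theorem homD_comp_barDelta {p : ℕ} {q : ℤ} {g : (V.normalised p).carrier →ₗ[ℚ] W.carrier}
    (hg : (V.normalised p).homD W q g = 0) :
    (V.normalised (p + 1)).homD W q (g ∘ₗ (V.barDelta p).restrictScalars ℚ) = 0 := by
  rw [homD_comp g _ (V.barDelta_d p), hg, LinearMap.zero_comp]

theorem barDelta_homGr {p : ℕ} {q : ℤ} {g : (V.normalised p).carrier →ₗ[ℚ] W.carrier}
    (hg : g ∈ (V.normalised p).homGr W.toGrMod q) :
    g ∘ₗ (V.barDelta p).restrictScalars ℚ ∈ (V.normalised (p + 1)).homGr W.toGrMod q :=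
  GrMod.homGr_comp hg (V.barDelta_mem p)

/-- Let `z_j` be the component of `z` in simplicial degree `j`. That component `p + 1` of `d z`
vanishes means that `z_p ∘ δ` is, up to sign, the coboundary of `z_{p+1}`. -/
theorem leading_comp_homologyDelta {p : ℕ} {n : ℤ} {z : V.bar.carrier →ₗ[ℚ] W.carrier}
    (hz : z ∈ (V.barHom W).pageCycles 2 p n) :
    leading hz ∘ₗ (V.homologyDelta p).restrictScalars ℚ = 0 := by
  have h := mem_fil_iff.1 ((V.barHom W).mem_pageCycles.1 hz).2.2 (p + 1) (by push_cast; lia)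
  refine (homologyMap_comp (homD_part one_le_two hz) (V.barDelta p) (V.barDelta_d p)
    (homD_comp_barDelta (homD_part one_le_two hz))).symm.trans ?_
  refine homologyMap_eq_zero_of_homD (g := (-1 : ℚ) ^ n • part V W (p + 1) z) _ ?_
  have h := (part_succ_homD n z p).symm.trans h
  rw [map_smul, sub_eq_zero.1 h, smul_smul, neg_one_zpow_mul_self, one_smul]

/-- Represent `φ` by a cocycle `g`. As `φ ∘ δ = 0`, the cocycle `g ∘ δ` has a primitive `g'`. The
map with components `g` and `(-1) ^ n g'` in simplicial degrees `p` and `p + 1` works: the second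
component cancels the contribution of `g ∘ δ` to component `p + 1` of the differential. -/
theorem exists_leading_eq (b : ∀ p, SplitBasis (V.normalised p)) (p : ℕ) (n : ℤ)
    {φ : (V.normalised p).homology.carrier →ₗ[ℚ] W.homology.carrier}
    (hφ : φ ∈ (V.normalised p).homology.homGr W.homology (n + p))
    (hφ' : φ ∘ₗ (V.homologyDelta p).restrictScalars ℚ = 0) :
    ∃ (z : V.bar.carrier →ₗ[ℚ] W.carrier) (hz : z ∈ (V.barHom W).pageCycles 2 p n),
      leading hz = φ := by
  obtain ⟨g, hg, hdg, e⟩ := (b p).exists_homologyMap_eq hφ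
  obtain ⟨g', hg', e'⟩ := (b (p + 1)).exists_of_homologyMap_eq_zero (barDelta_homGr hg)
    (homD_comp_barDelta hdg) (by
      rw [homologyMap_comp hdg _ (V.barDelta_d p), e]; exact hφ')
  obtain ⟨f, hf, hfil, rfl, e2⟩ := exists_part_eq_pair p hg
    (Submodule.smul_mem _ ((-1 : ℚ) ^ n) hg')
  have h1 : V.bar.homD W n f ∈ (V.barHom W).fil p := (V.barHom W).d_fil hf hfil
  have h2 := mem_fil_succ h1 (by rw [part_homD_of_mem_fil hfil, hdg])
  have h3 := mem_fil_succ (p := p + 1) (by exact_mod_cast h2)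
    (by rw [part_succ_homD, e2, map_smul, e', sub_self])
  exact ⟨f, (V.barHom W).mem_pageCycles.2
    ⟨hf, hfil, (V.barHom W).fil_antitone (by push_cast; lia) h3⟩, e⟩

/-- That `d u` lies in `F^p` need not be assumed: it differs from `z` by an element of `F^{p+1}`. -/
theorem mem_pageBoundaries_of_sub {p n : ℤ} {z u : V.bar.carrier →ₗ[ℚ] W.carrier}
    (hz : z ∈ (V.barHom W).pageCycles 2 p n) (hu : u ∈ (V.barHom W).gr (n + 1))
    (hu' : u ∈ (V.barHom W).fil (p - 1))
    (h : z - V.bar.homD W (n + 1) u ∈ (V.barHom W).fil (p + 1)) :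
    z ∈ (V.barHom W).pageBoundaries 2 p n := by
  have hz := (V.barHom W).mem_pageCycles.1 hz
  have hdu : V.bar.homD W (n + 1) u ∈ V.bar.homGr W.toGrMod n := by
    have := V.bar.homD_mem W hu
    rwa [add_sub_cancel_right] at this
  have hdd : V.bar.homD W n (V.bar.homD W (n + 1) u) = 0 := by
    have := V.bar.homD_homD W (n + 1) u
    rwa [add_sub_cancel_right] at this
  have hdz : V.bar.homD W n z ∈ (V.barHom W).fil (p + 2) := hz.2.2
  refine (V.barHom W).mem_pageBoundaries.2 ⟨z - V.bar.homD W (n + 1) u,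
    (V.barHom W).mem_pageCycles.2 ⟨sub_mem hz.1 hdu, h, ?_⟩, u,
    (V.barHom W).mem_pageCycles.2 ⟨hu, (V.barHom W).fil_antitone (by lia) hu', ?_⟩,
    sub_add_cancel z _⟩
  · change V.bar.homD W n (z - V.bar.homD W (n + 1) u) ∈ _
    rw [map_sub, hdd, sub_zero]
    exact (V.barHom W).fil_antitone (by lia) hdz
  · have h1 : z - (z - V.bar.homD W (n + 1) u) ∈ (V.barHom W).fil p :=
      sub_mem hz.2.1 ((V.barHom W).fil_antitone (by lia) h)
    rw [sub_sub_cancel] at h1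
    exact (V.barHom W).fil_antitone (by lia) h1

theorem exists_sub_mem_fil {p n : ℤ} {z : V.bar.carrier →ₗ[ℚ] W.carrier}
    (hz : z ∈ (V.barHom W).pageBoundaries 2 p n) :
    ∃ u ∈ V.bar.homGr W.toGrMod (n + 1), u ∈ (V.barHom W).fil (p - 1) ∧
      V.bar.homD W (n + 1) u ∈ (V.barHom W).fil p ∧
      z - V.bar.homD W (n + 1) u ∈ (V.barHom W).fil (p + 1) := by
  obtain ⟨a, ha, u, hu, e⟩ := (V.barHom W).mem_pageBoundaries.1 hz
  have ha := (V.barHom W).mem_pageCycles.1 ha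
  have hu := (V.barHom W).mem_pageCycles.1 hu
  refine ⟨u, hu.1, (V.barHom W).fil_antitone (by lia) hu.2.1,
    (V.barHom W).fil_antitone (by lia) hu.2.2, ?_⟩
  have e' : z - V.bar.homD W (n + 1) u = a := sub_eq_of_eq_add e.symm
  rw [e']
  exact ha.2.1

variable (h : ∀ p, (V.normalised p).homology.IsProjective)

/-- Take `u` in `F^{p-1}` with `d u` in `F^p` and `z - d u` in `F^{p+1}`. Comparing components in
simplicial degree `p` gives `z_p = d u_p ± u_{p-1} ∘ δ`, and `u_{p-1}` is a cocycle. On homology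
only `± u_{p-1} ∘ δ` remains, and for `p = 0` nothing remains. -/
theorem leading_mem_coboundaries {p : ℕ} {n : ℤ} {z : V.bar.carrier →ₗ[ℚ] W.carrier}
    (hz : z ∈ (V.barHom W).pageCycles 2 p n) (hz' : z ∈ (V.barHom W).pageBoundaries 2 p n) :
    leading hz ∈ (V.homologyRes h).coboundaries W.homology p (n + p) := by
  obtain ⟨u, hu, hu1, hu2, hu3⟩ := exists_sub_mem_fil hz'
  have e := mem_fil_iff.1 hu3 p (by lia)
  rw [map_sub, sub_eq_zero] at e
  cases p with
  | zero =>
    refine (homologyMap_eq_zero_of_homD (g := part V W 0 u) _ ?_ : _ = (0 : _ →ₗ[ℚ] _))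
    rw [e, part_zero_homD, Nat.cast_zero, add_zero]
  | succ p =>
    have hup : u ∈ (V.barHom W).fil p := (V.barHom W).fil_antitone (by push_cast; lia) hu1
    have h0 : (V.normalised p).homD W (n + 1 + p) (part V W p u) = 0 := by
      rw [← part_homD_of_mem_fil hup]
      exact mem_fil_iff.1 hu2 p (by push_cast; lia)
    have hpu := part_mem hu p
    have e1 : n + 1 + p = n + ((p + 1 : ℕ) : ℤ) := by push_cast; ring
    rw [part_succ_homD, e1] at e
    rw [e1] at h0 hpu
    have h0' : (V.normalised p).homD W (n + (p + 1 : ℕ))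
        (-(-1 : ℚ) ^ (n + 1) • part V W p u) = 0 := by
      rw [map_smul, h0, smul_zero]
    refine ⟨homologyMap _ _ h0', homologyMap_mem _ (Submodule.smul_mem _ _ hpu), ?_⟩
    refine (homologyMap_comp h0' (V.barDelta p) (V.barDelta_d p)
      (homD_comp_barDelta h0')).symm.trans ?_
    refine (homologyMap_eq_of_homD (homD_part one_le_two hz) (homD_comp_barDelta h0')
      (g := part V W (p + 1) u) ?_).symm
    rw [e, neg_smul, LinearMap.neg_comp, LinearMap.smul_comp, sub_neg_eq_add, sub_add_cancel]

/-- In positive simplicial degree, lift `-ψ` to a cocycle `g`, where `ψ ∘ δ` is the leading map.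
Then the leading component of `z` plus `g ∘ δ` induces zero on homology and so has a primitive `g'`.
The map `u` with components `(-1) ^ (n + 1) g` and `g'` agrees with `z` after differentiation, up to
one filtration step higher. -/
theorem mem_pageBoundaries_of_leading (b : ∀ p, SplitBasis (V.normalised p)) {p : ℕ} {n : ℤ}
    {z : V.bar.carrier →ₗ[ℚ] W.carrier} (hz : z ∈ (V.barHom W).pageCycles 2 p n)
    (hz' : leading hz ∈ (V.homologyRes h).coboundaries W.homology p (n + p)) :
    z ∈ (V.barHom W).pageBoundaries 2 p n := by
  have hzp := (V.barHom W).mem_pageCycles.1 hz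
  cases p with
  | zero =>
    obtain ⟨g, hg, e⟩ := (b 0).exists_of_homologyMap_eq_zero (part_mem hzp.1 0)
      (homD_part one_le_two hz) hz'
    simp only [Nat.cast_zero, add_zero] at hg e
    obtain ⟨u, hu, hpu, -⟩ := exists_part_single (n := n + 1) 0 (g := g) (by simpa using hg)
    refine mem_pageBoundaries_of_sub hz hu (mem_fil_of_nonpos (by simp) u) ?_
    refine mem_fil_succ (mem_fil_of_nonpos (by simp) _) ?_
    rw [map_sub, part_zero_homD, hpu, e, sub_self]
  | succ p =>
    obtain ⟨ψ, hψ, e⟩ := hz'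
    obtain ⟨g, hg, hdg, e'⟩ := (b p).exists_homologyMap_eq (neg_mem hψ)
    have hz0 := homD_part one_le_two hz
    have hd : (V.normalised (p + 1)).homD W (n + (p + 1 : ℕ))
        (part V W (p + 1) z + g ∘ₗ (V.barDelta p).restrictScalars ℚ) = 0 := by
      rw [map_add, hz0, homD_comp_barDelta hdg, add_zero]
    have hd0 : homologyMap _ _ hd = 0 := by
      rw [homologyMap_add hz0 (homD_comp_barDelta hdg), homologyMap_comp hdg _ (V.barDelta_d p),
        e']
      exact add_eq_zero_iff_eq_neg.2 (e.symm.trans (neg_neg _).symm)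
    obtain ⟨g', hg', e''⟩ := (b (p + 1)).exists_of_homologyMap_eq_zero
      (add_mem (part_mem hzp.1 (p + 1)) (barDelta_homGr hg)) hd hd0
    have e1 : n + ((p + 1 : ℕ) : ℤ) = n + 1 + p := by push_cast; ring
    rw [e1] at hg hg' e'' hdg
    obtain ⟨u, hu, hfil, hu1, hu2⟩ := exists_part_eq_pair (n := n + 1) p
      (Submodule.smul_mem _ ((-1 : ℚ) ^ (n + 1)) hg) hg'
    refine mem_pageBoundaries_of_sub hz hu (by simpa using hfil) ?_
    have h1 : V.bar.homD W (n + 1) u ∈ (V.barHom W).fil p := (V.barHom W).d_fil hu hfil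
    have h2 := mem_fil_succ h1 (by rw [part_homD_of_mem_fil hfil, hu1, map_smul, hdg, smul_zero])
    refine mem_fil_succ (sub_mem hzp.2.1 (by exact_mod_cast h2)) ?_
    rw [map_sub, part_succ_homD, hu1, hu2, e'', LinearMap.smul_comp, smul_smul,
      neg_one_zpow_mul_self, one_smul, add_sub_cancel_right, sub_self]

theorem leading_mem_cocycles {p : ℕ} {n : ℤ} {z : V.bar.carrier →ₗ[ℚ] W.carrier}
    (hz : z ∈ (V.barHom W).pageCycles 2 p n) :
    leading hz ∈ (V.homologyRes h).cocycles W.homology p (n + p) :=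
  ⟨leading_mem hz, leading_comp_homologyDelta hz⟩

theorem leading_add {p : ℕ} {n : ℤ} {z z' : V.bar.carrier →ₗ[ℚ] W.carrier}
    (hz : z ∈ (V.barHom W).pageCycles 2 p n) (hz' : z' ∈ (V.barHom W).pageCycles 2 p n)
    (h : z + z' ∈ (V.barHom W).pageCycles 2 p n) : leading h = leading hz + leading hz' := by
  have e : part V W p (z + z') = part V W p z + part V W p z' := map_add _ _ _
  exact (homologyMap_congr e (homD_part one_le_two h)).trans
    (homologyMap_add (homD_part one_le_two hz) (homD_part one_le_two hz') _)

theorem leading_smul {p : ℕ} {n : ℤ} {z : V.bar.carrier →ₗ[ℚ] W.carrier}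
    (hz : z ∈ (V.barHom W).pageCycles 2 p n) (c : ℚ)
    (h : c • z ∈ (V.barHom W).pageCycles 2 p n) : leading h = c • leading hz := by
  have e : part V W p (c • z) = c • part V W p z := map_smul _ _ _
  exact (homologyMap_congr e (homD_part one_le_two h)).trans
    (homologyMap_smul (homD_part one_le_two hz) c _)

variable (V W) in
/-- The map induced on homology by the leading component, as a linear map. -/
noncomputable def leadingMap (p : ℕ) (n : ℤ) : (V.barHom W).pageCycles 2 p n →ₗ[ℚ]
    (V.homologyRes h).cocycles W.homology p (n + p) where
  toFun z := ⟨leading z.2, leading_mem_cocycles h z.2⟩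
  map_add' z z' := Subtype.ext (leading_add z.2 z'.2 (z + z').2)
  map_smul' c z := Subtype.ext (leading_smul z.2 c (c • z).2)

/-- The second page of the spectral sequence computes `Ext` over the homology algebra. -/
theorem nonempty_page_two_equiv (b : ∀ p, SplitBasis (V.normalised p)) (p : ℕ) (n : ℤ) :
    Nonempty ((V.barHom W).Page 2 p n ≃ₗ[ℚ] (V.homologyRes h).Ext W.homology p (n + p)) := by
  let f : (V.barHom W).pageCycles 2 p n →ₗ[ℚ] (V.homologyRes h).Ext W.homology p (n + p) :=
    Submodule.mkQ _ ∘ₗ leadingMap V W h p n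
  refine ⟨equivOfKerEq ((V.barHom W).pageMk 2 p n) f ((V.barHom W).pageMk_surjective 2 p n) ?_ ?_⟩
  · intro x
    obtain ⟨⟨φ, hφ⟩, rfl⟩ := Submodule.mkQ_surjective _ x
    obtain ⟨z, hz, e⟩ := exists_leading_eq b p n hφ.1 hφ.2
    exact ⟨⟨z, hz⟩, congrArg (Submodule.mkQ _) (Subtype.ext e)⟩
  · ext z
    rw [LinearMap.mem_ker, LinearMap.mem_ker, FilteredComplex.pageMk_eq_zero]
    refine Iff.trans ?_ (Submodule.Quotient.mk_eq_zero _).symm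
    exact ⟨leading_mem_coboundaries h z.2, mem_pageBoundaries_of_leading h b z.2⟩

/-! ### Exactness in high filtrations -/

/-- The values of `f` on the basis cycles lie in degrees `≥ k + q ≥ l`, where every cycle of `W`
bounds. This is all that `exists_homD_eq` asks for. -/
theorem exists_homD_eq_of_large {k l : ℤ} (hW : ∀ n ≥ l, W.homology.gr n = ⊥) {X : DGMod A}
    (b : SplitBasis X) (hb : ∀ i, k ≤ b.degI i) {q : ℤ} (hq : l ≤ k + q)
    {f : X.carrier →ₗ[ℚ] W.carrier} (hf : f ∈ X.homGr W.toGrMod q) (hdf : X.homD W q f = 0) :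
    ∃ g ∈ X.homGr W.toGrMod (q + 1), X.homD W (q + 1) g = f := by
  refine b.exists_homD_eq hf hdf fun i => ?_
  have h1 := W.cls_mem (z := ⟨_, map_mem_cycles (x := b.basis (.inl i)) hdf (b.d_h i)⟩)
    (hf.1 _ _ (b.h_mem i))
  rw [hW _ (by linarith [hb i]), Submodule.mem_bot] at h1
  exact W.cls_eq_zero.1 h1

/-- In components, `d y = x` says `d y_{j+1} = x_{j+1} + (-1) ^ (n + 1) y_j ∘ δ`, to be solved
recursively in `j`. The right-hand side is a cocycle since `d x = 0`. The infinitely many solutions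
assemble to one map, as no finiteness is imposed on components. -/
theorem exists_homD_eq_of_fil {n p : ℤ}
    (h : ∀ (j : ℕ), p ≤ j → ∀ f ∈ (V.normalised j).homGr W.toGrMod (n + j),
      (V.normalised j).homD W (n + j) f = 0 → ∃ g ∈ (V.normalised j).homGr W.toGrMod (n + j + 1),
        (V.normalised j).homD W (n + j + 1) g = f)
    {x : V.bar.carrier →ₗ[ℚ] W.carrier} (hx : x ∈ V.bar.homGr W.toGrMod n)
    (hxp : x ∈ (V.barHom W).fil p) (hdx : V.bar.homD W n x = 0) :
    ∃ y ∈ V.bar.homGr W.toGrMod (n + 1), y ∈ (V.barHom W).fil p ∧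
      V.bar.homD W (n + 1) y = x := by
  -- Below simplicial degree `p` the primitive is taken to be zero, which keeps `y` in `F^p`.
  have solve : ∀ (j : ℕ), ∀ f ∈ (V.normalised j).homGr W.toGrMod (n + j),
      (V.normalised j).homD W (n + j) f = 0 → ((j : ℤ) < p → f = 0) →
      ∃ g ∈ (V.normalised j).homGr W.toGrMod (n + j + 1), ((j : ℤ) < p → g = 0) ∧
        (V.normalised j).homD W (n + j + 1) g = f := by
    intro j f hf hdf hjf
    by_cases hj : (j : ℤ) < p
    · exact ⟨0, zero_mem _, fun _ => rfl, by rw [map_zero, hjf hj]⟩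
    · obtain ⟨g, hg, e⟩ := h j (not_lt.1 hj) f hf hdf
      exact ⟨g, hg, fun hj' => absurd hj' hj, e⟩
  have hx0 : (V.normalised 0).homD W (n + (0 : ℕ)) (part V W 0 x) = 0 := by
    rw [Nat.cast_zero, add_zero, ← part_zero_homD, hdx, map_zero]
  obtain ⟨u₀, hu₀, hu₀p, e₀⟩ := solve 0 _ (part_mem hx 0) hx0 (mem_fil_iff.1 hxp 0)
  -- The invariant retains only that `d u` and `x_j` agree after composition with `δ`. This makes
  -- the next right-hand side a cocycle, and it propagates because `δ ∘ δ = 0` kills the correction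
  -- term.
  have key := exists_seq (X := fun j => (V.normalised j).carrier →ₗ[ℚ] W.carrier)
    (fun j u => u ∈ (V.normalised j).homGr W.toGrMod (n + j + 1) ∧ ((j : ℤ) < p → u = 0) ∧
      (V.normalised j).homD W (n + j + 1) u ∘ₗ (V.barDelta j).restrictScalars ℚ =
        part V W j x ∘ₗ (V.barDelta j).restrictScalars ℚ)
    (fun j u u' => (V.normalised (j + 1)).homD W (n + (j + 1 : ℕ) + 1) u' =
      part V W (j + 1) x + (-1 : ℚ) ^ (n + 1) • u ∘ₗ (V.barDelta j).restrictScalars ℚ)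
    u₀ ⟨hu₀, hu₀p, by rw [e₀]⟩ ?_
  · obtain ⟨s, hs0, hs, hs'⟩ := key
    obtain ⟨y, hy, e⟩ := exists_part_eq (n := n + 1) s fun j => by
      have := (hs j).1
      rwa [add_right_comm] at this
    refine ⟨y, hy, mem_fil_iff.2 fun j hj => (e j).trans ((hs j).2.1 hj), eq_of_part_eq fun j => ?_⟩
    cases j with
    | zero =>
      rw [part_zero_homD, e, hs0, ← e₀, Nat.cast_zero, add_zero]
    | succ j =>
      rw [part_succ_homD, e, e, add_right_comm n 1, sub_eq_iff_eq_add, ← hs' j, Nat.cast_succ,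
        add_assoc n]
  · rintro j u ⟨hu, hup, e⟩
    have e1 : n + (j : ℤ) + 1 = n + (j + 1 : ℕ) := by push_cast; ring
    have hdp := part_succ_homD n x j
    rw [hdx, map_zero] at hdp
    rw [e1] at hu e hdp
    obtain ⟨u', hu', hup', e'⟩ := solve (j + 1)
      (part V W (j + 1) x + (-1 : ℚ) ^ (n + 1) • u ∘ₗ (V.barDelta j).restrictScalars ℚ)
      (add_mem (part_mem hx _) (Submodule.smul_mem _ _ (barDelta_homGr hu))) (by
        rw [map_add, map_smul, homD_comp u _ (V.barDelta_d j), e, sub_eq_zero.1 hdp.symm,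
          zpow_add_one₀ (by norm_num), mul_neg_one, neg_smul]
        exact add_neg_cancel _) (fun hj => by
        rw [mem_fil_iff.1 hxp _ hj, hup (by push_cast at hj; lia), LinearMap.zero_comp, smul_zero,
          add_zero])
    refine ⟨u', ⟨hu', hup', ?_⟩, e'⟩
    rw [e']
    ext w
    change part V W (j + 1) x _ + (-1 : ℚ) ^ (n + 1) • u (V.barDelta j (V.barDelta (j + 1) w)) = _
    rw [barDelta_barDelta, map_zero, smul_zero, add_zero]
    rfl

end DGMod

end HyperExt

/-! ### The hyper-Ext spectral sequence -/

theorem mainTheorem11 (L : HyperExt.DGLie.{u}) (V W : L.Rep)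
    (hV : V.BoundedBelow) (hW : W.BoundedAbove) :
    ∃ E : HyperExt.SpecSeq.{u},
      Nonempty ((V.barHom W).SpectralSequenceIso E) ∧
      Nonempty (HyperExt.GrMod.ProjRes V.homology) ∧
      (∀ (P : HyperExt.GrMod.ProjRes V.homology) (p : ℕ) (q : ℤ),
        Nonempty ((E.page 2).X ((p : ℤ), q) ≃ₗ[ℚ] P.Ext W.homology p q)) ∧
      (∀ p q : ℤ, p < 0 → Subsingleton ((E.page 2).X (p, q))) ∧
      E.StronglyConverges (fun n => V.Ext W n) (V.barHom W).homologyFil := by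
  obtain ⟨k, hk⟩ := hV
  obtain ⟨l, hl⟩ := hW
  choose b hb using HyperExt.DGMod.exists_splitBasis_degI_ge (HyperExt.DGLie.env_isConnected L) V hk
  have h := fun p => (b p).isProjective_homology
  refine ⟨(V.barHom W).specSeq, ⟨(V.barHom W).specSeqIso⟩, ⟨V.homologyRes h⟩, fun P p q => ?_,
    fun p q hp => (V.barHom W).page_subsingleton_of_neg
      (fun _ hp => HyperExt.DGMod.mem_fil_of_nonpos hp) hp,
    (V.barHom W).stronglyConverges (fun _ hp => HyperExt.DGMod.mem_fil_of_nonpos hp)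
      -- In simplicial degree `j` the basis cycles have degree at least `k + j + 1`, and a map of
      -- degree `n + j` sends them to degree at least `k + n + 2 j + 1`. This is at least `l` once
      -- `j ≥ l - k - n`.
      fun n => ⟨|l - k - n|, fun p hp x hx hxp hdx =>
        HyperExt.DGMod.exists_homD_eq_of_fil (fun j hj f hf hdf => ?_) hx hxp hdx⟩⟩
  -- Total degree `q - p` in filtration `p` corresponds to leading maps of internal degree `(q - p)
  -- + p = q`.
  · obtain ⟨e⟩ := HyperExt.DGMod.nonempty_page_two_equiv (W := W) h b p (q - p)
    obtain ⟨e'⟩ := (V.homologyRes h).nonempty_ext_equiv W.homology P p (q - p + p)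
    have e'' := e.trans e'
    rw [sub_add_cancel] at e''
    exact ⟨e''⟩
  · refine HyperExt.DGMod.exists_homD_eq_of_large hl (b j) (hb j) ?_ hf hdf
    have := le_abs_self (l - k - n)
    lia
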